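/- Let $\Gamma\subset PSL(2,\mathbb R)$ be a strictly hyperbolic Fuchsian group (discrete, every element $\ne 1$ hyperbolic) such that $X=\Gamma\backslash\mathbb H$ is compact; let $\pi:\mathbb H\to X$ be the projection and orient $\mathbb H$ and $X$ by their complex structures. **The double complex.** Let $S_\bullet=S_\bullet(\mathbb H)$ be the complex of integral singular chains with differential $\partial'$ and the left action of $\Gamma$ by translation; make it a right module by $c\cdot\gamma=\gamma^{-1}(c)$. Let $B_\bullet$ be the normalized bar resolution of $\Gamma$: $B_q$ is the free left $\mathbb Z\Gamma$-module on symbols $[\gamma_1|\dots|\gamma_q]$ with all $\gamma_i\neq1$, a symbol with some entry $1$ is set equal to $0$, and $$\partial''[\gamma_1|\dots|\gamma_q]=\gamma_1[\gamma_2|\dots|\gamma_q]+\sum_{k=1}^{q-1}(-1)^k[\gamma_1|\dots|\gamma_k\gamma_{k+1}|\dots|\gamma_q]+(-1)^q[\gamma_1|\dots|\gamma_{q-1}].$$ Put $K_{p,q}=S_p\otimes_{\mathbb Z\Gamma}B_q$ and let $\mathrm{Tot}\,K$ be its total complex, with $\partial=\partial'+(-1)^p\partial''$ on $K_{p,q}$.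 Let $\varepsilon:\mathrm{Tot}\,K\to S_\bullet(X)$ be the chain map with $\varepsilon(c\otimes[\ ])=\pi_*c$ on $K_{p,0}$ and $\varepsilon=0$ on $K_{p,q}$ for $q>0$. **The chain $\Sigma$.** Let $g>1$ and let $\alpha_1,\beta_1,\dots,\alpha_g,\beta_g$ be standard generators of $\Gamma$, i.e. generators all of whose relations follow from $\gamma_1\cdots\gamma_g=1$, where $\gamma_i=[\alpha_i,\beta_i]=\alpha_i\beta_i\alpha_i^{-1}\beta_i^{-1}$. A canonical polygon for them is a closed simple geodesic $4g$-gon in $\mathbb H$ which is a fundamental domain for $\Gamma$ and whose boundary is formed by the consecutive sides $a_1,b_1',-a_1',-b_1,\dots,a_g,b_g',-a_g',-b_g$, where $a_i,b_i$ are oriented geodesic segments, $a_i'=\alpha_i^{-1}(a_i)$, $b_i'=\beta_i^{-1}(b_i)$ and the minus sign denotes reversed orientation (so that $a_i(0)=b_{i-1}(0)$ with $b_0=b_g$). It is viewed as a singular $2$-chain $F$ supported in the polygon, restricting to the canonical local orientation at every interior point, and with $\partial'F=\sum_{i=1}^g(a_i+b_i'-a_i'-b_i)$. Identify $F$ with $F\otimes[\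 ]\in K_{2,0}$ and put $$L=\sum_{i=1}^g\bigl(b_i\otimes[\beta_i]-a_i\otimes[\alpha_i]\bigr)\in K_{1,1},$$ $$V=\sum_{i=1}^g\bigl(a_i(0)\otimes[\alpha_i|\beta_i]-b_i(0)\otimes[\beta_i|\alpha_i]+b_i(0)\otimes[\gamma_i^{-1}|\alpha_i\beta_i]\bigr)-\sum_{i=1}^{g-1}b_g(0)\otimes[\gamma_g^{-1}\cdots\gamma_{i+1}^{-1}|\gamma_i^{-1}]\in K_{0,2},$$ $$\Sigma=F+L-V\in(\mathrm{Tot}\,K)_2 .$$ **Claims.** 1. $\varepsilon$ induces an isomorphism $H_2(\mathrm{Tot}\,K)\cong H_2(X,\mathbb Z)$. 2. For all standard generators and every canonical polygon for them, $\partial\Sigma=0$, and under this isomorphism $[\Sigma]$ corresponds to the fundamental class of $X$ (the class in $H_2(X,\mathbb Z)$ restricting to the canonical local orientation in $H_2(X,X-\{x\};\mathbb Z)$ for every $x\in X$). 3. The class is independent of the choice of the fundamental domain: let $D,D'$ be closed fundamental domains for $\Gamma$ (each is the closure of its interior, its translates cover $\mathbb H$, and the interiors of distinct translates are disjoint), represented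 by singular $2$-chains $F,F'$ (supported in $D$, resp. $D'$, and restricting to the canonical local orientation at every interior point). If $L,L'\in K_{1,1}$ and $V,V'\in K_{0,2}$ are such that $\Sigma=F+L-V$ and $\Sigma'=F'+L'-V'$ are cycles in $\mathrm{Tot}\,K$, then $[\Sigma]=[\Sigma']$ in $H_2(\mathrm{Tot}\,K)$. -/

import Mathlib

open CategoryTheory UpperHalfPlane
open scoped MatrixGroups

noncomputable section

section Bar
variable (k : Type) [CommRing k] (G : Type) [Group G]

/-- The free `kG`-module (`k = ℤ` below) on the symbols `[g₁|…|gₙ]` with all `gᵢ ≠ 1`. -/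
abbrev BarModule (n : ℕ) : Rep.{0} k G := Rep.free k G {g : Fin n → G // ∀ i, g i ≠ 1}

open Classical in
/-- The symbol `[g₁|…|gₙ]`, equal to zero if some `gᵢ = 1`. -/
def barSymbol {n : ℕ} (g : Fin n → G) : (BarModule k G n).V :=
  if h : ∀ i, g i ≠ 1 then Finsupp.single ⟨g, h⟩ (MonoidAlgebra.single 1 1) else 0

/-- `g₀[g₁|…|gₙ] + ∑ⱼ (-1)ʲ⁺¹[g₀|…|gⱼgⱼ₊₁|…|gₙ] + (-1)ⁿ⁺¹[g₀|…|gₙ₋₁]`; the last term is the one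
with `j = n` in the sum over `Fin.contractNth`. -/
def barBoundary {n : ℕ} (g : Fin (n + 1) → G) : (BarModule k G n).V :=
  (BarModule k G n).ρ (g 0) (barSymbol k G (fun i => g i.succ)) +
    ∑ j : Fin (n + 1), (-1 : k) ^ (j.val + 1) • barSymbol k G (j.contractNth (· * ·) g)

/-- The `kG`-linear differential of the normalized bar resolution. -/
def barD (n : ℕ) : BarModule k G (n + 1) ⟶ BarModule k G n :=
  Rep.freeLift k G _ (fun g => barBoundary k G g.1)

variable {k G}

lemma barSymbol_eq_zero {n : ℕ} (g : Fin n → G) (i : Fin n) (h : g i = 1) :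
    barSymbol k G g = 0 := dif_neg fun h' => h' i h

lemma barBoundary_eq_zero {n : ℕ} (g : Fin (n + 1) → G) (i : Fin (n + 1)) (h : g i = 1) :
    barBoundary k G g = 0 := by
  unfold barBoundary
  rcases Fin.eq_zero_or_eq_succ i with rfl | ⟨k, rfl⟩
  · rw [Finset.sum_eq_single (0 : Fin (n + 1))]
    · have : Fin.contractNth 0 (· * ·) g = fun i => g i.succ := by
        funext k
        rcases Nat.eq_zero_or_pos k.val with hk | hk
        · rw [Fin.contractNth_apply_of_eq _ _ _ _ (by simpa using hk)]
          have : k.castSucc = 0 := Fin.ext hk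
          rw [this, h, one_mul]
        · rw [Fin.contractNth_apply_of_gt _ _ _ _ (by simpa using hk)]
      rw [this, h]
      simp
    · intro j _ hj
      have hj0 : 0 < j.val := Nat.pos_of_ne_zero fun h0 => hj (Fin.ext h0)
      have hn : 0 < n := by omega
      rw [barSymbol_eq_zero _ ⟨0, hn⟩, smul_zero]
      rw [Fin.contractNth_apply_of_lt _ _ _ _ (by simpa using hj0)]
      exact h
    · simp
  · rw [barSymbol_eq_zero (fun i => g i.succ) k h, map_zero, zero_add]
    rw [Finset.sum_eq_add k.castSucc k.succ (by simp [Fin.ext_iff])]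
    · have : Fin.contractNth k.castSucc (· * ·) g = Fin.contractNth k.succ (· * ·) g := by
        funext l
        rcases lt_trichotomy l.val k.val with hl | hl | hl
        · rw [Fin.contractNth_apply_of_lt _ _ _ _ (by simpa using hl),
            Fin.contractNth_apply_of_lt _ _ _ _ (by simp; omega)]
        · rw [Fin.contractNth_apply_of_eq _ _ _ _ (by simpa using hl),
            Fin.contractNth_apply_of_lt _ _ _ _ (by simp; omega)]
          obtain rfl : l = k := Fin.ext hl
          rw [h, mul_one]
        · rw [Fin.contractNth_apply_of_gt _ _ _ _ (by simpa using hl)]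
          rcases Nat.lt_or_ge (k.val + 1) l.val with hl' | hl'
          · rw [Fin.contractNth_apply_of_gt _ _ _ _ (by simpa using hl')]
          · have hl2 : l.val = k.val + 1 := by omega
            rw [Fin.contractNth_apply_of_eq _ _ _ _ (by simpa using hl2)]
            have : l.castSucc = k.succ := Fin.ext (by simpa using hl2)
            rw [this, h, one_mul]
      rw [this]
      simp [pow_succ]
    · rintro j _ ⟨hj1, hj2⟩
      have e1 : j.val ≠ k.val := fun e => hj1 (Fin.ext e)
      have e2 : j.val ≠ k.val + 1 := fun e => hj2 (Fin.ext e)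
      rcases lt_or_gt_of_ne e1 with hlt | hgt
      · rw [barSymbol_eq_zero _ k, smul_zero]
        rw [Fin.contractNth_apply_of_gt _ _ _ _ hlt]
        exact h
      · have hk : k.val + 1 < n := by omega
        rw [barSymbol_eq_zero _ ⟨k.val + 1, hk⟩, smul_zero]
        rw [Fin.contractNth_apply_of_lt _ _ _ _ (by simp; omega)]
        exact h
    · simp
    · simp

/-- The projection from the unnormalized bar resolution. -/
def barProj (n : ℕ) : Rep.free k G (Fin n → G) ⟶ BarModule k G n :=
  Rep.freeLift k G _ (fun g => barSymbol k G g)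

lemma barD_symbol {n : ℕ} (g : Fin (n + 1) → G) :
    (barD k G n).hom (barSymbol k G g) = barBoundary k G g := by
  by_cases h : ∀ i, g i ≠ 1
  · rw [barSymbol, dif_pos h]
    simp [barD, ← Representation.IntertwiningMap.toLinearMap_apply]
  · push Not at h
    obtain ⟨i, hi⟩ := h
    rw [barSymbol_eq_zero g i hi, barBoundary_eq_zero g i hi, map_zero]

lemma barProj_single {n : ℕ} (g : Fin n → G) (γ : G) (r : k) :
    (barProj n).hom (Finsupp.single g (MonoidAlgebra.single γ r)) =
      r • (BarModule k G n).ρ γ (barSymbol k G g) := by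
  simp [barProj, ← Representation.IntertwiningMap.toLinearMap_apply]

lemma barProj_comm (n : ℕ) :
    Rep.barComplex.d k G n ≫ barProj n = barProj (n + 1) ≫ barD k G n := by
  refine Rep.free_ext k G _ _ _ fun g => ?_
  rw [Rep.hom_comp, Rep.hom_comp]
  change (barProj n).hom ((Rep.barComplex.d k G n).hom _) = (barD k G n).hom ((barProj (n + 1)).hom _)
  rw [Rep.barComplex.d_single, barProj_single, map_one, one_smul, Module.End.one_apply, barD_symbol,
    map_add, map_sum, barProj_single, one_smul]
  refine congrArg (_ + ·) (Finset.sum_congr rfl fun j _ => ?_)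
  rw [barProj_single, map_one, Module.End.one_apply]

lemma barD_comp (n : ℕ) : barD k G (n + 1) ≫ barD k G n = 0 := by
  have key : barProj (k := k) (n + 2) ≫ barD k G (n + 1) ≫ barD k G n = 0 := by
    rw [← Category.assoc, ← barProj_comm, Category.assoc, ← barProj_comm, ← Category.assoc]
    have h := (Rep.barComplex k G).d_comp_d (n + 2) (n + 1) n
    rw [Rep.barComplex.d_def, Rep.barComplex.d_def] at h
    rw [h, Limits.zero_comp]
  refine Rep.free_ext k G _ _ _ fun g => ?_
  have h := congrArg (fun f => f.hom (Finsupp.single g.1 (MonoidAlgebra.single 1 1))) key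
  simp only [Rep.hom_comp] at h
  have e : (barProj (n + 2)).hom (Finsupp.single g.1 (MonoidAlgebra.single 1 1)) =
      (Finsupp.single g (MonoidAlgebra.single 1 1) : (BarModule k G (n + 2)).V) := by
    rw [barProj_single, map_one, one_smul, Module.End.one_apply, barSymbol, dif_pos g.2]
  change (barD k G (n + 1) ≫ barD k G n).hom ((barProj (n + 2)).hom _) = _ at h
  rw [e] at h
  exact h

variable (k G)

/-- The normalized bar resolution `B_•(kG)`. -/
def barResolution : ChainComplex (Rep.{0} k G) ℕ :=
  ChainComplex.of (fun n => BarModule k G n) (fun n => barD k G n) (fun n => barD_comp n)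

end Bar

section Singular

variable (k : Type) [CommRing k]

/-- The singular chain complex of a space with coefficients in `k`. -/
abbrev Sing (X : TopCat.{0}) : ChainComplex (ModuleCat.{0} k) ℕ :=
  ((AlgebraicTopology.singularChainComplexFunctor (ModuleCat.{0} k)).obj (ModuleCat.of k k)).obj X

/-- The chain map induced by a continuous map. -/
abbrev singMap {X Y : TopCat.{0}} (f : X ⟶ Y) : Sing k X ⟶ Sing k Y :=
  ((AlgebraicTopology.singularChainComplexFunctor (ModuleCat.{0} k)).obj (ModuleCat.of k k)).map f

/-- A singular simplex, as a chain. -/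
def simplexChain {X : TopCat.{0}} {n : ℕ} (σ : C(stdSimplex ℝ (Fin (n + 1)), X)) :
    (Sing k X).X n :=
  (SSet.ιChainComplex (TopCat.toSSet.obj X) (R := ModuleCat.of k k)
    ((X.toSSetObjEquiv (.op (SimplexCategory.mk n))).symm σ)).hom (1 : k)

/-- The chain `c` is a combination of simplices with image in `A`. -/
def ChainIn {X : TopCat.{0}} (A : Set X) {n : ℕ} (c : (Sing k X).X n) : Prop :=
  ∃ e : (Sing k (TopCat.of A)).X n,
    ((singMap k (TopCat.ofHom ⟨Subtype.val, continuous_subtype_val⟩ : TopCat.of A ⟶ X)).f n).hom e = c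

/-- The homology class of a cycle. -/
def homologyClass (C : ChainComplex (ModuleCat.{0} k) ℕ) {n : ℕ} (c : C.X (n + 1))
    (h : (C.d (n + 1) n).hom c = 0) : C.homology (n + 1) :=
  (C.homologyπ (n + 1)).hom
    ((C.liftCycles (A := ModuleCat.of k k) (ModuleCat.ofHom (LinearMap.toSpanSingleton k _ c)) n
      (by simp) (by ext; simpa using h)).hom (1 : k))

variable (G : Type) [Group G] (X : Type) [TopologicalSpace X] [MulAction G X]
  [ContinuousConstSMul G X]

/-- Translation by a group element. -/
def translation (γ : G) : TopCat.of X ⟶ TopCat.of X :=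
  TopCat.ofHom ⟨fun x => γ • x, continuous_const_smul γ⟩

/-- The left action of `G` on singular `n`-chains by translation. -/
def singRep (n : ℕ) : Rep.{0} k G :=
  Rep.of (X := (Sing k (TopCat.of X)).X n)
    { toFun := fun γ => ((singMap k (translation G X γ)).f n).hom
      map_one' := by
        have : translation G X 1 = 𝟙 _ := by ext x; simp [translation]
        rw [this]; simp; rfl
      map_mul' := fun γ δ => by
        have : translation G X (γ * δ) = translation G X δ ≫ translation G X γ := by
          ext x; simp [translation, mul_smul]
        rw [this]; simp; rfl }

/-- The singular chain complex as a complex of left `G`-modules. -/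
def singRepComplex : ChainComplex (Rep.{0} k G) ℕ where
  X n := singRep k G X n
  d i j := Rep.ofHom ⟨((Sing k (TopCat.of X)).d i j).hom, fun γ => by
    have := (singMap k (translation G X γ)).comm i j
    exact congrArg ModuleCat.Hom.hom this⟩
  shape i j h := (forget₂ (Rep.{0} k G) (ModuleCat.{0} k)).map_injective
    ((Sing k (TopCat.of X)).shape i j h)
  d_comp_d' i j l _ _ := (forget₂ (Rep.{0} k G) (ModuleCat.{0} k)).map_injective
    ((Sing k (TopCat.of X)).d_comp_d i j l)

end Singular

section Total

variable (k : Type) [CommRing k]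

variable (G : Type) [Group G] (X : Type) [TopologicalSpace X] [MulAction G X]
  [ContinuousConstSMul G X]

/-- `A ⊗_{kG} B = (A ⊗_k B)_G`, for the right action `a · γ = γ⁻¹ a` on `A`. -/
abbrev tensorZG : Rep.{0} k G ⥤ Rep.{0} k G ⥤ ModuleCat.{0} k := Rep.coinvariantsTensor k G

instance : (tensorZG k G).PreservesZeroMorphisms where
  map_zero A B := by
    apply NatTrans.ext; funext C
    refine Rep.coinvariantsTensor_hom_ext ?_
    refine LinearMap.ext₂ fun a c => ?_
    change Representation.Coinvariants.mk _ ((0 : B.V) ⊗ₜ[k] c) = 0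
    rw [TensorProduct.zero_tmul, map_zero]

/-- `K_{p,q} = S_p ⊗_{kG} B_q`. -/
abbrev biK (p q : ℕ) : ModuleCat.{0} k :=
  ((tensorZG k G).obj ((singRepComplex k G X).X p)).obj ((barResolution k G).X q)

/-- `Tot (S_• ⊗_{kG} B_•)`, with `∂ = ∂' + (-1)ᵖ ∂''` on `K_{p,q}`. -/
abbrev totK : ChainComplex (ModuleCat.{0} k) ℕ :=
  HomologicalComplex.mapBifunctor (singRepComplex k G X) (barResolution k G) (tensorZG k G)
    (ComplexShape.down ℕ)

/-- The inclusion of `K_{p,q}` in the total complex. -/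
def inTot (p q n : ℕ) (h : p + q = n) : biK k G X p q →ₗ[k] (totK k G X).X n :=
  (HomologicalComplex.ιMapBifunctor (singRepComplex k G X) (barResolution k G) (tensorZG k G)
    (ComplexShape.down ℕ) p q n h).hom

/-- `c ⊗ [g₁|…|g_q]`. -/
def chainTensor {p q : ℕ} (c : (Sing k (TopCat.of X)).X p) (g : Fin q → G) : biK k G X p q :=
  Rep.coinvariantsTensorMk ((singRepComplex k G X).X p) ((barResolution k G).X q) c
    (barSymbol k G g)

/-- The quotient map `X → G\X`. -/
def orbitMap : TopCat.of X ⟶ TopCat.of (MulAction.orbitRel.Quotient G X) :=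
  TopCat.ofHom ⟨fun x => Quotient.mk _ x, continuous_quotient_mk'⟩

variable {G X} in
lemma translation_orbitMap (γ : G) : translation G X γ ≫ orbitMap G X = orbitMap G X := by
  ext x
  exact Quotient.sound ⟨γ, rfl⟩

/-- The augmentation `B₀ → k`, `[ ] ↦ 1`. -/
def barAug : BarModule k G 0 ⟶ Rep.trivial k G k :=
  Rep.freeLift k G _ fun _ => (1 : k)

lemma barAug_symbol (g : Fin 0 → G) : (barAug k G).hom (barSymbol k G g) = (1 : k) := by
  rw [barSymbol, dif_pos (fun i => i.elim0)]
  simp [barAug, ← Representation.IntertwiningMap.toLinearMap_apply]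

lemma barD_barAug : barD k G 0 ≫ barAug k G = 0 := by
  refine Rep.free_ext k G _ _ _ fun g => ?_
  change (barAug k G).hom ((barD k G 0).hom _) = 0
  have e : (Finsupp.single g (MonoidAlgebra.single 1 1) : (BarModule k G 1).V) =
      barSymbol k G g.1 := by rw [barSymbol, dif_pos g.2]
  have h1 : ∀ j : Fin 1, (-1 : k) ^ (j.val + 1) = -1 := fun j => by simp
  rw [e, barD_symbol, barBoundary, map_add, Rep.hom_comm_apply, barAug_symbol, map_sum,
    Fin.sum_univ_one, h1, map_smul, barAug_symbol]
  simp

/-- `S_p ⊗_{kG} B_0 → S_p(G\X)`, `c ⊗ [ ] ↦ π_* c`. -/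
def biKAug (p : ℕ) : biK k G X p 0 ⟶ (Sing k (TopCat.of (MulAction.orbitRel.Quotient G X))).X p :=
  ModuleCat.ofHom (Representation.Coinvariants.lift _
    (TensorProduct.lift ((LinearMap.lsmul k _).flip.compl₁₂
      ((singMap k (orbitMap G X)).f p).hom (barAug k G).hom.toLinearMap))
    (fun γ => by
      refine TensorProduct.ext' fun c b => ?_
      have h1 : ((singMap k (orbitMap G X)).f p).hom (((singMap k (translation G X γ)).f p).hom c) =
          ((singMap k (orbitMap G X)).f p).hom c := by
        have := congrArg (fun f => ((singMap k f).f p).hom c) (translation_orbitMap (X := X) γ)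
        simp only [singMap, Functor.map_comp] at this
        exact this
      have h2 : (barAug k G).hom ((BarModule k G 0).ρ γ b) = (barAug k G).hom b :=
        Rep.hom_comm_apply (barAug k G) γ b
      change (barAug k G).hom ((BarModule k G 0).ρ γ b) •
        ((singMap k (orbitMap G X)).f p).hom (((singMap k (translation G X γ)).f p).hom c) =
          (barAug k G).hom b • ((singMap k (orbitMap G X)).f p).hom c
      rw [h1, h2]))

lemma biKAug_mk (p : ℕ) (c : (Sing k (TopCat.of X)).X p) (b : (BarModule k G 0).V) :
    (biKAug k G X p).hom (Rep.coinvariantsTensorMk ((singRepComplex k G X).X p)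
      ((barResolution k G).X 0) c b) =
      ((barAug k G).hom b : k) • ((singMap k (orbitMap G X)).f p).hom c := rfl

lemma biKAug_d (p : ℕ) :
    ((tensorZG k G).map ((singRepComplex k G X).d (p + 1) p)).app ((barResolution k G).X 0) ≫
      biKAug k G X p = biKAug k G X (p + 1) ≫ (Sing k _).d (p + 1) p := by
  refine Rep.coinvariantsTensor_hom_ext (LinearMap.ext₂ fun c b => ?_)
  have h := congrArg (fun f => f.hom c) ((singMap k (orbitMap G X)).comm (p + 1) p)
  change ((barAug k G).hom b : k) • ((singMap k (orbitMap G X)).f p).hom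
      (((Sing k (TopCat.of X)).d (p + 1) p).hom c) =
    ((Sing k _).d (p + 1) p).hom
      (((barAug k G).hom b : k) • ((singMap k (orbitMap G X)).f (p + 1)).hom c)
  rw [map_smul]
  exact congrArg (((barAug k G).hom b : k) • ·) h.symm

lemma barResolution_d_biKAug (p : ℕ) :
    ((tensorZG k G).obj ((singRepComplex k G X).X p)).map ((barResolution k G).d 1 0) ≫
      biKAug k G X p = 0 := by
  refine Rep.coinvariantsTensor_hom_ext (LinearMap.ext₂ fun c b => ?_)
  have h : (barAug k G).hom (((barResolution k G).d 1 0).hom b) = (0 : k) := by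
    have e : (barResolution k G).d 1 0 = barD k G 0 := by
      unfold barResolution
      simpa using ChainComplex.of_d (fun n => BarModule k G n) (fun n => barD k G n) 0
    rw [e]
    exact congrArg (fun f => f.hom b) (barD_barAug k G)
  change ((barAug k G).hom (((barResolution k G).d 1 0).hom b) : k) •
    ((singMap k (orbitMap G X)).f p).hom c = 0
  rw [h, zero_smul]

/-- The components of the augmentation; they vanish on `K_{p,q}` for `q > 0`. -/
def totAugComponent (n : ℕ) : ∀ p q : ℕ, p + q = n →
    (biK k G X p q ⟶ (Sing k (TopCat.of (MulAction.orbitRel.Quotient G X))).X n)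
  | p, 0, h => biKAug k G X p ≫ (HomologicalComplex.XIsoOfEq _ h).hom
  | _, _ + 1, _ => 0

lemma totAug_d₁_eq_zero (p q m : ℕ) (h : p + (q + 1) = m + 1) :
    HomologicalComplex.mapBifunctor.d₁ (singRepComplex k G X) (barResolution k G) (tensorZG k G)
      (ComplexShape.down ℕ) p (q + 1) m ≫
      HomologicalComplex.mapBifunctorDesc (totAugComponent k G X m) = 0 := by
  cases p with
  | zero =>
    rw [HomologicalComplex.mapBifunctor.d₁_eq_zero _ _ _ _ _ _ _ (by simp), Limits.zero_comp]
  | succ p =>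
    have h' : p + (q + 1) = m := by omega
    rw [HomologicalComplex.mapBifunctor.d₁_eq _ _ _ _ (i₁' := p) (by simp) (q + 1) m h',
      Linear.units_smul_comp, Category.assoc, HomologicalComplex.ι_mapBifunctorDesc]
    have e : totAugComponent k G X m p (q + 1) h' = 0 := rfl
    erw [e, Limits.comp_zero, smul_zero]

/-- `Tot (S_• ⊗_{kG} B_•) → S_•(G\X)`, the map `c ⊗ [ ] ↦ π_* c` on `K_{p,0}` and zero on
`K_{p,q}` with `q > 0`. -/
def totAug : totK k G X ⟶ Sing k (TopCat.of (MulAction.orbitRel.Quotient G X)) where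
  f n := HomologicalComplex.mapBifunctorDesc (totAugComponent k G X n)
  comm' n m hnm := by
    obtain rfl : m + 1 = n := hnm
    refine HomologicalComplex.mapBifunctor.hom_ext fun p q h => ?_
    rw [HomologicalComplex.ι_mapBifunctorDesc_assoc, HomologicalComplex.mapBifunctor.d_eq,
      Preadditive.add_comp, Preadditive.comp_add, ← Category.assoc, ← Category.assoc,
      HomologicalComplex.mapBifunctor.ι_D₁, HomologicalComplex.mapBifunctor.ι_D₂]
    have h' : p + q = m + 1 := h
    match q, h' with
    | 0, h' =>
      obtain rfl : p = m + 1 := h'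
      rw [HomologicalComplex.mapBifunctor.d₂_eq_zero _ _ _ _ _ _ _ (by simp),
        HomologicalComplex.mapBifunctor.d₁_eq _ _ _ _ (i₁' := m) (by simp) 0 m rfl,
        Limits.zero_comp, add_zero, Linear.units_smul_comp, Category.assoc,
        HomologicalComplex.ι_mapBifunctorDesc]
      have h0 := biKAug_d k G X m
      have e1 : totAugComponent k G X (m + 1) (m + 1) 0 rfl = biKAug k G X (m + 1) :=
        Category.comp_id _
      have e2 : totAugComponent k G X m m 0 rfl = biKAug k G X m := Category.comp_id _
      erw [e1, e2, h0, one_smul]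
    | 1, h' =>
      obtain rfl : p = m := by omega
      rw [totAug_d₁_eq_zero k G X p 0 p rfl,
        HomologicalComplex.mapBifunctor.d₂_eq _ _ _ _ p (i₂ := 1) (i₂' := 0) (by simp) p rfl,
        Linear.units_smul_comp, Category.assoc, HomologicalComplex.ι_mapBifunctorDesc]
      have e2 : totAugComponent k G X p p 0 rfl = biKAug k G X p := Category.comp_id _
      have e3 : totAugComponent k G X (p + 1) p 1 h = 0 := rfl
      have h0 := barResolution_d_biKAug k G X p
      erw [e2, h0, e3, smul_zero, Limits.zero_comp, add_zero]
    | q + 2, h' =>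
      have e : p + (q + 1) = m := by omega
      rw [totAug_d₁_eq_zero k G X p (q + 1) m h',
        HomologicalComplex.mapBifunctor.d₂_eq _ _ _ _ p (i₂ := q + 2) (i₂' := q + 1) (by simp) m e,
        Linear.units_smul_comp, Category.assoc, HomologicalComplex.ι_mapBifunctorDesc]
      have e2 : totAugComponent k G X m p (q + 1) e = 0 := rfl
      have e3 : totAugComponent k G X (m + 1) p (q + 2) h = 0 := rfl
      erw [e2, e3, Limits.comp_zero, smul_zero, Limits.zero_comp, add_zero]

end Total

section Fuchsian

/-- `[a, b] = a b a⁻¹ b⁻¹`. -/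
def groupComm {G : Type} [Group G] (a b : G) : G := a * b * a⁻¹ * b⁻¹

/-- `PSL(2, ℝ)` acts on the upper half-plane by fractional linear transformations. -/
instance pslAction : MulAction PSL(2, ℝ) ℍ :=
  MulAction.compHom ℍ (Matrix.ProjectiveSpecialLinearGroup.toPGL (n := Fin 2) (R := ℝ))

lemma pslMk_smul (A : SL(2, ℝ)) (z : ℍ) : (QuotientGroup.mk A : PSL(2, ℝ)) • z = A • z := rfl

instance : ContinuousConstSMul PSL(2, ℝ) ℍ where
  continuous_const_smul γ := by
    induction γ using QuotientGroup.induction_on with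
    | H A => exact continuous_const_smul A

instance (Γ : Subgroup PSL(2, ℝ)) : ContinuousConstSMul Γ ℍ :=
  ⟨fun γ => continuous_const_smul (γ : PSL(2, ℝ))⟩

/-- A strictly hyperbolic Fuchsian group: a discrete subgroup of `PSL(2, ℝ)` all of whose
non-identity elements are hyperbolic. -/
structure IsStrictlyHyperbolicFuchsian (Γ : Subgroup PSL(2, ℝ)) : Prop where
  discrete : DiscreteTopology Γ
  hyperbolic : ∀ A : SL(2, ℝ), (QuotientGroup.mk A : PSL(2, ℝ)) ∈ Γ →
    (QuotientGroup.mk A : PSL(2, ℝ)) ≠ 1 → A.val.IsHyperbolic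

/-- `α, β` is a system of standard generators: they generate the group, and all the relations
between them follow from `[α₁, β₁] ⋯ [α_g, β_g] = 1`. -/
def IsMarking {G : Type} [Group G] {g : ℕ} (α β : Fin g → G) : Prop :=
  Function.Surjective (FreeGroup.lift (Sum.elim α β)) ∧
    (FreeGroup.lift (Sum.elim α β)).ker = Subgroup.normalClosure
      {(List.ofFn fun i : Fin g =>
        groupComm (FreeGroup.of (Sum.inl i : Fin g ⊕ Fin g)) (FreeGroup.of (Sum.inr i))).prod}

/-- The positively oriented Euclidean triangle with vertices `z + r, z + ir, z - r - ir`, as a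
singular simplex. -/
def orientedTriangle (z : ℍ) (r : ℝ) (h0 : 0 < r) (h1 : r < z.im) :
    C(stdSimplex ℝ (Fin 3), ℍ) where
  toFun x := ⟨z + r * ((x 0 - x 2 : ℝ) + (x 1 - x 2 : ℝ) * Complex.I), by
    have a := x.2.1 1
    have b := x.2.1 0
    have c := x.2.2
    rw [Fin.sum_univ_three] at c
    have : -1 ≤ (x 1 - x 2 : ℝ) := by
      have a : 0 ≤ x 1 := a
      have b : 0 ≤ x 0 := b
      have c : x 0 + x 1 + x 2 = 1 := c
      linarith
    simp
    nlinarith⟩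
  continuous_toFun := by
    rw [UpperHalfPlane.isEmbedding_coe.continuous_iff]
    change Continuous fun x : stdSimplex ℝ (Fin 3) =>
      (z + r * ((x 0 - x 2 : ℝ) + (x 1 - x 2 : ℝ) * Complex.I) : ℂ)
    have h (i : Fin 3) : Continuous fun x : stdSimplex ℝ (Fin 3) => x i :=
      (continuous_apply i).comp continuous_subtype_val
    refine continuous_const.add (continuous_const.mul ((Complex.continuous_ofReal.comp
      ((h 0).sub (h 2))).add ((Complex.continuous_ofReal.comp ((h 1).sub (h 2))).mul
        continuous_const)))

/-- For a map `π : ℍ → Y` that is a homeomorphism near `z`, the singular chain `c` of `Y` represents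
in `H_n(Y, Y - π(z))` the image of the canonical local orientation of `ℍ` at `z`. -/
def HasLocalOrientation {Y : TopCat.{0}} (π : TopCat.of ℍ ⟶ Y) (c : (Sing ℤ Y).X 2) (z : ℍ) :
    Prop :=
  ∃ ε > 0, ∀ r (h0 : 0 < r) (h1 : r < z.im), r < ε →
    ∃ e : (Sing ℤ Y).X 3, ChainIn ℤ {π z}ᶜ
      (c - ((singMap ℤ π).f 2).hom (simplexChain ℤ (orientedTriangle z r h0 h1)) -
        ((Sing ℤ Y).d 3 2).hom e)

variable (Γ : Subgroup PSL(2, ℝ))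

/-- The surface `X = Γ\ℍ`. -/
abbrev surface : TopCat.{0} := TopCat.of (MulAction.orbitRel.Quotient Γ ℍ)

/-- `u ∈ H₂(X, ℤ)` is the fundamental class of `X = Γ\ℍ`: its image in `H₂(X, X - x; ℤ)` is, for
every `x ∈ X`, the local orientation given by the complex structure. -/
def IsFundamentalClass (u : (Sing ℤ (surface Γ)).homology 2) : Prop :=
  ∃ (c : (Sing ℤ (surface Γ)).X 2) (hc : ((Sing ℤ (surface Γ)).d 2 1).hom c = 0),
    homologyClass ℤ _ c hc = u ∧ ∀ z : ℍ, HasLocalOrientation (orbitMap Γ ℍ) c z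

/-- A (closed) fundamental domain for `Γ`: a set which is the closure of its interior, whose
translates cover `ℍ`, the interiors of distinct translates being disjoint. -/
structure IsFundamentalDomain (D : Set ℍ) : Prop where
  closure_interior : closure (interior D) = D
  covers : ∀ z : ℍ, ∃ γ : Γ, γ • z ∈ D
  disjoint : ∀ γ : Γ, γ ≠ 1 → ∀ z ∈ interior D, γ • z ∉ interior D

/-- The singular `2`-chain `F` represents the region `D`: its simplices lie in `D` and it restricts
to the canonical orientation at every interior point of `D`. -/
structure IsFundamentalChain (D : Set ℍ) (F : (Sing ℤ (TopCat.of ℍ)).X 2) : Prop where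
  chainIn : ChainIn ℤ D F
  orientation : ∀ z ∈ interior D, HasLocalOrientation (𝟙 (TopCat.of ℍ)) F z

/-- A path, as a singular `1`-simplex from `p 0` to `p 1`. -/
def pathChain (p : C(unitInterval, ℍ)) : (Sing ℤ (TopCat.of ℍ)).X 1 :=
  simplexChain ℤ (X := TopCat.of ℍ) ⟨fun x : stdSimplex ℝ (Fin 2) => p ⟨x 1, x.2.1 1, by
    have := x.2.1 0
    have h := x.2.2
    rw [Fin.sum_univ_two] at h
    change x.1 1 ≤ 1
    linarith⟩, p.continuous.comp
      (((continuous_apply 1).comp continuous_subtype_val).subtype_mk _)⟩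

/-- A point, as a singular `0`-simplex. -/
def pointChain (z : ℍ) : (Sing ℤ (TopCat.of ℍ)).X 0 :=
  simplexChain ℤ (X := TopCat.of ℍ) (ContinuousMap.const _ z)

variable {Γ}

/-- `γ⁻¹` applied to a path. -/
def pullPath (γ : Γ) (p : C(unitInterval, ℍ)) : C(unitInterval, ℍ) :=
  ⟨fun t => γ⁻¹ • p t, p.continuous.const_smul γ⁻¹⟩

/-- The reversed path. -/
def reversePath (p : C(unitInterval, ℍ)) : C(unitInterval, ℍ) :=
  p.comp ⟨unitInterval.symm, unitInterval.continuous_symm⟩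

/-- The sides of the polygon, in the order and with the orientation in which they are traversed by
its boundary: `a_i`, `b_i' = β_i⁻¹(b_i)`, the reverse of `a_i' = α_i⁻¹(a_i)`, the reverse of `b_i`. -/
def polygonSide {g : ℕ} (α β : Fin g → Γ) (a b : Fin g → C(unitInterval, ℍ)) (i : Fin g) :
    Fin 4 → C(unitInterval, ℍ) :=
  ![a i, pullPath (β i) (b i), reversePath (pullPath (α i) (a i)), reversePath (b i)]

/-- A canonical fundamental polygon for the standard generators `α, β`: a closed non-Euclidean
`4g`-gon in `ℍ` which is a fundamental domain for `Γ`, with consecutive sides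
`a₁, b₁', -a₁', -b₁, …, a_g, b_g', -a_g', -b_g`, where `a_i' = α_i⁻¹(a_i)`, `b_i' = β_i⁻¹(b_i)`,
viewed as a singular chain with boundary `∑ (a_i + b_i' - a_i' - b_i)`. -/
structure CanonicalPolygon {g : ℕ} (α β : Fin g → Γ) where
  /-- the edges `a_i` -/
  a : Fin g → C(unitInterval, ℍ)
  /-- the edges `b_i` -/
  b : Fin g → C(unitInterval, ℍ)
  /-- the polygon as a set -/
  carrier : Set ℍ
  /-- the polygon as a singular chain -/
  chain : (Sing ℤ (TopCat.of ℍ)).X 2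
  fundamentalDomain : IsFundamentalDomain Γ carrier
  geodesic_a : ∀ i, Set.range (a i) =
    {z | dist (a i 0) z + dist z (a i 1) = dist (a i 0) (a i 1)}
  geodesic_b : ∀ i, Set.range (b i) =
    {z | dist (b i 0) z + dist z (b i 1) = dist (b i 0) (b i 1)}
  consecutive : ∀ i (j : Fin 3),
    polygonSide α β a b i j.castSucc 1 = polygonSide α β a b i j.succ 0
  consecutive' : ∀ i, polygonSide α β a b i 3 1 = polygonSide α β a b (finRotate g i) 0 0
  simple : Set.InjOn (fun p : (Fin g × Fin 4) × unitInterval => polygonSide α β a b p.1.1 p.1.2 p.2)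
    {p | p.2 ≠ 1}
  frontier_carrier : frontier carrier = ⋃ i, ⋃ j, Set.range (polygonSide α β a b i j)
  fundamentalChain : IsFundamentalChain carrier chain
  boundary_chain : ((Sing ℤ (TopCat.of ℍ)).d 2 1).hom chain =
    ∑ i, (pathChain (a i) + pathChain (pullPath (β i) (b i)) - pathChain (pullPath (α i) (a i)) -
      pathChain (b i))

/-- `F = F ⊗ [ ]` as an element of `K_{2,0}`. -/
def cornerF (F : (Sing ℤ (TopCat.of ℍ)).X 2) : biK ℤ Γ ℍ 2 0 :=
  chainTensor ℤ Γ ℍ F ![]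

/-- `L = ∑ᵢ (b_i ⊗ [β_i] - a_i ⊗ [α_i])`. -/
def edgeL {g : ℕ} (α β : Fin g → Γ) (a b : Fin g → C(unitInterval, ℍ)) : biK ℤ Γ ℍ 1 1 :=
  ∑ i, (chainTensor ℤ Γ ℍ (pathChain (b i)) ![β i] - chainTensor ℤ Γ ℍ (pathChain (a i)) ![α i])

/-- With `γ_i = [α_i, β_i]`,
`V = ∑_{i=1}^g (a_i(0) ⊗ [α_i|β_i] - b_i(0) ⊗ [β_i|α_i] + b_i(0) ⊗ [γ_i⁻¹|α_iβ_i])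
  - ∑_{i=1}^{g-1} b_g(0) ⊗ [γ_g⁻¹⋯γ_{i+1}⁻¹|γ_i⁻¹]`. -/
def vertexV {g : ℕ} (hg : 0 < g) (α β : Fin g → Γ) (a b : Fin g → C(unitInterval, ℍ)) :
    biK ℤ Γ ℍ 0 2 :=
  ∑ i, (chainTensor ℤ Γ ℍ (pointChain (a i 0)) ![α i, β i] -
      chainTensor ℤ Γ ℍ (pointChain (b i 0)) ![β i, α i] +
      chainTensor ℤ Γ ℍ (pointChain (b i 0)) ![(groupComm (α i) (β i))⁻¹, α i * β i]) -
    ∑ i : Fin g with i.val + 1 < g,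
      chainTensor ℤ Γ ℍ (pointChain (b ⟨g - 1, by omega⟩ 0))
        ![(((List.ofFn fun j => (groupComm (α j) (β j))⁻¹).drop (i.val + 1)).reverse).prod,
          (groupComm (α i) (β i))⁻¹]

/-- `Σ = F + L - V` in the total complex. -/
def sigmaChain (F : (Sing ℤ (TopCat.of ℍ)).X 2) (L : biK ℤ Γ ℍ 1 1) (V : biK ℤ Γ ℍ 0 2) :
    (totK ℤ Γ ℍ).X 2 :=
  inTot ℤ Γ ℍ 2 0 2 rfl (cornerF F) + inTot ℤ Γ ℍ 1 1 2 rfl L - inTot ℤ Γ ℍ 0 2 2 rfl V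

end Fuchsian

end

/-!
The double complex `K = S ⊗ B` is compared with the singular chains of the surface `X = Γ\ℍ` through
its rows, in which the singular degree is fixed. The group acts freely and properly discontinuously,
so `ℍ → X` is a covering, every simplex of `X` lifts, and the lifts of a simplex form one free orbit
(`LiftsSimplices`). After a choice of a representative in each orbit of simplices, the contraction
`γ[γ₁|…|γₙ] ↦ [γ|γ₁|…|γₙ]` of the bar resolution contracts the rows (`rowCone`): they are resolutions
of the modules `S_p(X)`. A zigzag through the exact rows then shows that the augmentation is an
isomorphism on `H₂` (`bijective_homologyMap_totAug`).

That `Σ = F + L - V` is a cycle for a canonical polygon means `∂'F = ∂''L` and `∂'L = ∂''V`. The first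
equation is the pairing of the sides. In the second, the vertex terms of index `i` of `V` bound the
ends of the edges up to `b_i(0) ⊗ [γ_i⁻¹]`, and these remainders are bounded by the last sum of `V`,
which telescopes because the product of the commutators is trivial (`CanonicalPolygon.d_sigmaChain`).

The augmentation sends any cycle `F + L - V` to the projection of `F`, whatever `L` and `V` are. If
`F` represents a fundamental domain `D`, this projection has the correct local orientation at the
images of the interior points of `D`, since the other translates of such a point avoid `D` and
fractional linear transformations preserve the orientation (`IsFundamentalChain.relNull_proj`,
`relNull_triangleChain_smul`). The translates of the interior of `D` are dense, and the class of a
cycle at a point is determined by its class at any other point of a small disc; so the orientation is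
correct everywhere (`IsFundamentalChain.hasLocalOrientation`).

Finally, a `2`-cycle of `X` is determined up to homology by its local classes
(`exists_dS_eq_of_local`). By compactness `X` is covered by finitely many small discs, all of whose
intersections are convex sets in a chart, because hyperbolic discs are Euclidean discs. Relative to
the complement of a convex set in a chart, homology vanishes in degrees at least `3` and classes are
detected at one point. Relative Mayer–Vietoris (`RelNull.union`) then glues: a cycle that is locally
null is null relative to the complement of the union of the discs, that is, it bounds. This makes the
fundamental class unique (`IsFundamentalClass.unique`), and with the injectivity of the augmentation
on `H₂` it makes the class of `Σ` independent of the fundamental domain.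

Excision and Mayer–Vietoris rest on barycentric subdivision, which is carried out for chains that are
finitely supported functions on the singular simplices (`SChain`, identified with Mathlib's singular
chains by `singEquiv`). Relative homology appears through the predicates `RelCycle` and `RelNull`.
-/

noncomputable section

lemma moduleCat_hom_congr {M N : ModuleCat.{0} ℤ} {f g : M ⟶ N} (h : f = g) (x : M) :
    f.hom x = g.hom x := h ▸ rfl

/-! ### Singular chains as finitely supported functions -/

/-- Singular `n`-chains of `X`, as finitely supported functions on the singular simplices. -/
abbrev SChain (X : Type) [TopologicalSpace X] (n : ℕ) : Type :=
  C(stdSimplex ℝ (Fin (n + 1)), X) →₀ ℤ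

/-- The `i`-th face of the standard simplex. -/
def stdFace (n : ℕ) (i : Fin (n + 2)) :
    C(stdSimplex ℝ (Fin (n + 1)), stdSimplex ℝ (Fin (n + 2))) :=
  ⟨stdSimplex.map i.succAbove, stdSimplex.continuous_map _⟩

section
variable {X Y Z : Type} [TopologicalSpace X] [TopologicalSpace Y] [TopologicalSpace Z]

/-- The singular differential. -/
def dS (n : ℕ) : SChain X (n + 1) →ₗ[ℤ] SChain X n :=
  Finsupp.linearCombination ℤ fun σ =>
    ∑ i : Fin (n + 2), (-1 : ℤ) ^ i.val • Finsupp.single (σ.comp (stdFace n i)) 1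

/-- The map on singular chains induced by a continuous map. -/
def pushS (f : C(X, Y)) (n : ℕ) : SChain X n →ₗ[ℤ] SChain Y n :=
  Finsupp.lmapDomain ℤ ℤ f.comp

lemma dS_single {n : ℕ} (σ : C(stdSimplex ℝ (Fin (n + 2)), X)) :
    dS n (Finsupp.single σ 1) =
      ∑ i : Fin (n + 2), (-1 : ℤ) ^ i.val • Finsupp.single (σ.comp (stdFace n i)) 1 := by
  simp [dS]

lemma pushS_single (f : C(X, Y)) {n : ℕ} (σ : C(stdSimplex ℝ (Fin (n + 1)), X)) (r : ℤ) :
    pushS f n (Finsupp.single σ r) = Finsupp.single (f.comp σ) r := by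
  simp [pushS]

lemma SChain.hom_ext {n : ℕ} {M : Type*} [AddCommGroup M] [Module ℤ M] {f g : SChain X n →ₗ[ℤ] M}
    (h : ∀ σ, f (Finsupp.single σ 1) = g (Finsupp.single σ 1)) : f = g :=
  Finsupp.lhom_ext' fun σ => LinearMap.ext_ring (h σ)

lemma pushS_comp (f : C(X, Y)) (g : C(Y, Z)) (n : ℕ) (c : SChain X n) :
    pushS (g.comp f) n c = pushS g n (pushS f n c) := by
  simp only [pushS, Finsupp.lmapDomain_apply, ← Finsupp.mapDomain_comp]
  rfl

lemma pushS_id (n : ℕ) (c : SChain X n) : pushS (ContinuousMap.id X) n c = c := by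
  have : (ContinuousMap.id X).comp (α := stdSimplex ℝ (Fin (n + 1))) = id := by
    funext; rfl
  simp [pushS, this]

lemma dS_pushS (f : C(X, Y)) (n : ℕ) (c : SChain X (n + 1)) :
    dS n (pushS f (n + 1) c) = pushS f n (dS n c) := by
  suffices h : (dS n).comp (pushS f (n + 1)) = (pushS f n).comp (dS n) from congrArg (· c) h
  refine SChain.hom_ext fun σ => ?_
  simp only [LinearMap.comp_apply, pushS_single, dS_single, map_sum, map_smul]
  rfl

lemma pushS_injective {f : C(X, Y)} (hf : Function.Injective f) (n : ℕ) :
    Function.Injective (pushS f n) :=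
  Finsupp.mapDomain_injective fun _ _ h => ContinuousMap.ext fun x =>
    hf (congrArg (fun k => k x) h)

/-- The singular `n`-chains all of whose simplices lie in `A`. -/
def chainsIn (A : Set X) (n : ℕ) : Submodule ℤ (SChain X n) :=
  Finsupp.supported ℤ ℤ {σ | Set.range σ ⊆ A}

lemma chainsIn_mono {A B : Set X} (h : A ⊆ B) (n : ℕ) : chainsIn A n ≤ chainsIn B n :=
  Finsupp.supported_mono fun _ hσ => hσ.trans h

lemma single_mem_chainsIn {A : Set X} {n : ℕ} {σ : C(stdSimplex ℝ (Fin (n + 1)), X)}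
    (h : ∀ t, σ t ∈ A) (r : ℤ) : Finsupp.single σ r ∈ chainsIn A n :=
  Finsupp.single_mem_supported ℤ r (Set.range_subset_iff.2 h)

lemma chainsIn_univ (n : ℕ) (c : SChain X n) : c ∈ chainsIn Set.univ n := by
  simp [chainsIn]

lemma chainsIn_empty {n : ℕ} {c : SChain X n} (h : c ∈ chainsIn ∅ n) : c = 0 := by
  rw [chainsIn, Finsupp.mem_supported] at h
  rw [← Finsupp.support_eq_empty]
  refine Finset.eq_empty_of_forall_notMem fun σ hσ => ?_
  exact (h hσ) ⟨Classical.arbitrary _, rfl⟩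

lemma chainsIn_inter {A B : Set X} {n : ℕ} {c : SChain X n} (hA : c ∈ chainsIn A n)
    (hB : c ∈ chainsIn B n) : c ∈ chainsIn (A ∩ B) n := by
  rw [chainsIn, Finsupp.mem_supported] at *
  exact fun σ hσ => Set.subset_inter (hA hσ) (hB hσ)

/-- To check that a linear map sends chains in `A` into a submodule, check it on simplices. -/
lemma map_chainsIn {A : Set X} {n : ℕ} {M : Type*} [AddCommGroup M] [Module ℤ M]
    (f : SChain X n →ₗ[ℤ] M)
    (N : Submodule ℤ M)
    (h : ∀ σ : C(stdSimplex ℝ (Fin (n + 1)), X), (∀ t, σ t ∈ A) → f (Finsupp.single σ 1) ∈ N)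
    {c : SChain X n} (hc : c ∈ chainsIn A n) : f c ∈ N := by
  rw [chainsIn, Finsupp.supported_eq_span_single] at hc
  have : Submodule.span ℤ ((fun σ => Finsupp.single σ (1 : ℤ)) ''
      {σ : C(stdSimplex ℝ (Fin (n + 1)), X) | Set.range σ ⊆ A}) ≤ N.comap f := by
    rw [Submodule.span_le]
    rintro _ ⟨σ, hσ, rfl⟩
    exact h σ (Set.range_subset_iff.1 hσ)
  exact this hc

lemma dS_mem_chainsIn {A : Set X} {n : ℕ} {c : SChain X (n + 1)} (hc : c ∈ chainsIn A (n + 1)) :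
    dS n c ∈ chainsIn A n := by
  refine map_chainsIn (dS n) _ (fun σ hσ => ?_) hc
  rw [dS_single]
  exact Submodule.sum_mem _ fun i _ => Submodule.smul_mem _ _
    (single_mem_chainsIn (fun t => hσ (stdFace n i t)) 1)

lemma pushS_mem_chainsIn {A : Set X} {B : Set Y} {f : C(X, Y)} (h : Set.MapsTo f A B) {n : ℕ}
    {c : SChain X n} (hc : c ∈ chainsIn A n) : pushS f n c ∈ chainsIn B n := by
  refine map_chainsIn (pushS f n) _ (fun σ hσ => ?_) hc
  rw [pushS_single]
  exact single_mem_chainsIn (fun t => h (hσ t)) 1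

/-- Chains in the image of an embedding lift. -/
lemma exists_pushS_eq {f : C(X, Y)} (hf : Topology.IsEmbedding f) {B : Set Y} {n : ℕ}
    {c : SChain Y n} (hc : c ∈ chainsIn B n) (hB : B ⊆ Set.range f) :
    ∃ e : SChain X n, e ∈ chainsIn (f ⁻¹' B) n ∧ pushS f n e = c := by
  suffices h : c ∈ (chainsIn (f ⁻¹' B) n).map (pushS f n) from h
  refine map_chainsIn LinearMap.id _ (fun σ hσ => ?_) hc
  choose g hg using fun t => hB (hσ t)
  have hgc : Continuous g := by
    rw [hf.continuous_iff]
    have : f ∘ g = σ := funext hg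
    rw [this]; exact σ.continuous
  refine ⟨Finsupp.single ⟨g, hgc⟩ 1, single_mem_chainsIn (fun t => ?_) 1, ?_⟩
  · change f (g t) ∈ B
    rw [hg]; exact hσ t
  · rw [pushS_single]
    exact congrArg (fun τ => Finsupp.single τ (1 : ℤ)) (ContinuousMap.ext hg)

/-- An injective map detects whether a chain lies in the preimage of a set. -/
lemma mem_chainsIn_of_pushS {f : C(X, Y)} (hf : Function.Injective f) {B : Set Y} {n : ℕ}
    {c : SChain X n} (hc : pushS f n c ∈ chainsIn B n) : c ∈ chainsIn (f ⁻¹' B) n := by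
  rw [chainsIn, Finsupp.mem_supported] at *
  intro σ hσ
  have h1 : Function.Injective (f.comp : C(stdSimplex ℝ (Fin (n + 1)), X) → _) :=
    fun _ _ h => ContinuousMap.ext fun x => hf (congrArg (fun k => k x) h)
  have : f.comp σ ∈ (pushS f n c).support := by
    rw [Finset.mem_coe, Finsupp.mem_support_iff] at hσ
    rw [Finsupp.mem_support_iff]
    rwa [pushS, Finsupp.lmapDomain_apply, Finsupp.mapDomain_apply h1]
  rintro _ ⟨t, rfl⟩
  exact hc this ⟨t, rfl⟩

end

/-! ### Comparison with the singular chain complex -/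

section
variable {k : Type} [CommRing k]

lemma sing_linearMap_ext {X : TopCat.{0}} {n : ℕ} {M : Type} [AddCommGroup M] [Module k M]
    {f g : (Sing k X).X n →ₗ[k] M}
    (h : ∀ σ : C(stdSimplex ℝ (Fin (n + 1)), X), f (simplexChain k σ) = g (simplexChain k σ)) :
    f = g := by
  have : ModuleCat.ofHom f = ModuleCat.ofHom g := by
    refine SSet.chainComplex_hom_ext (X := TopCat.toSSet.obj X) (R := ModuleCat.of k k) fun x => ?_
    refine ModuleCat.hom_ext (LinearMap.ext_ring ?_)
    have := h (X.toSSetObjEquiv (.op (SimplexCategory.mk n)) x)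
    simp only [simplexChain, Equiv.symm_apply_apply] at this
    exact this
  exact congrArg ModuleCat.Hom.hom this

/-- The linear map on singular chains with given values on the simplices. -/
def singLift {X : TopCat.{0}} {n : ℕ} {M : Type} [AddCommGroup M] [Module k M]
    (v : C(stdSimplex ℝ (Fin (n + 1)), X) → M) : (Sing k X).X n →ₗ[k] M :=
  (Limits.Cofan.IsColimit.desc
    ((TopCat.toSSet.obj X).isColimitChainComplexXCofan (ModuleCat.of k k) n)
    fun x => (ModuleCat.ofHom (LinearMap.toSpanSingleton k M
      (v (X.toSSetObjEquiv (.op (SimplexCategory.mk n)) x))) : ModuleCat.of k k ⟶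
        ModuleCat.of k M)).hom

lemma singLift_simplexChain {X : TopCat.{0}} {n : ℕ} {M : Type} [AddCommGroup M] [Module k M]
    (v : C(stdSimplex ℝ (Fin (n + 1)), X) → M) (σ : C(stdSimplex ℝ (Fin (n + 1)), X)) :
    singLift v (simplexChain k σ) = v σ := by
  have h := Limits.Cofan.IsColimit.fac
      ((TopCat.toSSet.obj X).isColimitChainComplexXCofan (ModuleCat.of k k) n)
      (fun x => (ModuleCat.ofHom (LinearMap.toSpanSingleton k M
        (v (X.toSSetObjEquiv (.op (SimplexCategory.mk n)) x))) : ModuleCat.of k k ⟶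
          ModuleCat.of k M)) ((X.toSSetObjEquiv (.op (SimplexCategory.mk n))).symm σ)
  have h' := congrArg (fun f => f.hom (1 : k)) h
  refine Eq.trans h' ?_
  refine (LinearMap.toSpanSingleton_apply_one k _ _).trans ?_
  rw [Equiv.apply_symm_apply]

lemma singMap_simplexChain {X Y : TopCat.{0}} (f : X ⟶ Y) {n : ℕ}
    (σ : C(stdSimplex ℝ (Fin (n + 1)), X)) :
    ((singMap k f).f n).hom (simplexChain k σ) = simplexChain k (f.hom.comp σ) := by
  have h := SSet.ι_chainComplexMap_f (X := TopCat.toSSet.obj X) (R := ModuleCat.of k k)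
    (f := TopCat.toSSet.map f) (x := (X.toSSetObjEquiv (.op (SimplexCategory.mk n))).symm σ)
  exact congrArg (fun f => f.hom (1 : k)) h

end

section
variable (X : TopCat.{0})

variable {X} in
/-- The additive map on integral singular chains with given values on the simplices. -/
def singLiftAdd {n : ℕ} {M : Type} [AddCommGroup M]
    (v : C(stdSimplex ℝ (Fin (n + 1)), X) → M) : (Sing ℤ X).X n →+ M :=
  (singLift (k := ℤ) v).toAddMonoidHom

variable {X} in
lemma singLiftAdd_simplexChain {n : ℕ} {M : Type} [AddCommGroup M]
    (v : C(stdSimplex ℝ (Fin (n + 1)), X) → M) (σ : C(stdSimplex ℝ (Fin (n + 1)), X)) :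
    singLiftAdd v (simplexChain ℤ σ) = v σ := singLift_simplexChain (k := ℤ) v σ

variable {X} in
lemma sing_hom_ext {n : ℕ} {M : Type} [AddCommGroup M] {f g : (Sing ℤ X).X n →+ M}
    (h : ∀ σ : C(stdSimplex ℝ (Fin (n + 1)), X), f (simplexChain ℤ σ) = g (simplexChain ℤ σ)) :
    f = g := by
  let F (f : (Sing ℤ X).X n →+ M) : (Sing ℤ X).X n →ₗ[ℤ] M :=
    { toFun := f, map_add' := f.map_add, map_smul' := fun r x => map_intCast_smul f ℤ ℤ r x }
  have : F f = F g := sing_linearMap_ext h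
  exact AddMonoidHom.ext fun x => LinearMap.congr_fun this x

/-- The map from Mathlib's singular chains to finitely supported functions. -/
def singTo (n : ℕ) : (Sing ℤ X).X n →+ SChain X n :=
  singLiftAdd fun σ : C(stdSimplex ℝ (Fin (n + 1)), X) => Finsupp.single σ 1

lemma singTo_simplexChain {n : ℕ} (σ : C(stdSimplex ℝ (Fin (n + 1)), X)) :
    singTo X n (simplexChain ℤ σ) = Finsupp.single σ 1 :=
  singLiftAdd_simplexChain _ σ

/-- Mathlib's module of singular chains is the module of finitely supported functions. -/
def singEquiv (n : ℕ) : (Sing ℤ X).X n ≃+ SChain X n :=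
  AddMonoidHom.toAddEquiv (singTo X n)
    (Finsupp.liftAddHom fun σ => zmultiplesHom _ (simplexChain ℤ σ))
    (sing_hom_ext fun σ => by
      change Finsupp.liftAddHom _ (singTo X n (simplexChain ℤ σ)) = _
      rw [singTo_simplexChain, Finsupp.liftAddHom_apply_single]
      exact one_zsmul _)
    (Finsupp.addHom_ext' fun σ => AddMonoidHom.ext_int (by
      simp only [AddMonoidHom.comp_apply, Finsupp.singleAddHom_apply,
        Finsupp.liftAddHom_apply_single, zmultiplesHom_apply, one_zsmul, AddMonoidHom.id_apply]
      exact singTo_simplexChain X σ))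

variable {X}

lemma singEquiv_simplexChain {n : ℕ} (σ : C(stdSimplex ℝ (Fin (n + 1)), X)) :
    singEquiv X n (simplexChain ℤ σ) = Finsupp.single σ 1 := singTo_simplexChain X σ

lemma sing_d_simplexChain {n : ℕ} (σ : C(stdSimplex ℝ (Fin (n + 2)), X)) :
    ((Sing ℤ X).d (n + 1) n).hom (simplexChain ℤ σ) =
      ∑ i : Fin (n + 2), (-1 : ℤ) ^ i.val • simplexChain ℤ (σ.comp (stdFace n i)) := by
  have h := SSet.ιChainComplex_d (R := ModuleCat.of ℤ ℤ) (X := TopCat.toSSet.obj X)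
    ((X.toSSetObjEquiv (.op (SimplexCategory.mk (n + 1)))).symm σ)
  refine (moduleCat_hom_congr h (1 : ℤ)).trans ?_
  rw [ModuleCat.hom_sum, LinearMap.sum_apply]
  rfl

lemma singEquiv_d {n : ℕ} (c : (Sing ℤ X).X (n + 1)) :
    singEquiv X n (((Sing ℤ X).d (n + 1) n).hom c) = dS n (singEquiv X (n + 1) c) := by
  suffices h : (singEquiv X n).toAddMonoidHom.comp
      ((Sing ℤ X).d (n + 1) n).hom.toAddMonoidHom =
      (dS n).toAddMonoidHom.comp (singEquiv X (n + 1)).toAddMonoidHom from DFunLike.congr_fun h c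
  refine sing_hom_ext fun σ => ?_
  change singEquiv X n (((Sing ℤ X).d (n + 1) n).hom (simplexChain ℤ σ)) =
    dS n (singEquiv X (n + 1) (simplexChain ℤ σ))
  rw [sing_d_simplexChain, singEquiv_simplexChain, dS_single, map_sum]
  refine Finset.sum_congr rfl fun i _ => ?_
  rw [map_zsmul, singEquiv_simplexChain]

lemma singEquiv_map {Y : TopCat.{0}} (f : X ⟶ Y) {n : ℕ} (c : (Sing ℤ X).X n) :
    singEquiv Y n (((singMap ℤ f).f n).hom c) = pushS f.hom n (singEquiv X n c) := by
  suffices h : (singEquiv Y n).toAddMonoidHom.comp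
      ((singMap ℤ f).f n).hom.toAddMonoidHom =
      (pushS f.hom n).toAddMonoidHom.comp (singEquiv X n).toAddMonoidHom from
    DFunLike.congr_fun h c
  refine sing_hom_ext fun σ => ?_
  change singEquiv Y n (((singMap ℤ f).f n).hom (simplexChain ℤ σ)) =
    pushS f.hom n (singEquiv X n (simplexChain ℤ σ))
  rw [singMap_simplexChain, singEquiv_simplexChain, singEquiv_simplexChain, pushS_single]

lemma chainIn_iff {A : Set X} {n : ℕ} (c : (Sing ℤ X).X n) :
    ChainIn ℤ A c ↔ singEquiv X n c ∈ chainsIn A n := by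
  have hemb : Topology.IsEmbedding (⟨Subtype.val, continuous_subtype_val⟩ : C(A, X)) :=
    Topology.IsEmbedding.subtypeVal
  constructor
  · rintro ⟨e, rfl⟩
    rw [singEquiv_map]
    exact pushS_mem_chainsIn (fun x _ => x.2) (chainsIn_univ n _)
  · intro h
    obtain ⟨e, -, he⟩ := exists_pushS_eq hemb h (by
      intro x hx; exact ⟨⟨x, hx⟩, rfl⟩)
    refine ⟨(singEquiv (TopCat.of A) n).symm e, (singEquiv X n).injective ?_⟩
    rw [singEquiv_map, AddEquiv.apply_symm_apply]
    exact he

lemma dS_dS {X : Type} [TopologicalSpace X] (n : ℕ) (c : SChain X (n + 2)) :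
    dS n (dS (n + 1) c) = 0 := by
  obtain ⟨c, rfl⟩ := (singEquiv (TopCat.of X) (n + 2)).surjective c
  erw [← singEquiv_d, ← singEquiv_d]
  have := congrArg (fun f => f.hom c) ((Sing ℤ (TopCat.of X)).d_comp_d (n + 2) (n + 1) n)
  exact (congrArg (singEquiv (TopCat.of X) n) this).trans (map_zero _)

end

/-! ### Homology classes of cycles -/

section
variable {C D : ChainComplex (ModuleCat.{0} ℤ) ℕ}

/-- A cycle, as an element of the module of cycles. -/
def cycleMk {n : ℕ} (c : C.X (n + 1)) (h : (C.d (n + 1) n).hom c = 0) : C.cycles (n + 1) :=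
  (C.liftCycles (A := ModuleCat.of ℤ ℤ) (ModuleCat.ofHom (LinearMap.toSpanSingleton ℤ _ c)) n
      (by simp) (by ext; simpa using h)).hom (1 : ℤ)

lemma iCycles_injective (n : ℕ) : Function.Injective (C.iCycles n).hom :=
  (ModuleCat.mono_iff_injective (C.iCycles n)).1 inferInstance

lemma iCycles_cycleMk {n : ℕ} (c : C.X (n + 1)) (h : (C.d (n + 1) n).hom c = 0) :
    (C.iCycles (n + 1)).hom (cycleMk c h) = c := by
  have := C.liftCycles_i (A := ModuleCat.of ℤ ℤ)
    (ModuleCat.ofHom (LinearMap.toSpanSingleton ℤ _ c)) n (by simp) (by ext; simpa using h)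
  exact (moduleCat_hom_congr this (1 : ℤ)).trans (LinearMap.toSpanSingleton_apply_one ℤ _ _)

lemma homologyClass_def {n : ℕ} (c : C.X (n + 1)) (h : (C.d (n + 1) n).hom c = 0) :
    homologyClass ℤ C c h = (C.homologyπ (n + 1)).hom (cycleMk c h) := rfl

lemma homologyClass_surjective {n : ℕ} (x : C.homology (n + 1)) :
    ∃ (c : C.X (n + 1)) (h : (C.d (n + 1) n).hom c = 0), homologyClass ℤ C c h = x := by
  obtain ⟨z, rfl⟩ := (ModuleCat.epi_iff_surjective (C.homologyπ (n + 1))).1 inferInstance x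
  refine ⟨(C.iCycles (n + 1)).hom z, moduleCat_hom_congr (C.iCycles_d (n + 1) n) z, ?_⟩
  rw [homologyClass_def]
  exact congrArg _ (iCycles_injective _ (iCycles_cycleMk _ _))

lemma homologyClass_eq_iff {n : ℕ} (c c' : C.X (n + 1)) (h : (C.d (n + 1) n).hom c = 0)
    (h' : (C.d (n + 1) n).hom c' = 0) :
    homologyClass ℤ C c h = homologyClass ℤ C c' h' ↔
      ∃ e, (C.d (n + 2) (n + 1)).hom e = c - c' := by
  have hi (e) : (C.iCycles (n + 1)).hom ((C.toCycles (n + 2) (n + 1)).hom e) =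
      (C.d (n + 2) (n + 1)).hom e := moduleCat_hom_congr (C.toCycles_i (n + 2) (n + 1)) e
  rw [homologyClass_def, homologyClass_def, ← sub_eq_zero, ← map_sub]
  have hex : (ShortComplex.mk _ _ (C.toCycles_comp_homologyπ (n + 2) (n + 1))).Exact :=
    ShortComplex.exact_of_g_is_cokernel _ (C.homologyIsCokernel (n + 2) (n + 1) (by simp))
  constructor
  · intro h0
    obtain ⟨e, he⟩ := (ShortComplex.moduleCat_exact_iff _).1 hex _ h0
    refine ⟨e, ?_⟩
    rw [← hi]
    refine (congrArg _ he).trans ?_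
    rw [map_sub, iCycles_cycleMk, iCycles_cycleMk]
  · rintro ⟨e, he⟩
    have : cycleMk c h - cycleMk c' h' = (C.toCycles (n + 2) (n + 1)).hom e := by
      refine iCycles_injective _ ?_
      rw [hi, he, map_sub, iCycles_cycleMk, iCycles_cycleMk]
    rw [this]
    exact moduleCat_hom_congr (C.toCycles_comp_homologyπ (n + 2) (n + 1)) e

lemma homologyMap_homologyClass (f : C ⟶ D) {n : ℕ} (c : C.X (n + 1))
    (h : (C.d (n + 1) n).hom c = 0) (h' : (D.d (n + 1) n).hom ((f.f (n + 1)).hom c) = 0) :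
    (HomologicalComplex.homologyMap f (n + 1)).hom (homologyClass ℤ C c h) =
      homologyClass ℤ D ((f.f (n + 1)).hom c) h' := by
  rw [homologyClass_def, homologyClass_def]
  refine (moduleCat_hom_congr (HomologicalComplex.homologyπ_naturality f (n + 1)) _).trans ?_
  refine congrArg (D.homologyπ (n + 1)).hom (iCycles_injective _ ?_)
  rw [iCycles_cycleMk]
  refine (moduleCat_hom_congr (HomologicalComplex.cyclesMap_i f (n + 1)) _).trans ?_
  exact congrArg (f.f (n + 1)).hom (iCycles_cycleMk c h)

end

/-! ### The augmented complex of tuples -/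

section Tuples
variable {V W : Type}

/-- The free abelian group on `n`-tuples. With the differential `dL` these groups form an augmented
complex in which `n`-tuples stand for `(n-1)`-simplices, the empty tuple giving the augmentation. -/
abbrev LChain (V : Type) (n : ℕ) : Type := (Fin n → V) →₀ ℤ

/-- The alternating sum of the faces of a tuple. -/
def dL (n : ℕ) : LChain V (n + 1) →ₗ[ℤ] LChain V n :=
  Finsupp.linearCombination ℤ fun v =>
    ∑ i : Fin (n + 1), (-1 : ℤ) ^ i.val • Finsupp.single (v ∘ i.succAbove) 1

/-- The cone operator, prepending a vertex. -/
def coneL (b : V) (n : ℕ) : LChain V n →ₗ[ℤ] LChain V (n + 1) :=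
  Finsupp.lmapDomain ℤ ℤ (Fin.cons (α := fun _ => V) b)

/-- The map on tuples induced by a map of vertices. -/
def mapL (f : V → W) (n : ℕ) : LChain V n →ₗ[ℤ] LChain W n :=
  Finsupp.lmapDomain ℤ ℤ (f ∘ ·)

lemma LChain.hom_ext {n : ℕ} {M : Type*} [AddCommGroup M] [Module ℤ M]
    {f g : LChain V n →ₗ[ℤ] M}
    (h : ∀ v, f (Finsupp.single v 1) = g (Finsupp.single v 1)) : f = g :=
  Finsupp.lhom_ext' fun v => LinearMap.ext_ring (h v)

lemma dL_single {n : ℕ} (v : Fin (n + 1) → V) :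
    dL n (Finsupp.single v 1) =
      ∑ i : Fin (n + 1), (-1 : ℤ) ^ i.val • Finsupp.single (v ∘ i.succAbove) 1 := by
  simp [dL]

lemma coneL_single (b : V) {n : ℕ} (v : Fin n → V) (r : ℤ) :
    coneL b n (Finsupp.single v r) = Finsupp.single (Fin.cons b v) r := by
  simp [coneL]

lemma mapL_single (f : V → W) {n : ℕ} (v : Fin n → V) (r : ℤ) :
    mapL f n (Finsupp.single v r) = Finsupp.single (f ∘ v) r := by
  simp [mapL]

lemma dL_mapL (f : V → W) (n : ℕ) (x : LChain V (n + 1)) :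
    dL n (mapL f (n + 1) x) = mapL f n (dL n x) := by
  suffices h : (dL n).comp (mapL f (n + 1)) = (mapL f n).comp (dL n) from DFunLike.congr_fun h x
  refine LChain.hom_ext fun v => ?_
  simp only [LinearMap.comp_apply, mapL_single, dL_single, map_sum, map_smul]
  rfl

lemma mapL_coneL (f : V → W) (b : V) (n : ℕ) (x : LChain V n) :
    mapL f (n + 1) (coneL b n x) = coneL (f b) n (mapL f n x) := by
  suffices h : (mapL f (n + 1)).comp (coneL b n) = (coneL (f b) n).comp (mapL f n) from
    DFunLike.congr_fun h x
  refine LChain.hom_ext fun v => ?_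
  simp only [LinearMap.comp_apply, mapL_single, coneL_single]
  congr 1
  exact Fin.comp_cons f b v

lemma dL_coneL_zero (b : V) (x : LChain V 0) : dL 0 (coneL b 0 x) = x := by
  suffices h : (dL 0).comp (coneL b 0) = LinearMap.id from DFunLike.congr_fun h x
  refine LChain.hom_ext fun v => ?_
  simp only [LinearMap.comp_apply, coneL_single, dL_single, LinearMap.id_apply]
  refine (Fin.sum_univ_one _).trans ((one_smul ℤ _).trans ?_)
  congr 1

lemma dL_coneL (b : V) (n : ℕ) (x : LChain V (n + 1)) :
    dL (n + 1) (coneL b (n + 1) x) = x - coneL b n (dL n x) := by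
  suffices h : (dL (n + 1)).comp (coneL b (n + 1)) =
      LinearMap.id - (coneL b n).comp (dL n) from DFunLike.congr_fun h x
  refine LChain.hom_ext fun v => ?_
  simp only [LinearMap.comp_apply, coneL_single, dL_single, LinearMap.sub_apply,
    LinearMap.id_apply, map_sum, map_smul]
  rw [Fin.sum_univ_succ, sub_eq_add_neg, ← Finset.sum_neg_distrib]
  congr 1
  · simp only [Fin.val_zero, pow_zero, one_smul]
    congr 1
  · refine Finset.sum_congr rfl fun i _ => ?_
    have : (Fin.cons b v : Fin (n + 2) → V) ∘ i.succ.succAbove = Fin.cons b (v ∘ i.succAbove) := by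
      funext j
      refine Fin.cases ?_ (fun j => ?_) j
      · simp
      · simp
    rw [this, Fin.val_succ, pow_succ, mul_neg_one]
    exact neg_smul _ _

lemma dL_dL (n : ℕ) (x : LChain V (n + 2)) : dL n (dL (n + 1) x) = 0 := by
  induction n with
  | zero =>
    suffices h : (dL 0).comp (dL (V := V) 1) = 0 from DFunLike.congr_fun h x
    refine LChain.hom_ext fun v => ?_
    rw [← Fin.cons_self_tail v, ← coneL_single]
    simp only [LinearMap.comp_apply, LinearMap.zero_apply]
    rw [dL_coneL, map_sub, dL_coneL_zero, sub_self]
  | succ n ih =>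
    suffices h : (dL (n + 1)).comp (dL (V := V) (n + 2)) = 0 from DFunLike.congr_fun h x
    refine LChain.hom_ext fun v => ?_
    rw [← Fin.cons_self_tail v, ← coneL_single]
    simp only [LinearMap.comp_apply, LinearMap.zero_apply]
    rw [dL_coneL, map_sub, dL_coneL, ih, map_zero, sub_zero, sub_self]

/-- The chain homotopy between two chain maps `f` and `g` of the augmented complexes of tuples that
agree in degree `0`. It is defined recursively on a tuple `v` by coning `f v - g v - h (∂ v)` from
the vertex `b v`; this chain is a cycle, and the complex of all tuples is contracted by any cone. -/
def htpyL (f g : ∀ n, LChain V n →ₗ[ℤ] LChain W n) (b : ∀ n, (Fin (n + 1) → V) → W) :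
    ∀ n, LChain V n →ₗ[ℤ] LChain W (n + 1)
  | 0 => 0
  | n + 1 => Finsupp.linearCombination ℤ fun v => coneL (b n v) (n + 1)
      (f (n + 1) (Finsupp.single v 1) - g (n + 1) (Finsupp.single v 1) -
        htpyL f g b n (dL n (Finsupp.single v 1)))

lemma htpyL_single (f g : ∀ n, LChain V n →ₗ[ℤ] LChain W n) (b : ∀ n, (Fin (n + 1) → V) → W)
    {n : ℕ} (v : Fin (n + 1) → V) :
    htpyL f g b (n + 1) (Finsupp.single v 1) = coneL (b n v) (n + 1)
      (f (n + 1) (Finsupp.single v 1) - g (n + 1) (Finsupp.single v 1) -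
        htpyL f g b n (dL n (Finsupp.single v 1))) := by
  rw [htpyL, Finsupp.linearCombination_single, one_smul]

lemma dL_htpyL {f g : ∀ n, LChain V n →ₗ[ℤ] LChain W n} (b : ∀ n, (Fin (n + 1) → V) → W)
    (hf : ∀ n x, dL n (f (n + 1) x) = f n (dL n x))
    (hg : ∀ n x, dL n (g (n + 1) x) = g n (dL n x)) (h0 : f 0 = g 0)
    (n : ℕ) (x : LChain V (n + 1)) :
    dL (n + 1) (htpyL f g b (n + 1) x) + htpyL f g b n (dL n x) = f (n + 1) x - g (n + 1) x := by
  suffices h : (dL (n + 1)).comp (htpyL f g b (n + 1)) + (htpyL f g b n).comp (dL n) =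
      f (n + 1) - g (n + 1) from DFunLike.congr_fun h x
  induction n with
  | zero =>
    refine LChain.hom_ext fun v => ?_
    simp only [LinearMap.add_apply, LinearMap.comp_apply, LinearMap.sub_apply]
    rw [htpyL_single, dL_coneL]
    simp only [htpyL, LinearMap.zero_apply, sub_zero, map_sub, hf, hg, h0, sub_self, map_zero,
      add_zero]
  | succ n ih =>
    refine LChain.hom_ext fun v => ?_
    have h := DFunLike.congr_fun (ih (dL _ (Finsupp.single v 1))) (dL _ (Finsupp.single v 1))
    simp only [LinearMap.add_apply, LinearMap.comp_apply, LinearMap.sub_apply, dL_dL, map_zero,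
      add_zero] at h ⊢
    rw [htpyL_single, dL_coneL]
    simp only [map_sub, hf, hg, h, sub_self, map_zero, sub_zero, sub_add_cancel]

/-- Naturality of the homotopy, which makes it compatible with the faces of simplices. -/
lemma mapL_htpyL {V' W' : Type} {f g : ∀ n, LChain V n →ₗ[ℤ] LChain W n}
    {f' g' : ∀ n, LChain V' n →ₗ[ℤ] LChain W' n} {b : ∀ n, (Fin (n + 1) → V) → W}
    {b' : ∀ n, (Fin (n + 1) → V') → W'} (φ : V → V') (ψ : W → W')
    (hf : ∀ n x, mapL ψ n (f n x) = f' n (mapL φ n x))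
    (hg : ∀ n x, mapL ψ n (g n x) = g' n (mapL φ n x))
    (hb : ∀ n v, ψ (b n v) = b' n (φ ∘ v)) (n : ℕ) (x : LChain V n) :
    mapL ψ (n + 1) (htpyL f g b n x) = htpyL f' g' b' n (mapL φ n x) := by
  suffices h : (mapL ψ (n + 1)).comp (htpyL f g b n) = (htpyL f' g' b' n).comp (mapL φ n) from
    DFunLike.congr_fun h x
  induction n with
  | zero => ext; simp [htpyL]
  | succ n ih =>
    refine LChain.hom_ext fun v => ?_
    have h := DFunLike.congr_fun (ih (dL _ (Finsupp.single v 1))) (dL _ (Finsupp.single v 1))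
    simp only [LinearMap.comp_apply] at h ⊢
    rw [htpyL_single, mapL_coneL, map_sub (mapL ψ _), map_sub (mapL ψ _), hf, hg, h, hb,
      mapL_single, htpyL_single, ← dL_mapL, mapL_single]

/-- Barycentric subdivision, for an abstract choice `b` of barycenters: the subdivided boundary is
coned from the barycenter. -/
def sdL (b : ∀ n, (Fin (n + 1) → V) → V) : ∀ n, LChain V n →ₗ[ℤ] LChain V n
  | 0 => LinearMap.id
  | n + 1 => Finsupp.linearCombination ℤ fun v => coneL (b n v) n
      (sdL b n (dL n (Finsupp.single v 1)))

lemma sdL_single (b : ∀ n, (Fin (n + 1) → V) → V) {n : ℕ} (v : Fin (n + 1) → V) :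
    sdL b (n + 1) (Finsupp.single v 1) = coneL (b n v) n (sdL b n (dL n (Finsupp.single v 1))) := by
  rw [sdL, Finsupp.linearCombination_single, one_smul]

lemma dL_sdL (b : ∀ n, (Fin (n + 1) → V) → V) (n : ℕ) (x : LChain V (n + 1)) :
    dL n (sdL b (n + 1) x) = sdL b n (dL n x) := by
  suffices h : (dL n).comp (sdL b (n + 1)) = (sdL b n).comp (dL n) from DFunLike.congr_fun h x
  induction n with
  | zero =>
    refine LChain.hom_ext fun v => ?_
    simp only [LinearMap.comp_apply]
    rw [sdL_single, dL_coneL_zero]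
  | succ n ih =>
    refine LChain.hom_ext fun v => ?_
    have h := DFunLike.congr_fun (ih (dL _ (Finsupp.single v 1))) (dL _ (Finsupp.single v 1))
    simp only [LinearMap.comp_apply, dL_dL, map_zero] at h ⊢
    rw [sdL_single, dL_coneL, h, map_zero, sub_zero]

lemma mapL_sdL {b : ∀ n, (Fin (n + 1) → V) → V} {b' : ∀ n, (Fin (n + 1) → W) → W} (φ : V → W)
    (hb : ∀ n v, φ (b n v) = b' n (φ ∘ v)) (n : ℕ) (x : LChain V n) :
    mapL φ n (sdL b n x) = sdL b' n (mapL φ n x) := by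
  suffices h : (mapL φ n).comp (sdL b n) = (sdL b' n).comp (mapL φ n) from DFunLike.congr_fun h x
  induction n with
  | zero => rfl
  | succ n ih =>
    refine LChain.hom_ext fun v => ?_
    have h := DFunLike.congr_fun (ih (dL _ (Finsupp.single v 1))) (dL _ (Finsupp.single v 1))
    simp only [LinearMap.comp_apply] at h ⊢
    rw [sdL_single, mapL_coneL, h, hb, mapL_single, sdL_single, ← dL_mapL, mapL_single]

end Tuples

/-! ### Affine simplices in convex sets -/

section Affine

variable {E F : Type} [NormedAddCommGroup E] [NormedSpace ℝ E] [NormedAddCommGroup F]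
  [NormedSpace ℝ F]

/-- The affine simplex with given vertices in a convex set. -/
def affineSimplex {C : Set E} (hC : Convex ℝ C) {n : ℕ} (v : Fin (n + 1) → C) :
    C(stdSimplex ℝ (Fin (n + 1)), C) where
  toFun t := ⟨∑ i, t i • (v i : E), hC.sum_mem (fun i _ => t.2.1 i) t.2.2 fun i _ => (v i).2⟩
  continuous_toFun := by
    refine Continuous.subtype_mk (continuous_finsetSum _ fun i _ => Continuous.smul ?_
      continuous_const) _
    exact (continuous_apply i).comp continuous_subtype_val

lemma stdSimplex_sum_map {n m : ℕ} (f : Fin (n + 1) → Fin (m + 1))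
    (t : stdSimplex ℝ (Fin (n + 1))) (v : Fin (m + 1) → E) :
    ∑ j, (stdSimplex.map f t) j • v j = ∑ i, t i • v (f i) := by
  classical
  rw [stdSimplex.map_coe]
  simp only [FunOnFinite.linearMap_apply_apply]
  simp_rw [Finset.sum_smul]
  rw [← Finset.sum_fiberwise (s := Finset.univ) (g := f) (f := fun i => t i • v (f i))]
  refine Finset.sum_congr rfl fun j _ => Finset.sum_congr (by simp) fun i hi => ?_
  simp only [Finset.mem_filter, Finset.mem_univ, true_and] at hi
  rw [hi]

lemma affineSimplex_face {C : Set E} (hC : Convex ℝ C) {n : ℕ} (v : Fin (n + 2) → C)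
    (i : Fin (n + 2)) :
    (affineSimplex hC v).comp (stdFace n i) = affineSimplex hC (v ∘ i.succAbove) := by
  refine ContinuousMap.ext fun t => Subtype.ext ?_
  exact stdSimplex_sum_map i.succAbove t fun j => (v j : E)

lemma coe_affineSimplex {C : Set E} (hC : Convex ℝ C) {n : ℕ} (v : Fin (n + 1) → C)
    (t : stdSimplex ℝ (Fin (n + 1))) : (affineSimplex hC v t : E) = ∑ i, t i • (v i : E) := rfl

/-- The barycenter of a tuple of points in a convex set. -/
def baryC {C : Set E} (hC : Convex ℝ C) (n : ℕ) (v : Fin (n + 1) → C) : C :=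
  affineSimplex hC v stdSimplex.barycenter

/-- A map between convex sets that is compatible with convex combinations. -/
def IsAffineMap {C : Set E} (hC : Convex ℝ C) {C' : Set F} (hC' : Convex ℝ C') (φ : C → C') :
    Prop :=
  ∀ (n : ℕ) (v : Fin (n + 1) → C) (t : stdSimplex ℝ (Fin (n + 1))),
    φ (affineSimplex hC v t) = affineSimplex hC' (φ ∘ v) t

lemma isAffineMap_affineSimplex {C : Set E} (hC : Convex ℝ C) {n : ℕ} (v : Fin (n + 1) → C) :
    IsAffineMap (convex_stdSimplex ℝ (Fin (n + 1))) hC (affineSimplex hC v) := by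
  intro m w t
  refine Subtype.ext ?_
  rw [coe_affineSimplex, coe_affineSimplex]
  have h (i : Fin (n + 1)) : affineSimplex (convex_stdSimplex ℝ (Fin (n + 1))) w t i =
      ∑ j, t j * w j i := by
    change (∑ j, t j • (w j : Fin (n + 1) → ℝ)) i = _
    rw [Finset.sum_apply]
    rfl
  simp_rw [h, Finset.sum_smul, Function.comp_apply, coe_affineSimplex, Finset.smul_sum, mul_smul]
  exact Finset.sum_comm

lemma affineSimplex_vertex (n : ℕ) :
    affineSimplex (convex_stdSimplex ℝ (Fin (n + 1))) stdSimplex.vertex = ContinuousMap.id _ := by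
  refine ContinuousMap.ext fun t => Subtype.ext ?_
  rw [coe_affineSimplex]
  funext i
  rw [Finset.sum_apply]
  simp only [Pi.smul_apply, smul_eq_mul, Pi.single_apply, mul_ite, mul_one,
    mul_zero, Finset.sum_ite_eq, Finset.mem_univ, if_true]
  rfl

lemma stdFace_eq (n : ℕ) (i : Fin (n + 2)) :
    stdFace n i = affineSimplex (convex_stdSimplex ℝ (Fin (n + 2)))
      (stdSimplex.vertex ∘ i.succAbove) := by
  rw [← affineSimplex_face, affineSimplex_vertex]
  rfl

lemma isAffineMap_stdFace (n : ℕ) (i : Fin (n + 2)) :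
    IsAffineMap (convex_stdSimplex ℝ (Fin (n + 1))) (convex_stdSimplex ℝ (Fin (n + 2)))
      (stdFace n i) := by
  rw [stdFace_eq]
  exact isAffineMap_affineSimplex _ _

lemma affineSimplex_comp_vertex {C : Set E} (hC : Convex ℝ C) {n : ℕ} (v : Fin (n + 1) → C) :
    affineSimplex hC v ∘ stdSimplex.vertex = v := by
  funext i
  refine Subtype.ext ?_
  rw [Function.comp_apply, coe_affineSimplex]
  simp only [stdSimplex.vertex_coe, Pi.single_apply, ite_smul, one_smul, zero_smul,
    Finset.sum_ite_eq', Finset.mem_univ, if_true]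

/-- The singular chain of affine simplices attached to a chain of tuples. -/
def realL {C : Set E} (hC : Convex ℝ C) (n : ℕ) : LChain C (n + 1) →ₗ[ℤ] SChain C n :=
  Finsupp.lmapDomain ℤ ℤ (affineSimplex hC)

lemma realL_single {C : Set E} (hC : Convex ℝ C) {n : ℕ} (v : Fin (n + 1) → C) :
    realL hC n (Finsupp.single v 1) = Finsupp.single (affineSimplex hC v) 1 := by
  simp [realL]

lemma dS_realL {C : Set E} (hC : Convex ℝ C) (n : ℕ) (x : LChain C (n + 2)) :
    dS n (realL hC (n + 1) x) = realL hC n (dL (n + 1) x) := by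
  suffices h : (dS n).comp (realL hC (n + 1)) = (realL hC n).comp (dL (n + 1)) from
    DFunLike.congr_fun h x
  refine LChain.hom_ext fun v => ?_
  simp only [LinearMap.comp_apply, realL_single, dS_single, dL_single, map_sum, map_smul,
    affineSimplex_face]

lemma pushS_realL {C : Set E} (hC : Convex ℝ C) {C' : Set F} (hC' : Convex ℝ C')
    {φ : C(C, C')} (hφ : IsAffineMap hC hC' φ) (n : ℕ) (x : LChain C (n + 1)) :
    pushS φ n (realL hC n x) = realL hC' n (mapL φ (n + 1) x) := by
  suffices h : (pushS φ n).comp (realL hC n) = (realL hC' n).comp (mapL φ (n + 1)) from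
    DFunLike.congr_fun h x
  refine LChain.hom_ext fun v => ?_
  simp only [LinearMap.comp_apply, realL_single, pushS_single, mapL_single]
  congr 1
  exact ContinuousMap.ext fun t => hφ n v t

/-- The tuple of vertices of the standard simplex. -/
def vertexL (n : ℕ) : LChain (stdSimplex ℝ (Fin (n + 1))) (n + 1) :=
  Finsupp.single stdSimplex.vertex 1

lemma dL_vertexL (n : ℕ) : dL (n + 1) (vertexL (n + 1)) =
    ∑ i : Fin (n + 2), (-1 : ℤ) ^ i.val • mapL (stdFace n i) (n + 1) (vertexL n) := by
  rw [vertexL, dL_single]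
  refine Finset.sum_congr rfl fun i _ => ?_
  rw [vertexL, mapL_single, stdFace_eq, affineSimplex_comp_vertex]

lemma mapL_vertexL {C : Set E} (hC : Convex ℝ C) {n : ℕ} (v : Fin (n + 1) → C) :
    mapL (affineSimplex hC v) (n + 1) (vertexL n) = Finsupp.single v 1 := by
  rw [vertexL, mapL_single, affineSimplex_comp_vertex]

end Affine

/-! ### Barycentric subdivision of singular chains -/

section Subdivision

variable {X Y : Type} [TopologicalSpace X] [TopologicalSpace Y]

/-- Barycenters of tuples in the standard simplex. -/
abbrev baryD (m n : ℕ) (v : Fin (n + 1) → stdSimplex ℝ (Fin (m + 1))) :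
    stdSimplex ℝ (Fin (m + 1)) := baryC (convex_stdSimplex ℝ (Fin (m + 1))) n v

/-- The chain homotopy from the identity to the barycentric subdivision of tuples. -/
abbrev sdHtpyL {V : Type} (b : ∀ n, (Fin (n + 1) → V) → V) (n : ℕ) :
    LChain V n →ₗ[ℤ] LChain V (n + 1) :=
  htpyL (fun _ => LinearMap.id) (sdL b) b n

/-- Barycentric subdivision. -/
def sdS (n : ℕ) : SChain X n →ₗ[ℤ] SChain X n :=
  Finsupp.linearCombination ℤ fun σ =>
    pushS σ n (realL (convex_stdSimplex ℝ _) n (sdL (baryD n) (n + 1) (vertexL n)))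

/-- The chain homotopy from the identity to the barycentric subdivision. -/
def tS (n : ℕ) : SChain X n →ₗ[ℤ] SChain X (n + 1) :=
  Finsupp.linearCombination ℤ fun σ =>
    pushS σ (n + 1) (realL (convex_stdSimplex ℝ _) (n + 1) (sdHtpyL (baryD n) (n + 1) (vertexL n)))

lemma sdS_single {n : ℕ} (σ : C(stdSimplex ℝ (Fin (n + 1)), X)) : sdS n (Finsupp.single σ 1) =
    pushS σ n (realL (convex_stdSimplex ℝ _) n (sdL (baryD n) (n + 1) (vertexL n))) := by
  simp [sdS]

lemma tS_single {n : ℕ} (σ : C(stdSimplex ℝ (Fin (n + 1)), X)) : tS n (Finsupp.single σ 1) =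
    pushS σ (n + 1) (realL (convex_stdSimplex ℝ _) (n + 1)
      (sdHtpyL (baryD n) (n + 1) (vertexL n))) := by
  simp [tS]

lemma pushS_mem_chainsIn_of_range {A : Set Y} {f : C(X, Y)} (h : ∀ x, f x ∈ A) {n : ℕ}
    (c : SChain X n) : pushS f n c ∈ chainsIn A n :=
  pushS_mem_chainsIn (A := Set.univ) (fun x _ => h x) (chainsIn_univ n c)

lemma sdS_mem_chainsIn {A : Set X} {n : ℕ} {c : SChain X n} (hc : c ∈ chainsIn A n) :
    sdS n c ∈ chainsIn A n := by
  refine map_chainsIn (sdS n) _ (fun σ hσ => ?_) hc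
  rw [sdS_single]
  exact pushS_mem_chainsIn_of_range hσ _

lemma tS_mem_chainsIn {A : Set X} {n : ℕ} {c : SChain X n} (hc : c ∈ chainsIn A n) :
    tS n c ∈ chainsIn A (n + 1) := by
  refine map_chainsIn (tS n) _ (fun σ hσ => ?_) hc
  rw [tS_single]
  exact pushS_mem_chainsIn_of_range hσ _

lemma sdS_pushS (f : C(X, Y)) (n : ℕ) (c : SChain X n) :
    sdS n (pushS f n c) = pushS f n (sdS n c) := by
  suffices h : (sdS n).comp (pushS f n) = (pushS f n).comp (sdS n) from DFunLike.congr_fun h c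
  refine SChain.hom_ext fun σ => ?_
  simp only [LinearMap.comp_apply, pushS_single, sdS_single, pushS_comp]

lemma mapL_stdFace_sdL (n : ℕ) (i : Fin (n + 2)) (m : ℕ)
    (x : LChain (stdSimplex ℝ (Fin (n + 1))) m) :
    mapL (stdFace n i) m (sdL (baryD n) m x) =
      sdL (baryD (n + 1)) m (mapL (stdFace n i) m x) :=
  mapL_sdL _ (fun k v => isAffineMap_stdFace n i k v _) m x

lemma dS_sdS (n : ℕ) (c : SChain X (n + 1)) : dS n (sdS (n + 1) c) = sdS n (dS n c) := by
  suffices h : (dS n).comp (sdS (n + 1)) = (sdS n).comp (dS (X := X) n) from DFunLike.congr_fun h c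
  refine SChain.hom_ext fun σ => ?_
  simp only [LinearMap.comp_apply]
  rw [sdS_single, dS_pushS, dS_realL, dL_sdL, dL_vertexL, dS_single]
  simp only [map_sum, map_smul]
  refine Finset.sum_congr rfl fun i _ => ?_
  rw [← mapL_stdFace_sdL, ← pushS_realL _ _ (isAffineMap_stdFace n i), ← pushS_comp, sdS_single]

lemma dS_tS (n : ℕ) (c : SChain X (n + 1)) :
    dS (n + 1) (tS (n + 1) c) + tS n (dS n c) = c - sdS (n + 1) c := by
  suffices h : (dS (n + 1)).comp (tS (n + 1)) + (tS n).comp (dS n) =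
      LinearMap.id - sdS (X := X) (n + 1) from DFunLike.congr_fun h c
  refine SChain.hom_ext fun σ => ?_
  simp only [LinearMap.comp_apply, LinearMap.add_apply, LinearMap.sub_apply, LinearMap.id_apply]
  have hb := dL_htpyL (f := fun _ => LinearMap.id) (g := sdL (baryD (n + 1))) (baryD (n + 1))
    (fun _ _ => rfl) (dL_sdL _) rfl (n + 1) (vertexL (n + 1))
  have h1 : tS n (dS n (Finsupp.single σ 1)) = pushS σ (n + 1) (realL (convex_stdSimplex ℝ _) _
      (sdHtpyL (baryD (n + 1)) (n + 1) (dL (n + 1) (vertexL (n + 1))))) := by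
    rw [dS_single, dL_vertexL]
    simp only [map_sum, map_smul]
    refine Finset.sum_congr rfl fun i _ => ?_
    rw [← mapL_htpyL (f := fun _ => LinearMap.id) (g := sdL (baryD n)) (b := baryD n)
      (stdFace n i) (stdFace n i) (fun _ _ => rfl) (mapL_stdFace_sdL n i)
      (fun k v => isAffineMap_stdFace n i k v _), ← pushS_realL _ _ (isAffineMap_stdFace n i),
      ← pushS_comp, tS_single]
  rw [h1, tS_single, dS_pushS, dS_realL, ← map_add, ← map_add, hb, map_sub, map_sub, sdS_single]
  congr 1
  rw [LinearMap.id_apply, vertexL, realL_single, affineSimplex_vertex, pushS_single]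
  rfl

/-- Iterated subdivision. -/
def sdPow (m n : ℕ) : SChain X n →ₗ[ℤ] SChain X n := (sdS n) ^ m

lemma sdPow_succ (m n : ℕ) (c : SChain X n) : sdPow (m + 1) n c = sdS n (sdPow m n c) := by
  rw [sdPow, pow_succ']; rfl

lemma sdPow_zero (n : ℕ) (c : SChain X n) : sdPow 0 n c = c := rfl

lemma sdPow_mem_chainsIn {A : Set X} {m n : ℕ} {c : SChain X n} (hc : c ∈ chainsIn A n) :
    sdPow m n c ∈ chainsIn A n := by
  induction m with
  | zero => exact hc
  | succ m ih => rw [sdPow_succ]; exact sdS_mem_chainsIn ih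

lemma dS_sdPow (m n : ℕ) (c : SChain X (n + 1)) : dS n (sdPow m (n + 1) c) = sdPow m n (dS n c) := by
  induction m with
  | zero => rfl
  | succ m ih => rw [sdPow_succ, dS_sdS, ih, sdPow_succ]

lemma sdPow_pushS (f : C(X, Y)) (m n : ℕ) (c : SChain X n) :
    sdPow m n (pushS f n c) = pushS f n (sdPow m n c) := by
  induction m with
  | zero => rfl
  | succ m ih => rw [sdPow_succ, sdPow_succ, ih, sdS_pushS]

/-- The chain homotopy from the identity to the iterated subdivision. -/
def tPow : ∀ (_ n : ℕ), SChain X n →ₗ[ℤ] SChain X (n + 1)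
  | 0, _ => 0
  | m + 1, n => tPow m n + (tS n).comp (sdPow m n)

lemma tPow_succ (m n : ℕ) (c : SChain X n) :
    tPow (m + 1) n c = tPow m n c + tS n (sdPow m n c) := rfl

lemma tPow_mem_chainsIn {A : Set X} {m n : ℕ} {c : SChain X n} (hc : c ∈ chainsIn A n) :
    tPow m n c ∈ chainsIn A (n + 1) := by
  induction m with
  | zero => exact Submodule.zero_mem _
  | succ m ih =>
    rw [tPow_succ]
    exact Submodule.add_mem _ ih (tS_mem_chainsIn (sdPow_mem_chainsIn hc))

lemma dS_tPow (m n : ℕ) (c : SChain X (n + 1)) :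
    dS (n + 1) (tPow m (n + 1) c) + tPow m n (dS n c) = c - sdPow m (n + 1) c := by
  induction m with
  | zero => simp [tPow, sdPow_zero]
  | succ m ih =>
    have h := dS_tS n (sdPow m (n + 1) c)
    rw [dS_sdPow] at h
    rw [tPow_succ, tPow_succ, map_add, sdPow_succ, add_add_add_comm, ih, h]
    abel

end Subdivision

/-! ### Subdivision makes chains small -/

section Mesh
variable {E : Type} [NormedAddCommGroup E] [NormedSpace ℝ E]

lemma map_supported {α : Type} {M : Type*} [AddCommGroup M] [Module ℤ M] {s : Set α}
    (f : (α →₀ ℤ) →ₗ[ℤ] M) (N : Submodule ℤ M) (h : ∀ a ∈ s, f (Finsupp.single a 1) ∈ N)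
    {c : α →₀ ℤ} (hc : c ∈ Finsupp.supported ℤ ℤ s) : f c ∈ N := by
  rw [Finsupp.supported_eq_span_single] at hc
  have : Submodule.span ℤ ((fun a => Finsupp.single a (1 : ℤ)) '' s) ≤ N.comap f := by
    rw [Submodule.span_le]
    rintro _ ⟨a, ha, rfl⟩
    exact h a ha
  exact this hc

/-- The tuples of points of `C` that lie in `A` and have mutual distances at most `δ`. -/
def smallTuples {C : Set E} (A : Set E) (δ : ℝ) (n : ℕ) : Set (Fin n → C) :=
  {w | (∀ i, (w i : E) ∈ A) ∧ ∀ i j, dist (w i : E) (w j) ≤ δ}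

/-- The barycenter of `n + 1` points is closer to each of them than their diameter, by a factor
`n / (n + 1)`. -/
lemma dist_baryC_le {C : Set E} (hC : Convex ℝ C) {n : ℕ} (v : Fin (n + 1) → C) {δ : ℝ}
    (hv : ∀ i j, dist (v i : E) (v j) ≤ δ) (i : Fin (n + 1)) :
    dist (v i : E) (baryC hC n v) ≤ n / (n + 1) * δ := by
  have hn : (0 : ℝ) < n + 1 := by positivity
  have e : (v i : E) - baryC hC n v = ∑ j, ((n : ℝ) + 1)⁻¹ • ((v i : E) - v j) := by
    rw [← Finset.smul_sum, Finset.sum_sub_distrib, Finset.sum_const, Finset.card_univ,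
      Fintype.card_fin, smul_sub, baryC, coe_affineSimplex, Finset.smul_sum,
      ← Nat.cast_smul_eq_nsmul ℝ, smul_smul]
    push_cast
    rw [inv_mul_cancel₀ hn.ne', one_smul]
    congr 1
    refine Finset.sum_congr rfl fun j _ => ?_
    have : (stdSimplex.barycenter : stdSimplex ℝ (Fin (n + 1))) j = ((n : ℝ) + 1)⁻¹ :=
      (stdSimplex.barycenter_apply j).trans (by simp)
    rw [this]
  rw [dist_eq_norm, e]
  refine (norm_sum_le _ _).trans ?_
  rw [← Finset.add_sum_erase _ _ (Finset.mem_univ i), sub_self, smul_zero, norm_zero, zero_add]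
  refine (Finset.sum_le_card_nsmul _ _ (((n : ℝ) + 1)⁻¹ * δ) fun j _ => ?_).trans ?_
  · rw [norm_smul, Real.norm_of_nonneg (by positivity), ← dist_eq_norm]
    exact mul_le_mul_of_nonneg_left (hv i j) (by positivity)
  · rw [Finset.card_erase_of_mem (Finset.mem_univ i), Finset.card_univ, Fintype.card_fin,
      nsmul_eq_mul, Nat.add_sub_cancel]
    exact le_of_eq (by ring)

/-- Barycentric subdivision of a tuple of `n` points shrinks its diameter by the factor
`(n - 1) / n`. The convex hull is carried along because the cone adds the barycenter to tuples in
the convex hulls of the faces. -/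
lemma sdL_mem_smallTuples {C : Set E} (hC : Convex ℝ C) {n : ℕ} (v : Fin n → C) {δ : ℝ}
    (hδ : 0 ≤ δ) (hv : ∀ i j, dist (v i : E) (v j) ≤ δ) :
    sdL (baryC hC) n (Finsupp.single v 1) ∈ Finsupp.supported ℤ ℤ
      (smallTuples (convexHull ℝ (Set.range fun i => (v i : E))) ((n - 1) / n * δ) n) := by
  induction n with
  | zero =>
    exact Finsupp.single_mem_supported _ _ ⟨fun i => i.elim0, fun i => i.elim0⟩
  | succ n ih =>
    have hb (i) := dist_baryC_le hC v hv i
    push_cast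
    rw [add_sub_cancel_right]
    have hn : (0 : ℝ) < n + 1 := by positivity
    set A := convexHull ℝ (Set.range fun i => (v i : E)) with hA
    have hbA : ((baryC hC n v : C) : E) ∈ A := by
      rw [baryC, coe_affineSimplex]
      exact (convex_convexHull ℝ _).sum_mem (fun i _ => stdSimplex.barycenter.2.1 i)
        stdSimplex.barycenter.2.2 fun i _ => subset_convexHull ℝ _ ⟨i, rfl⟩
    have hAb : A ⊆ Metric.closedBall ((baryC hC n v : C) : E) (n / (n + 1) * δ) := by
      refine convexHull_min ?_ (convex_closedBall _ _)
      rintro _ ⟨i, rfl⟩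
      exact hb i
    rw [sdL_single]
    refine map_supported (s := smallTuples A (n / (n + 1) * δ) n) _ _ (fun w hw => ?_) ?_
    · rw [coneL_single]
      refine Finsupp.single_mem_supported _ _ ⟨fun i => ?_, fun i j => ?_⟩
      · refine Fin.cases hbA (fun i => ?_) i
        exact hw.1 i
      · refine Fin.cases ?_ (fun i => ?_) i <;> refine Fin.cases ?_ (fun j => ?_) j
        · simp only [Fin.cons_zero, dist_self]; positivity
        · simp only [Fin.cons_zero, Fin.cons_succ]
          rw [dist_comm]
          exact hAb (hw.1 j)
        · simp only [Fin.cons_zero, Fin.cons_succ]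
          exact hAb (hw.1 i)
        · simpa only [Fin.cons_succ] using hw.2 i j
    · rw [dL_single, map_sum]
      refine Submodule.sum_mem _ fun i _ => ?_
      rw [map_smul]
      refine Submodule.smul_mem _ _ ?_
      refine Finsupp.supported_mono ?_ (ih (v ∘ i.succAbove) fun j k => hv _ _)
      rintro w ⟨hw1, hw2⟩
      refine ⟨fun j => convexHull_mono (fun x => ?_) (hw1 j), fun j k => (hw2 j k).trans ?_⟩
      · rintro ⟨l, rfl⟩; exact ⟨i.succAbove l, rfl⟩
      · refine mul_le_mul_of_nonneg_right ?_ hδ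
        rcases Nat.eq_zero_or_pos n with rfl | h
        · simp
        · have : (0 : ℝ) < n := by exact_mod_cast h
          rw [div_le_div_iff₀ this hn]
          nlinarith

lemma sdL_pow_mem_smallTuples {C : Set E} (hC : Convex ℝ C) {n : ℕ} (v : Fin (n + 1) → C) {δ : ℝ}
    (hδ : 0 ≤ δ) (hv : ∀ i j, dist (v i : E) (v j) ≤ δ) (m : ℕ) :
    ((sdL (baryC hC) (n + 1)) ^ m) (Finsupp.single v 1) ∈ Finsupp.supported ℤ ℤ
      (smallTuples Set.univ ((n / (n + 1) : ℝ) ^ m * δ) (n + 1)) := by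
  induction m with
  | zero =>
    exact Finsupp.single_mem_supported _ _ ⟨fun i => trivial, by simpa using hv⟩
  | succ m ih =>
    have e : ((sdL (baryC hC) (n + 1)) ^ (m + 1)) (Finsupp.single v 1) =
        sdL (baryC hC) (n + 1) (((sdL (baryC hC) (n + 1)) ^ m) (Finsupp.single v 1)) := by
      rw [pow_succ', Module.End.mul_apply]
    rw [e]
    refine map_supported _ _ (fun w hw => ?_) ih
    refine Finsupp.supported_mono ?_ (sdL_mem_smallTuples hC w (by positivity) hw.2)
    rintro u ⟨-, hu⟩
    refine ⟨fun _ => trivial, fun i j => (hu i j).trans (le_of_eq ?_)⟩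
    push_cast
    rw [pow_succ]
    ring

lemma dist_affineSimplex_le {C : Set E} (hC : Convex ℝ C) {n : ℕ} (v : Fin (n + 1) → C) {δ : ℝ}
    (hv : ∀ i j, dist (v i : E) (v j) ≤ δ) (t : stdSimplex ℝ (Fin (n + 1))) :
    dist (affineSimplex hC v t) (v 0) ≤ δ := by
  rw [Subtype.dist_eq, coe_affineSimplex]
  exact (convex_closedBall (v 0 : E) δ).sum_mem (fun i _ => t.2.1 i) t.2.2 fun i _ => hv i 0

lemma sdS_realL {n m : ℕ} (x : LChain (stdSimplex ℝ (Fin (m + 1))) (n + 1)) :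
    sdS n (realL (convex_stdSimplex ℝ _) n x) =
      realL (convex_stdSimplex ℝ _) n (sdL (baryD m) (n + 1) x) := by
  suffices h : (sdS n).comp (realL (convex_stdSimplex ℝ _) n) =
      (realL (convex_stdSimplex ℝ (Fin (m + 1))) n).comp (sdL (baryD m) (n + 1)) from
    DFunLike.congr_fun h x
  refine LChain.hom_ext fun v => ?_
  have hv := isAffineMap_affineSimplex (convex_stdSimplex ℝ _) v
  simp only [LinearMap.comp_apply]
  rw [realL_single, sdS_single, pushS_realL _ _ hv, ← mapL_vertexL (convex_stdSimplex ℝ _) v]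
  congr 1
  exact mapL_sdL _ (fun k w => hv k w _) _ _

lemma sdPow_single {X : Type} [TopologicalSpace X] {n : ℕ} (σ : C(stdSimplex ℝ (Fin (n + 1)), X))
    (m : ℕ) : sdPow m n (Finsupp.single σ 1) = pushS σ n (realL (convex_stdSimplex ℝ _) n
      (((sdL (baryD n) (n + 1)) ^ m) (vertexL n))) := by
  induction m with
  | zero =>
    rw [sdPow_zero, pow_zero, Module.End.one_apply, vertexL, realL_single, affineSimplex_vertex,
      pushS_single]
    rfl
  | succ m ih =>
    rw [sdPow_succ, ih, sdS_pushS, sdS_realL, pow_succ', Module.End.mul_apply]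

/-- Sufficiently fine subdivisions of a chain in `U₁ ∪ U₂` split into a chain in `U₁` and a chain in
`U₂`. -/
lemma exists_sdPow_mem {X : Type} [TopologicalSpace X] {U₁ U₂ : Set X} (h₁ : IsOpen U₁)
    (h₂ : IsOpen U₂) {n : ℕ} {c : SChain X n} (hc : c ∈ chainsIn (U₁ ∪ U₂) n) :
    ∃ m, sdPow m n c ∈ chainsIn U₁ n ⊔ chainsIn U₂ n := by
  suffices h : ∃ M, ∀ m ≥ M, sdPow m n c ∈ chainsIn U₁ n ⊔ chainsIn U₂ n from
    h.imp fun m hm => hm m le_rfl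
  rw [chainsIn, Finsupp.supported_eq_span_single] at hc
  induction hc using Submodule.span_induction with
  | zero => exact ⟨0, fun m _ => by rw [map_zero]; exact Submodule.zero_mem _⟩
  | add x y _ _ hx hy =>
    obtain ⟨M, hM⟩ := hx
    obtain ⟨N, hN⟩ := hy
    refine ⟨max M N, fun m hm => ?_⟩
    rw [map_add]
    exact Submodule.add_mem _ (hM m ((le_max_left _ _).trans hm)) (hN m ((le_max_right _ _).trans hm))
  | smul r x _ hx =>
    obtain ⟨M, hM⟩ := hx
    exact ⟨M, fun m hm => by rw [map_smul]; exact Submodule.smul_mem _ _ (hM m hm)⟩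
  | mem x hx =>
    obtain ⟨σ, hσ, rfl⟩ := hx
    have hcomp : CompactSpace (stdSimplex ℝ (Fin (n + 1))) :=
      isCompact_iff_compactSpace.1 (isCompact_stdSimplex ℝ _)
    -- a Lebesgue number of the cover of the simplex by the preimages of `U₁` and `U₂`
    obtain ⟨δ, hδ, hL⟩ := lebesgue_number_lemma_of_metric
      (s := (Set.univ : Set (stdSimplex ℝ (Fin (n + 1)))))
      (c := fun b : Bool => σ ⁻¹' (if b then U₁ else U₂)) isCompact_univ
      (fun b => IsOpen.preimage σ.continuous (by cases b <;> simp [h₁, h₂]))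
      (fun t _ => by
        rcases hσ ⟨t, rfl⟩ with h | h
        · exact Set.mem_iUnion.2 ⟨true, by simpa using h⟩
        · exact Set.mem_iUnion.2 ⟨false, by simpa using h⟩)
    have hn : (n / (n + 1) : ℝ) < 1 := by
      rw [div_lt_one (by positivity)]; linarith
    obtain ⟨M, hM⟩ := exists_pow_lt_of_lt_one (show (0 : ℝ) < δ / 2 by positivity) hn
    refine ⟨M, fun m hm => ?_⟩
    have hd (i j : Fin (n + 1)) : dist ((stdSimplex.vertex (S := ℝ) i : stdSimplex ℝ (Fin (n + 1))) :
        Fin (n + 1) → ℝ) (stdSimplex.vertex (S := ℝ) j : stdSimplex ℝ (Fin (n + 1))) ≤ 1 :=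
      (Metric.dist_le_diam_of_mem (bounded_stdSimplex _) (Subtype.property _)
        (Subtype.property _)).trans diam_stdSimplex_le
    have h := sdL_pow_mem_smallTuples (convex_stdSimplex ℝ _) _ zero_le_one hd m
    rw [sdPow_single]
    refine map_supported (pushS σ n ∘ₗ realL (convex_stdSimplex ℝ _) n) _ (fun w hw => ?_) h
    rw [LinearMap.comp_apply, realL_single, pushS_single]
    obtain ⟨b, hb⟩ := hL (w 0) trivial
    have hin (t) : σ (affineSimplex (convex_stdSimplex ℝ _) w t) ∈ if b then U₁ else U₂ := by
      refine hb ?_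
      rw [Metric.mem_ball]
      refine (dist_affineSimplex_le _ w hw.2 t).trans_lt ?_
      rw [mul_one]
      have := pow_le_pow_of_le_one (a := (n / (n + 1) : ℝ)) (by positivity) hn.le hm
      linarith
    cases b
    · exact Submodule.mem_sup_right (single_mem_chainsIn (fun t => by simpa using hin t) 1)
    · exact Submodule.mem_sup_left (single_mem_chainsIn (fun t => by simpa using hin t) 1)

end Mesh

/-! ### The prism operator and homotopies -/

section Prism
variable {X Y : Type} [TopologicalSpace X] [TopologicalSpace Y]

/-- The prism `Δⁿ × [0, 1]`, as a subset of a normed space. -/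
abbrev prismSet (n : ℕ) : Set ((Fin (n + 1) → ℝ) × ℝ) := stdSimplex ℝ (Fin (n + 1)) ×ˢ unitInterval

lemma convex_prismSet (n : ℕ) : Convex ℝ (prismSet n) :=
  (convex_stdSimplex ℝ _).prod (convex_Icc 0 1)

/-- The inclusion of the simplex in the prism at height `s`. -/
def prismIncl (n : ℕ) (s : unitInterval) : C(stdSimplex ℝ (Fin (n + 1)), prismSet n) :=
  ⟨fun t => ⟨(t.1, s.1), t.2, s.2⟩, by fun_prop⟩

/-- The map from the prism given by a simplex and a homotopy. -/
def prismMap (H : C(X × unitInterval, Y)) {n : ℕ} (σ : C(stdSimplex ℝ (Fin (n + 1)), X)) :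
    C(prismSet n, Y) :=
  H.comp ⟨fun p => (σ ⟨p.1.1, p.2.1⟩, ⟨p.1.2, p.2.2⟩), by
    refine Continuous.prodMk (σ.continuous.comp ?_) ?_ <;>
    exact Continuous.subtype_mk (by fun_prop) _⟩

/-- The side of the prism over the `i`-th face of the simplex. -/
def prismFace (n : ℕ) (i : Fin (n + 2)) : C(prismSet n, prismSet (n + 1)) :=
  ⟨fun p => ⟨((stdFace n i ⟨p.1.1, p.2.1⟩).1, p.1.2), (stdFace n i ⟨p.1.1, p.2.1⟩).2, p.2.2⟩, by
    refine Continuous.subtype_mk (Continuous.prodMk ?_ (by fun_prop)) _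
    exact continuous_subtype_val.comp ((stdFace n i).continuous.comp
      (Continuous.subtype_mk (by fun_prop) _))⟩

lemma coe_affineSimplex_prism {n m : ℕ} (v : Fin (m + 1) → prismSet n)
    (t : stdSimplex ℝ (Fin (m + 1))) :
    (affineSimplex (convex_prismSet n) v t : (Fin (n + 1) → ℝ) × ℝ) =
      (∑ i, t i • (v i).1.1, ∑ i, t i • (v i).1.2) := by
  rw [coe_affineSimplex]
  exact Prod.ext Prod.fst_sum Prod.snd_sum

lemma isAffineMap_prismFace (n : ℕ) (i : Fin (n + 2)) :
    IsAffineMap (convex_prismSet n) (convex_prismSet (n + 1)) (prismFace n i) := by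
  intro m v t
  refine Subtype.ext ?_
  rw [coe_affineSimplex_prism]
  have h := isAffineMap_stdFace n i m (fun j => ⟨(v j).1.1, (v j).2.1⟩) t
  refine Prod.ext ?_ ?_
  · refine Eq.trans ?_ (congrArg Subtype.val h)
    change (stdFace n i _).1 = (stdFace n i _).1
    congr 2
    exact Subtype.ext (congrArg Prod.fst (coe_affineSimplex_prism v t))
  · change (affineSimplex (convex_prismSet n) v t).1.2 = _
    rw [coe_affineSimplex_prism]
    rfl

lemma isAffineMap_prismIncl (n : ℕ) (s : unitInterval) :
    IsAffineMap (convex_stdSimplex ℝ _) (convex_prismSet n) (prismIncl n s) := by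
  intro m v t
  refine Subtype.ext ?_
  rw [coe_affineSimplex_prism]
  refine Prod.ext rfl ?_
  change (s : ℝ) = ∑ i, t i • (s : ℝ)
  rw [← Finset.sum_smul, stdSimplex.sum_eq_one, one_smul]

/-- The chain homotopy of tuples between the top and the bottom of the prism, with cone vertices the
barycenters in the bottom. -/
abbrev prismHtpyL (n k : ℕ) :
    LChain (stdSimplex ℝ (Fin (n + 1))) k →ₗ[ℤ] LChain (prismSet n) (k + 1) :=
  htpyL (mapL (prismIncl n 1)) (mapL (prismIncl n 0))
    (fun j v => prismIncl n 0 (baryD n j v)) k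

/-- The prism operator of a homotopy. -/
def prismS (H : C(X × unitInterval, Y)) (n : ℕ) : SChain X n →ₗ[ℤ] SChain Y (n + 1) :=
  Finsupp.linearCombination ℤ fun σ => pushS (prismMap H σ) (n + 1)
    (realL (convex_prismSet n) (n + 1) (prismHtpyL n (n + 1) (vertexL n)))

lemma prismS_single (H : C(X × unitInterval, Y)) {n : ℕ} (σ : C(stdSimplex ℝ (Fin (n + 1)), X)) :
    prismS H n (Finsupp.single σ 1) = pushS (prismMap H σ) (n + 1)
      (realL (convex_prismSet n) (n + 1) (prismHtpyL n (n + 1) (vertexL n))) := by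
  simp [prismS]

lemma prismS_mem_chainsIn {A : Set X} {B : Set Y} {H : C(X × unitInterval, Y)}
    (h : ∀ x ∈ A, ∀ s, H (x, s) ∈ B) {n : ℕ} {c : SChain X n} (hc : c ∈ chainsIn A n) :
    prismS H n c ∈ chainsIn B (n + 1) := by
  refine map_chainsIn (prismS H n) _ (fun σ hσ => ?_) hc
  rw [prismS_single]
  exact pushS_mem_chainsIn_of_range (fun p => h _ (hσ _) _) _

/-- The time `s` map of a homotopy. -/
def slice (H : C(X × unitInterval, Y)) (s : unitInterval) : C(X, Y) :=
  H.comp ⟨fun x => (x, s), by fun_prop⟩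

lemma dS_prismS (H : C(X × unitInterval, Y)) (n : ℕ) (c : SChain X (n + 1)) :
    dS (n + 1) (prismS H (n + 1) c) + prismS H n (dS n c) =
      pushS (slice H 1) (n + 1) c - pushS (slice H 0) (n + 1) c := by
  suffices h : (dS (n + 1)).comp (prismS H (n + 1)) + (prismS H n).comp (dS n) =
      pushS (slice H 1) (n + 1) - pushS (slice H 0) (n + 1) from DFunLike.congr_fun h c
  refine SChain.hom_ext fun σ => ?_
  simp only [LinearMap.comp_apply, LinearMap.add_apply, LinearMap.sub_apply]
  have hb := dL_htpyL (f := mapL (prismIncl (n + 1) 1)) (g := mapL (prismIncl (n + 1) 0))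
    (fun j v => prismIncl (n + 1) 0 (baryD (n + 1) j v)) (fun _ _ => dL_mapL _ _ _)
    (fun _ _ => dL_mapL _ _ _)
    (LChain.hom_ext fun v => by
      rw [mapL_single, mapL_single]; congr 1; exact Subsingleton.elim _ _)
    (n + 1) (vertexL (n + 1))
  have hcomm (i : Fin (n + 2)) (s : unitInterval) (k : ℕ)
      (x : LChain (stdSimplex ℝ (Fin (n + 1))) k) :
      mapL (prismFace n i) k (mapL (prismIncl n s) k x) =
        mapL (prismIncl (n + 1) s) k (mapL (stdFace n i) k x) := by
    suffices h : (mapL (prismFace n i) k).comp (mapL (prismIncl n s) k) =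
      (mapL (prismIncl (n + 1) s) k).comp (mapL (stdFace n i) k) from DFunLike.congr_fun h x
    refine LChain.hom_ext fun v => ?_
    simp only [LinearMap.comp_apply, mapL_single]
    rfl
  have h1 : prismS H n (dS n (Finsupp.single σ 1)) = pushS (prismMap H σ) (n + 1)
      (realL (convex_prismSet (n + 1)) _
      (prismHtpyL (n + 1) (n + 1) (dL (n + 1) (vertexL (n + 1))))) := by
    rw [dS_single, dL_vertexL]
    simp only [map_sum, map_smul]
    refine Finset.sum_congr rfl fun i _ => ?_
    rw [← mapL_htpyL (f := mapL (prismIncl n 1)) (g := mapL (prismIncl n 0))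
      (b := fun j v => prismIncl n 0 (baryD n j v))
      (stdFace n i) (prismFace n i) (hcomm i 1) (hcomm i 0)
      (fun k v => congrArg (prismIncl (n + 1) 0) (isAffineMap_stdFace n i k v _)),
      ← pushS_realL _ _ (isAffineMap_prismFace n i), ← pushS_comp, prismS_single]
    rfl
  have h2 (s : unitInterval) : pushS (prismMap H σ) (n + 1) (realL (convex_prismSet (n + 1)) _
      (mapL (prismIncl (n + 1) s) (n + 1 + 1) (vertexL (n + 1)))) =
      pushS (slice H s) (n + 1) (Finsupp.single σ 1) := by
    rw [← pushS_realL _ _ (isAffineMap_prismIncl (n + 1) s), ← pushS_comp, vertexL, realL_single,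
      affineSimplex_vertex, pushS_single, pushS_single]
    rfl
  rw [h1, prismS_single, dS_pushS, dS_realL, ← map_add, ← map_add, hb, map_sub, map_sub, h2, h2]

/-- A constant map sends every chain to a multiple of the constant simplex. -/
lemma pushS_const (y : Y) (n : ℕ) (c : SChain X n) : ∃ r : ℤ,
    pushS (ContinuousMap.const X y) n c = Finsupp.single (ContinuousMap.const _ y) r := by
  induction c using Finsupp.induction_linear with
  | zero => exact ⟨0, by simp⟩
  | add f g hf hg =>
    obtain ⟨r, hr⟩ := hf
    obtain ⟨s, hs⟩ := hg
    exact ⟨r + s, by rw [map_add, hr, hs, Finsupp.single_add]⟩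
  | single σ r => exact ⟨r, by rw [pushS_single]; rfl⟩

lemma dS_const (y : Y) (n : ℕ) (r : ℤ) :
    dS n (Finsupp.single (ContinuousMap.const _ y) r) =
      Finsupp.single (ContinuousMap.const _ y) (if Even n then 0 else r) := by
  have : (Finsupp.single (ContinuousMap.const _ y) r : SChain Y (n + 1)) =
      r • Finsupp.single (ContinuousMap.const _ y) 1 := by simp
  rw [this, map_smul, dS_single]
  have h (i : Fin (n + 2)) : (ContinuousMap.const (stdSimplex ℝ (Fin (n + 2))) y).comp
      (stdFace n i) = ContinuousMap.const _ y := rfl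
  simp only [h]
  rw [← Finset.sum_smul, Fin.sum_neg_one_pow]
  by_cases hn : Even n <;> simp [hn, Nat.even_add]

/-- A cycle of positive degree that contracts to a point through a homotopy bounds. The end of the
homotopy is a multiple of a constant simplex, which is a boundary whenever it is a cycle. -/
lemma exists_dS_eq_of_contraction {A B : Set X} {y : X} (H : C(A × unitInterval, X)) (hyB : y ∈ B)
    (hH : ∀ a s, H (a, s) ∈ B) (h1 : ∀ a : A, H (a, 1) = a) (h0 : ∀ a, H (a, 0) = y) {n : ℕ}
    {c : SChain X (n + 1)} (hc : c ∈ chainsIn A (n + 1)) (hd : dS n c = 0) :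
    ∃ e ∈ chainsIn B (n + 2), dS (n + 1) e = c := by
  have hemb : Topology.IsEmbedding (⟨Subtype.val, continuous_subtype_val⟩ : C(A, X)) :=
    Topology.IsEmbedding.subtypeVal
  obtain ⟨c, -, rfl⟩ := exists_pushS_eq hemb hc (fun x hx => ⟨⟨x, hx⟩, rfl⟩)
  have hd' : dS n c = 0 := by
    refine pushS_injective hemb.injective n ?_
    rw [← dS_pushS, hd, map_zero]
  have hp := dS_prismS H n c
  have e1 : slice H 1 = ⟨Subtype.val, continuous_subtype_val⟩ := ContinuousMap.ext h1
  have e0 : slice H 0 = ContinuousMap.const A y := ContinuousMap.ext h0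
  rw [hd', map_zero, add_zero, e1, e0] at hp
  obtain ⟨r, hr⟩ := pushS_const y (n + 1) c
  have hcyc : dS n (Finsupp.single (ContinuousMap.const _ y) r : SChain X (n + 1)) = 0 := by
    rw [← hr, dS_pushS, hd', map_zero]
  have hbd : ∃ e ∈ chainsIn B (n + 2), dS (n + 1) e =
      (Finsupp.single (ContinuousMap.const _ y) r : SChain X (n + 1)) := by
    by_cases hn : Even n
    · refine ⟨Finsupp.single (ContinuousMap.const _ y) r, single_mem_chainsIn (fun _ => hyB) r, ?_⟩
      rw [dS_const, if_neg (by simp [Nat.even_add, hn])]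
    · refine ⟨0, Submodule.zero_mem _, ?_⟩
      rw [dS_const, if_neg hn, Finsupp.single_eq_zero] at hcyc
      rw [hcyc, map_zero, Finsupp.single_zero]
  obtain ⟨e, heB, he⟩ := hbd
  refine ⟨prismS H (n + 1) c + e, Submodule.add_mem _ (prismS_mem_chainsIn (A := Set.univ)
    (fun a _ s => hH a s) (chainsIn_univ _ _)) heB, ?_⟩
  rw [map_add, hp, he, hr, sub_add_cancel]

/-- A cycle of positive degree in a star-convex set bounds in it. -/
lemma exists_dS_eq_of_starConvex {E : Type} [NormedAddCommGroup E] [NormedSpace ℝ E] {A : Set E}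
    {y : E} (hy : y ∈ A) (hA : StarConvex ℝ y A) {n : ℕ}
    {c : SChain E (n + 1)} (hc : c ∈ chainsIn A (n + 1)) (hd : dS n c = 0) :
    ∃ e ∈ chainsIn A (n + 2), dS (n + 1) e = c := by
  refine exists_dS_eq_of_contraction (A := A) (y := y)
    ⟨fun p => (1 - p.2 : ℝ) • y + (p.2 : ℝ) • (p.1 : E), by fun_prop⟩ hy (fun a s => ?_)
    (fun a => ?_) (fun a => ?_) hc hd
  · exact hA a.2 (by linarith [s.2.2]) s.2.1 (by ring)
  · simp
  · simp

end Prism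

/-! ### Relative cycles and boundaries -/

lemma mapsTo_compl_image {V Y : Type} {f : V → Y} (hf : Function.Injective f) (K : Set V) :
    Set.MapsTo f Kᶜ (f '' K)ᶜ := by
  rintro x hx ⟨y, hy, hxy⟩
  exact hx (hf hxy ▸ hy)

section Relative
variable {X Y V : Type} [TopologicalSpace X] [TopologicalSpace Y] [TopologicalSpace V]

/-- The chain `c` is a cycle of `(X, X - A)`. -/
def RelCycle (A : Set X) {n : ℕ} (c : SChain X (n + 1)) : Prop := dS n c ∈ chainsIn Aᶜ n

/-- The chain `c` is a boundary of `(X, X - A)`. -/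
def RelNull (A : Set X) {n : ℕ} (c : SChain X n) : Prop :=
  ∃ e : SChain X (n + 1), c - dS n e ∈ chainsIn Aᶜ n

/-- A boundary relative to `X - B` is one relative to the larger set `X - A`. -/
lemma RelNull.mono {A B : Set X} (h : A ⊆ B) {n : ℕ} {c : SChain X n} (hc : RelNull B c) :
    RelNull A c :=
  hc.imp fun _ he => chainsIn_mono (Set.compl_subset_compl.2 h) n he

lemma RelCycle.mono {A B : Set X} (h : A ⊆ B) {n : ℕ} {c : SChain X (n + 1)} (hc : RelCycle B c) :
    RelCycle A c :=
  chainsIn_mono (Set.compl_subset_compl.2 h) n hc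

lemma RelNull.add {A : Set X} {n : ℕ} {c c' : SChain X n} (hc : RelNull A c) (hc' : RelNull A c') :
    RelNull A (c + c') := by
  obtain ⟨e, he⟩ := hc
  obtain ⟨e', he'⟩ := hc'
  refine ⟨e + e', ?_⟩
  rw [map_add, add_sub_add_comm]
  exact Submodule.add_mem _ he he'

lemma RelNull.neg {A : Set X} {n : ℕ} {c : SChain X n} (hc : RelNull A c) : RelNull A (-c) := by
  obtain ⟨e, he⟩ := hc
  refine ⟨-e, ?_⟩
  rw [map_neg, ← neg_sub']
  exact Submodule.neg_mem _ he

lemma RelNull.sub {A : Set X} {n : ℕ} {c c' : SChain X n} (hc : RelNull A c) (hc' : RelNull A c') :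
    RelNull A (c - c') := by
  rw [sub_eq_add_neg]; exact hc.add hc'.neg

lemma RelNull.of_mem {A : Set X} {n : ℕ} {c : SChain X n} (hc : c ∈ chainsIn Aᶜ n) :
    RelNull A c := ⟨0, by rwa [map_zero, sub_zero]⟩

lemma RelNull.of_dS {A : Set X} {n : ℕ} (e : SChain X (n + 1)) : RelNull A (dS n e) :=
  ⟨e, by rw [sub_self]; exact Submodule.zero_mem _⟩

lemma relNull_empty {n : ℕ} (c : SChain X n) : RelNull ∅ c :=
  RelNull.of_mem (by rw [Set.compl_empty]; exact chainsIn_univ n c)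

lemma RelNull.symm {A : Set X} {n : ℕ} {c c' : SChain X n} (h : RelNull A (c - c')) :
    RelNull A (c' - c) := by
  rw [← neg_sub]; exact h.neg

lemma RelNull.trans {A : Set X} {n : ℕ} {c c' c'' : SChain X n} (h : RelNull A (c - c'))
    (h' : RelNull A (c' - c'')) : RelNull A (c - c'') := by
  rw [← sub_add_sub_cancel c c' c'']; exact h.add h'

lemma RelNull.relCycle {A : Set X} {n : ℕ} {c : SChain X (n + 1)} (h : RelNull A c) :
    RelCycle A c := by
  obtain ⟨e, he⟩ := h
  have := dS_mem_chainsIn he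
  rwa [map_sub, dS_dS, sub_zero] at this

lemma RelCycle.sub {A : Set X} {n : ℕ} {c c' : SChain X (n + 1)} (h : RelCycle A c)
    (h' : RelCycle A c') : RelCycle A (c - c') := by
  rw [RelCycle, map_sub]; exact Submodule.sub_mem _ h h'

lemma RelNull.push {A : Set X} {B : Set Y} {f : C(X, Y)} (h : Set.MapsTo f Aᶜ Bᶜ) {n : ℕ}
    {c : SChain X n} (hc : RelNull A c) : RelNull B (pushS f n c) := by
  obtain ⟨e, he⟩ := hc
  refine ⟨pushS f (n + 1) e, ?_⟩
  rw [dS_pushS, ← map_sub]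
  exact pushS_mem_chainsIn h he

lemma RelCycle.push {A : Set X} {B : Set Y} {f : C(X, Y)} (h : Set.MapsTo f Aᶜ Bᶜ) {n : ℕ}
    {c : SChain X (n + 1)} (hc : RelCycle A c) : RelCycle B (pushS f (n + 1) c) := by
  rw [RelCycle, dS_pushS]
  exact pushS_mem_chainsIn h hc

/-- Subdividing a chain changes it by a relative boundary, if the chain is a relative cycle. -/
lemma RelCycle.relNull_sub_sdPow {A : Set X} {n : ℕ} {c : SChain X (n + 1)} (hc : RelCycle A c)
    (m : ℕ) : RelNull A (c - sdPow m (n + 1) c) := by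
  refine ⟨tPow m (n + 1) c, ?_⟩
  rw [← dS_tPow, add_sub_cancel_left]
  exact tPow_mem_chainsIn hc

/-- Injectivity part of excision, for an open subspace `V` of `Y` and a subset `K` of `V` that is
closed in `Y`. -/
lemma RelNull.of_push {f : C(V, Y)} (hf : Topology.IsOpenEmbedding f) {K : Set V}
    (hK : IsClosed (f '' K)) {n : ℕ} {c : SChain V (n + 1)} (hc : RelCycle K c)
    (h : RelNull (f '' K) (pushS f (n + 1) c)) : RelNull K c := by
  obtain ⟨e, he⟩ := h
  obtain ⟨m, hm⟩ := exists_sdPow_mem hf.isOpen_range hK.isOpen_compl (c := e) (by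
    have : Set.range f ∪ (f '' K)ᶜ = Set.univ :=
      Set.eq_univ_of_forall fun y => by
        by_cases hy : y ∈ f '' K
        · exact Or.inl (Set.image_subset_range _ _ hy)
        · exact Or.inr hy
    rw [this]; exact chainsIn_univ _ _)
  obtain ⟨e₁, he₁, e₂, he₂, h12⟩ := Submodule.mem_sup.1 hm
  obtain ⟨e₁, -, rfl⟩ := exists_pushS_eq hf.isEmbedding he₁ subset_rfl
  have key : sdPow m (n + 1) c - dS (n + 1) e₁ ∈ chainsIn Kᶜ (n + 1) := by
    have h1 : pushS f (n + 1) (sdPow m (n + 1) c - dS (n + 1) e₁) =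
        sdPow m (n + 1) (pushS f (n + 1) c - dS (n + 1) e) + dS (n + 1) e₂ := by
      rw [map_sub, map_sub, ← dS_pushS, ← dS_sdPow, ← h12, map_add, sdPow_pushS]
      abel
    have h2 : f ⁻¹' (f '' K)ᶜ = Kᶜ := by
      rw [Set.preimage_compl, Set.preimage_image_eq _ hf.injective]
    rw [← h2]
    refine mem_chainsIn_of_pushS hf.injective ?_
    rw [h1]
    exact Submodule.add_mem _ (sdPow_mem_chainsIn he) (dS_mem_chainsIn he₂)
  have := (hc.relNull_sub_sdPow m).add ⟨e₁, key⟩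
  rwa [sub_add_cancel] at this

/-- Surjectivity part of excision: every relative cycle is homologous to one of the open subspace. -/
lemma RelCycle.exists_push {f : C(V, Y)} (hf : Topology.IsOpenEmbedding f) {K : Set V}
    (hK : IsClosed (f '' K)) {n : ℕ} {c : SChain Y (n + 1)} (hc : RelCycle (f '' K) c) :
    ∃ c' : SChain V (n + 1), RelCycle K c' ∧ RelNull (f '' K) (c - pushS f (n + 1) c') := by
  obtain ⟨m, hm⟩ := exists_sdPow_mem hf.isOpen_range hK.isOpen_compl (c := c) (by
    have : Set.range f ∪ (f '' K)ᶜ = Set.univ :=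
      Set.eq_univ_of_forall fun y => by
        by_cases hy : y ∈ f '' K
        · exact Or.inl (Set.image_subset_range _ _ hy)
        · exact Or.inr hy
    rw [this]; exact chainsIn_univ _ _)
  obtain ⟨c₁, hc₁, c₂, hc₂, h12⟩ := Submodule.mem_sup.1 hm
  obtain ⟨c₁, -, rfl⟩ := exists_pushS_eq hf.isEmbedding hc₁ subset_rfl
  refine ⟨c₁, ?_, ?_⟩
  · have h2 : f ⁻¹' (f '' K)ᶜ = Kᶜ := by
      rw [Set.preimage_compl, Set.preimage_image_eq _ hf.injective]
    rw [RelCycle, ← h2]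
    refine mem_chainsIn_of_pushS hf.injective ?_
    rw [← dS_pushS, eq_sub_of_add_eq h12, map_sub, dS_sdPow]
    exact Submodule.sub_mem _ (sdPow_mem_chainsIn hc) (dS_mem_chainsIn hc₂)
  · have := (hc.relNull_sub_sdPow m).add (RelNull.of_mem hc₂)
    rwa [← h12, sub_add_eq_sub_sub, sub_add_cancel] at this

/-- The relative Mayer–Vietoris argument: a chain that bounds relative to `X - A` and relative to
`X - B` bounds relative to `X - (A ∪ B)`, if all cycles of `(X, X - (A ∩ B))` of the next degree
bound. -/
lemma RelNull.union {A B : Set X} (hA : IsClosed A) (hB : IsClosed B) {n : ℕ}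
    {c : SChain X (n + 1)} (h₁ : RelNull A c) (h₂ : RelNull B c)
    (hAB : ∀ e : SChain X (n + 2), RelCycle (A ∩ B) e → RelNull (A ∩ B) e) :
    RelNull (A ∪ B) c := by
  obtain ⟨e₁, he₁⟩ := h₁
  obtain ⟨e₂, he₂⟩ := h₂
  have hd : dS (n + 1) (e₁ - e₂) ∈ chainsIn Aᶜ (n + 1) ⊔ chainsIn Bᶜ (n + 1) := by
    have : dS (n + 1) (e₁ - e₂) = -(c - dS (n + 1) e₁) + (c - dS (n + 1) e₂) := by
      rw [map_sub]; abel
    rw [this]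
    exact Submodule.add_mem_sup (Submodule.neg_mem _ he₁) he₂
  have hsup (k) : chainsIn Aᶜ k ⊔ chainsIn Bᶜ k ≤ chainsIn (A ∩ B)ᶜ k := by
    rw [Set.compl_inter]
    exact sup_le (chainsIn_mono Set.subset_union_left _) (chainsIn_mono Set.subset_union_right _)
  -- the two bounding chains differ by a cycle of `(X, X - (A ∩ B))`; after this is corrected by a
  -- boundary and subdivided, the difference splits into a chain off `A` and a chain off `B`
  obtain ⟨f, hf⟩ := hAB (e₁ - e₂) (hsup _ hd)
  set w := e₁ - e₂ - dS (n + 2) f with hw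
  have hdw : dS (n + 1) w = dS (n + 1) (e₁ - e₂) := by rw [hw, map_sub, dS_dS, sub_zero]
  rw [Set.compl_inter] at hf
  obtain ⟨m, hm⟩ := exists_sdPow_mem hA.isOpen_compl hB.isOpen_compl hf
  have hT : tPow m (n + 1) (dS (n + 1) w) ∈ chainsIn Aᶜ (n + 2) ⊔ chainsIn Bᶜ (n + 2) := by
    rw [hdw]
    obtain ⟨u, hu, v, hv, huv⟩ := Submodule.mem_sup.1 hd
    rw [← huv, map_add]
    exact Submodule.add_mem_sup (tPow_mem_chainsIn hu) (tPow_mem_chainsIn hv)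
  have hsum := Submodule.add_mem _ hm hT
  have hwd := dS_tPow m (n + 1) w
  obtain ⟨u, hu, v, hv, huv⟩ := Submodule.mem_sup.1 hsum
  have hfin : dS (n + 1) (e₁ - u) = dS (n + 1) (e₂ + v) := by
    have : e₁ - u = e₂ + v + dS (n + 2) (f + tPow m (n + 2) w) := by
      have h3 : dS (n + 2) (tPow m (n + 2) w) = w - (u + v) := by
        rw [huv, eq_sub_iff_add_eq]
        refine Eq.trans ?_ (eq_sub_iff_add_eq.1 hwd)
        abel
      rw [map_add, h3, hw]
      abel
    rw [this, map_add, dS_dS, add_zero]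
  refine ⟨e₁ - u, ?_⟩
  rw [Set.compl_union]
  refine chainsIn_inter ?_ ?_
  · rw [map_sub, sub_sub_eq_add_sub, add_sub_right_comm]
    exact Submodule.add_mem _ he₁ (dS_mem_chainsIn hu)
  · rw [hfin, map_add, sub_add_eq_sub_sub]
    exact Submodule.sub_mem _ he₂ (dS_mem_chainsIn hv)

/-- Homotopic chains are homologous relative to the complement of `B`, if the homotopy keeps the
boundary off `B`. -/
lemma relNull_of_homotopy {A : Set X} {B : Set Y} (H : C(X × unitInterval, Y))
    (h : ∀ x ∈ A, ∀ s, H (x, s) ∈ Bᶜ) {n : ℕ} {c : SChain X (n + 1)} (hc : dS n c ∈ chainsIn A n) :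
    RelNull B (pushS (slice H 1) (n + 1) c - pushS (slice H 0) (n + 1) c) := by
  refine ⟨prismS H (n + 1) c, ?_⟩
  rw [← dS_prismS, add_sub_cancel_left]
  exact prismS_mem_chainsIn h hc

/-- If a family of closed sets is closed under intersection and has no relative homology in
degrees at least `3`, then the same holds for finite unions of members of the family. -/
lemma relNull_iUnion_of_vanishing {𝒢 : Set (Set X)} (hcl : ∀ A ∈ 𝒢, IsClosed A)
    (hint : ∀ A ∈ 𝒢, ∀ B ∈ 𝒢, A ∩ B ∈ 𝒢)
    (hvan : ∀ A ∈ 𝒢, ∀ (n : ℕ) (c : SChain X (n + 3)), RelCycle A c → RelNull A c)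
    (l : List (Set X)) (hl : ∀ A ∈ l, A ∈ 𝒢) (n : ℕ) (c : SChain X (n + 3))
    (hc : RelCycle (⋃ A ∈ l, A) c) : RelNull (⋃ A ∈ l, A) c := by
  induction hk : l.length generalizing l n with
  | zero =>
    obtain rfl := List.length_eq_zero_iff.1 hk
    simp only [List.not_mem_nil, Set.iUnion_of_empty, Set.iUnion_empty]
    exact relNull_empty c
  | succ k ih =>
    obtain ⟨A, l, rfl⟩ := List.exists_cons_of_length_eq_add_one hk
    have hU : (⋃ B ∈ A :: l, B) = A ∪ ⋃ B ∈ l, B := by simp [Set.iUnion_or, Set.iUnion_union_distrib]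
    have hI : A ∩ (⋃ B ∈ l, B) = ⋃ B ∈ l.map (A ∩ ·), B := by simp [Set.inter_iUnion]
    have hl' : ∀ B ∈ l, B ∈ 𝒢 := fun B hB => hl B (List.mem_cons_of_mem _ hB)
    rw [hU] at hc ⊢
    refine RelNull.union (hcl A (hl A List.mem_cons_self)) ?_
      (hvan A (hl A List.mem_cons_self) n c (hc.mono Set.subset_union_left))
      (ih l hl' n c (hc.mono Set.subset_union_right) (by simpa using hk)) fun e he => ?_
    · exact Set.Finite.isClosed_biUnion (List.finite_toSet l) fun B hB => hcl B (hl' B hB)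
    · rw [hI] at he ⊢
      refine ih _ ?_ (n + 1) e he (by simpa using hk)
      intro B hB
      obtain ⟨B', hB', rfl⟩ := List.mem_map.1 hB
      exact hint _ (hl A List.mem_cons_self) _ (hl' B' hB')

/-- In the situation of `relNull_iUnion_of_vanishing`, a relative `2`-cycle that bounds relative to
each member of a finite union bounds relative to the union. -/
lemma relNull_iUnion_of_forall {𝒢 : Set (Set X)} (hcl : ∀ A ∈ 𝒢, IsClosed A)
    (hint : ∀ A ∈ 𝒢, ∀ B ∈ 𝒢, A ∩ B ∈ 𝒢)
    (hvan : ∀ A ∈ 𝒢, ∀ (n : ℕ) (c : SChain X (n + 3)), RelCycle A c → RelNull A c)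
    (l : List (Set X)) (hl : ∀ A ∈ l, A ∈ 𝒢) (c : SChain X 2) (hc : ∀ A ∈ l, RelNull A c) :
    RelNull (⋃ A ∈ l, A) c := by
  induction l with
  | nil =>
    simp only [List.not_mem_nil, Set.iUnion_of_empty, Set.iUnion_empty]
    exact relNull_empty c
  | cons A l ih =>
    have hU : (⋃ B ∈ A :: l, B) = A ∪ ⋃ B ∈ l, B := by simp [Set.iUnion_or, Set.iUnion_union_distrib]
    have hI : A ∩ (⋃ B ∈ l, B) = ⋃ B ∈ l.map (A ∩ ·), B := by simp [Set.inter_iUnion]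
    have hl' : ∀ B ∈ l, B ∈ 𝒢 := fun B hB => hl B (List.mem_cons_of_mem _ hB)
    rw [hU]
    refine RelNull.union (hcl A (hl A List.mem_cons_self)) ?_ (hc A List.mem_cons_self)
      (ih hl' fun B hB => hc B (List.mem_cons_of_mem _ hB)) fun e he => ?_
    · exact Set.Finite.isClosed_biUnion (List.finite_toSet l) fun B hB => hcl B (hl' B hB)
    · rw [hI] at he ⊢
      refine relNull_iUnion_of_vanishing hcl hint hvan _ ?_ 0 e he
      intro B hB
      obtain ⟨B', hB', rfl⟩ := List.mem_map.1 hB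
      exact hint _ (hl A List.mem_cons_self) _ (hl' B' hB')

end Relative

/-! ### Relative homology of the plane -/

section Plane

/-- Pushing radially away from `z`: a relative cycle of a bounded convex set bounds as soon as it
bounds relative to the complement of one point `z` of the set. -/
lemma RelNull.of_point {E : Type} [NormedAddCommGroup E] [NormedSpace ℝ E] {K : Set E}
    (hK : Convex ℝ K) (hb : Bornology.IsBounded K) {z : E} (hz : z ∈ K) {n : ℕ}
    {c : SChain E (n + 1)} (hc : RelCycle K c) (h : RelNull {z} c) : RelNull K c := by
  obtain ⟨e, he⟩ := h
  have hemb : Topology.IsEmbedding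
      (⟨Subtype.val, continuous_subtype_val⟩ : C(({z}ᶜ : Set E), E)) :=
    Topology.IsEmbedding.subtypeVal
  obtain ⟨u, -, hu⟩ := exists_pushS_eq hemb he (fun x hx => ⟨⟨x, hx⟩, rfl⟩)
  obtain ⟨R, hR0, hR⟩ : ∃ R > 0, K ⊆ Metric.closedBall z R := by
    obtain ⟨R, hR⟩ := hb.subset_closedBall z
    exact ⟨max R 1, by positivity, hR.trans (Metric.closedBall_subset_closedBall (le_max_left _ _))⟩
  have hne (w : ({z}ᶜ : Set E)) : ‖(w : E) - z‖ ≠ 0 := norm_ne_zero_iff.2 (sub_ne_zero.2 w.2)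
  -- at time `1` the homotopy has added `R` to the distance from `z`, so it has left `K`
  let H : C(({z}ᶜ : Set E) × unitInterval, E) :=
    ⟨fun p => (p.1 : E) + ((p.2 : ℝ) * (R / ‖(p.1 : E) - z‖)) • ((p.1 : E) - z), by
      refine Continuous.add (by fun_prop) (Continuous.smul (Continuous.mul (by fun_prop)
        (Continuous.div continuous_const (by fun_prop) fun p => hne p.1)) (by fun_prop))⟩
  have hH (w : ({z}ᶜ : Set E)) (s : unitInterval) :
      H (w, s) = z + (1 + (s : ℝ) * (R / ‖(w : E) - z‖)) • ((w : E) - z) := by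
    change (w : E) + _ = _
    rw [add_smul, one_smul]
    abel
  have hpos (w : ({z}ᶜ : Set E)) (s : unitInterval) : 0 ≤ (s : ℝ) * (R / ‖(w : E) - z‖) :=
    mul_nonneg s.2.1 (div_nonneg hR0.le (norm_nonneg _))
  have hdu : dS n u ∈ chainsIn (Subtype.val ⁻¹' Kᶜ : Set ({z}ᶜ : Set E)) n := by
    refine mem_chainsIn_of_pushS hemb.injective ?_
    rw [← dS_pushS, hu, map_sub, dS_dS, sub_zero]
    exact hc
  have hoff : ∀ w ∈ (Subtype.val ⁻¹' Kᶜ : Set ({z}ᶜ : Set E)), ∀ s, H (w, s) ∈ Kᶜ := ?_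
  · have h1 := relNull_of_homotopy H hoff hdu
    have h0 : slice H 0 = ⟨Subtype.val, continuous_subtype_val⟩ := by
      refine ContinuousMap.ext fun w => ?_
      change (w : E) + ((0 : ℝ) * _) • _ = w
      rw [zero_mul, zero_smul, add_zero]
    rw [h0, hu] at h1
    have h2 : RelNull K (pushS (slice H 1) (n + 1) u) := by
      refine RelNull.of_mem (pushS_mem_chainsIn_of_range (fun w hw => ?_) u)
      have h3 := hR hw
      change H (w, 1) ∈ _ at h3
      rw [hH, Metric.mem_closedBall, dist_eq_norm, add_sub_cancel_left, norm_smul,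
        Real.norm_of_nonneg (by linarith [hpos w 1])] at h3
      rw [Set.Icc.coe_one, one_mul, add_mul, one_mul, div_mul_cancel₀ _ (hne w)] at h3
      have := lt_of_le_of_ne (norm_nonneg _) (hne w).symm
      linarith
    have h3 := (h2.sub h1).add (RelNull.of_dS e)
    rwa [sub_sub_cancel, sub_add_cancel] at h3
  · -- `w` lies on the segment from `z` to its image under the homotopy
    intro w hw s hs
    refine hw ?_
    have hq := hpos w s
    rw [hH] at hs
    have := hK hz hs (a := 1 - (1 + (s : ℝ) * (R / ‖(w : E) - z‖))⁻¹)
      (b := (1 + (s : ℝ) * (R / ‖(w : E) - z‖))⁻¹)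
      (by rw [sub_nonneg]; exact inv_le_one_of_one_le₀ (by linarith)) (by positivity) (by ring)
    rw [smul_add, smul_smul, inv_mul_cancel₀ (by positivity), one_smul, ← add_assoc, ← add_smul,
      sub_add_cancel, one_smul, add_sub_cancel] at this
    exact this

/-- A chain in the union of two disjoint open sets splits. -/
lemma chainsIn_union_of_disjoint {X : Type} [TopologicalSpace X] {L R : Set X} (hL : IsOpen L)
    (hR : IsOpen R) (hd : Disjoint L R) {n : ℕ} {c : SChain X n} (hc : c ∈ chainsIn (L ∪ R) n) :
    c ∈ chainsIn L n ⊔ chainsIn R n := by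
  refine map_chainsIn LinearMap.id _ (fun σ hσ => ?_) hc
  rcases IsPreconnected.subset_or_subset hL hR hd (Set.range_subset_iff.2 hσ)
    (isPreconnected_range σ.continuous) with h | h
  · exact Submodule.mem_sup_left (single_mem_chainsIn (Set.range_subset_iff.1 h) 1)
  · exact Submodule.mem_sup_right (single_mem_chainsIn (Set.range_subset_iff.1 h) 1)

/-- Cycles of positive degree in the union of two disjoint open convex sets bound. -/
lemma exists_dS_eq_of_disjoint_convex {E : Type} [NormedAddCommGroup E] [NormedSpace ℝ E]
    {L R : Set E} (hL : IsOpen L) (hR : IsOpen R) (hd : Disjoint L R) (hL' : Convex ℝ L)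
    (hR' : Convex ℝ R) (hLn : L.Nonempty) (hRn : R.Nonempty) {n : ℕ} {c : SChain E (n + 1)}
    (hc : c ∈ chainsIn (L ∪ R) (n + 1)) (hcd : dS n c = 0) :
    ∃ e ∈ chainsIn (L ∪ R) (n + 2), dS (n + 1) e = c := by
  obtain ⟨a, ha, b, hb, rfl⟩ := Submodule.mem_sup.1 (chainsIn_union_of_disjoint hL hR hd hc)
  have hab : dS n a = -dS n b := by rw [map_add] at hcd; exact eq_neg_of_add_eq_zero_left hcd
  have ha0 : dS n a = 0 := by
    refine chainsIn_empty ?_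
    rw [← Set.disjoint_iff_inter_eq_empty.1 hd]
    refine chainsIn_inter (dS_mem_chainsIn ha) ?_
    rw [hab]
    exact Submodule.neg_mem _ (dS_mem_chainsIn hb)
  have hb0 : dS n b = 0 := by rw [ha0, zero_eq_neg] at hab; exact hab
  obtain ⟨x, hx⟩ := hLn
  obtain ⟨y, hy⟩ := hRn
  obtain ⟨e, he, rfl⟩ := exists_dS_eq_of_starConvex hx (hL'.starConvex hx) ha ha0
  obtain ⟨f, hf, rfl⟩ := exists_dS_eq_of_starConvex hy (hR'.starConvex hy) hb hb0
  exact ⟨e + f, Submodule.add_mem _ (chainsIn_mono Set.subset_union_left _ he)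
    (chainsIn_mono Set.subset_union_right _ hf), map_add _ _ _⟩

/-- The punctured plane has no homology in degrees at least `2`: it is the union of two slit planes,
which are star-convex and meet in two half-planes. -/
lemma exists_dS_eq_of_punctured {z : ℂ} {n : ℕ} {b : SChain ℂ (n + 2)}
    (hb : b ∈ chainsIn {z}ᶜ (n + 2)) (hd : dS (n + 1) b = 0) :
    ∃ g ∈ chainsIn {z}ᶜ (n + 3), dS (n + 2) g = b := by
  set L : Set ℂ := {w | w.re < z.re} with hL
  set R : Set ℂ := {w | z.re < w.re} with hR
  set U₁ : Set ℂ := L ∪ R ∪ {w | w.im < z.im} with hU₁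
  set U₂ : Set ℂ := L ∪ R ∪ {w | z.im < w.im} with hU₂
  have hLo : IsOpen L := isOpen_lt Complex.continuous_re continuous_const
  have hRo : IsOpen R := isOpen_lt continuous_const Complex.continuous_re
  have h1o : IsOpen U₁ := (hLo.union hRo).union (isOpen_lt Complex.continuous_im continuous_const)
  have h2o : IsOpen U₂ := (hLo.union hRo).union (isOpen_lt continuous_const Complex.continuous_im)
  have hu : U₁ ∪ U₂ = {z}ᶜ := by
    ext w
    simp only [hU₁, hU₂, hL, hR, Set.mem_union, Set.mem_ofPred_eq, Set.mem_compl_iff,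
      Set.mem_singleton_iff, Complex.ext_iff]
    grind
  have hi : U₁ ∩ U₂ = L ∪ R := by
    ext w
    simp only [hU₁, hU₂, hL, hR, Set.mem_union, Set.mem_ofPred_eq, Set.mem_inter_iff]
    grind
  have hs1 : StarConvex ℝ (z - Complex.I) U₁ := by
    intro w hw a b ha hb hab
    obtain rfl : a = 1 - b := by linarith
    simp only [hU₁, hL, hR, Set.mem_union, Set.mem_ofPred_eq] at hw ⊢
    simp
    rcases hb.eq_or_lt with rfl | hb'
    · right; linarith
    · rcases hw with (h | h) | h
      · left; intro h0; nlinarith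
      · left; intro h0; nlinarith
      · right; nlinarith
  have hs2 : StarConvex ℝ (z + Complex.I) U₂ := by
    intro w hw a b ha hb hab
    obtain rfl : a = 1 - b := by linarith
    simp only [hU₂, hL, hR, Set.mem_union, Set.mem_ofPred_eq] at hw ⊢
    simp
    rcases hb.eq_or_lt with rfl | hb'
    · right; linarith
    · rcases hw with (h | h) | h
      · left; intro h0; nlinarith
      · left; intro h0; nlinarith
      · right; nlinarith
  -- Mayer–Vietoris for the two slit planes
  obtain ⟨m, hm⟩ := exists_sdPow_mem h1o h2o (c := b) (by rwa [hu])
  obtain ⟨b₁, hb₁, b₂, hb₂, h12⟩ := Submodule.mem_sup.1 hm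
  have hsum : dS (n + 1) b₁ + dS (n + 1) b₂ = 0 := by
    rw [← map_add, h12, dS_sdPow, hd, map_zero]
  have hmem : dS (n + 1) b₁ ∈ chainsIn (L ∪ R) (n + 1) := by
    rw [← hi]
    refine chainsIn_inter (dS_mem_chainsIn hb₁) ?_
    rw [eq_neg_of_add_eq_zero_left hsum]
    exact Submodule.neg_mem _ (dS_mem_chainsIn hb₂)
  obtain ⟨f, hf, hfd⟩ := exists_dS_eq_of_disjoint_convex hLo hRo
    (Set.disjoint_left.2 fun w (h : w.re < z.re) (h' : z.re < w.re) => lt_asymm h h')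
    (convex_halfSpace_lt Complex.reLm.isLinear _)
    (convex_halfSpace_gt Complex.reLm.isLinear _) ⟨z - 1, by simp [hL]⟩ ⟨z + 1, by simp [hR]⟩
    hmem (dS_dS n b₁)
  rw [← hi] at hf
  obtain ⟨g₁, hg₁, hgd₁⟩ := exists_dS_eq_of_starConvex (c := b₁ - f)
    (show z - Complex.I ∈ U₁ by right; simp) hs1
    (Submodule.sub_mem _ hb₁ (chainsIn_mono Set.inter_subset_left _ hf))
    (by rw [map_sub, hfd, sub_self])
  obtain ⟨g₂, hg₂, hgd₂⟩ := exists_dS_eq_of_starConvex (c := b₂ + f)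
    (show z + Complex.I ∈ U₂ by right; simp) hs2
    (Submodule.add_mem _ hb₂ (chainsIn_mono Set.inter_subset_right _ hf))
    (by rw [map_add, hfd]; exact (add_comm _ _).trans hsum)
  have hT := dS_tPow m (n + 1) b
  rw [hd, map_zero, add_zero] at hT
  refine ⟨g₁ + g₂ + tPow m (n + 2) b, ?_, ?_⟩
  · rw [← hu]
    refine Submodule.add_mem _ (Submodule.add_mem _ (chainsIn_mono Set.subset_union_left _ hg₁)
      (chainsIn_mono Set.subset_union_right _ hg₂)) (tPow_mem_chainsIn (by rwa [hu]))
  · rw [map_add, map_add, hgd₁, hgd₂, hT, ← h12]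
    abel

/-- The plane has no local homology in degrees at least `3`. -/
lemma RelCycle.relNull_of_plane {z : ℂ} {n : ℕ} {c : SChain ℂ (n + 3)} (hc : RelCycle {z} c) :
    RelNull {z} c := by
  obtain ⟨g, hg, hgd⟩ := exists_dS_eq_of_punctured hc (dS_dS _ _)
  obtain ⟨e, -, he⟩ := exists_dS_eq_of_starConvex (c := c - g) (Set.mem_univ (0 : ℂ))
    (convex_univ.starConvex (Set.mem_univ _)) (chainsIn_univ _ _) (by rw [map_sub, hgd, sub_self])
  refine ⟨e, ?_⟩
  rw [he, sub_sub_cancel]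
  exact hg

/-- Local homology in a chart: a relative cycle of a set that is compact and convex in a plane chart
bounds as soon as it bounds relative to the complement of one point of the set. -/
lemma RelNull.of_point_of_chart {V Y : Type} [TopologicalSpace V] [TopologicalSpace Y]
    {f : C(V, Y)} (hf : Topology.IsOpenEmbedding f) {g : C(V, ℂ)}
    (hg : Topology.IsOpenEmbedding g) [T1Space Y] {K : Set V} (hfK : IsClosed (f '' K))
    (hgK : IsCompact (g '' K)) (hconv : Convex ℝ (g '' K)) {x : V} (hx : x ∈ K) {n : ℕ}
    {c : SChain Y (n + 1)} (hc : RelCycle (f '' K) c) (h : RelNull {f x} c) :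
    RelNull (f '' K) c := by
  obtain ⟨c', hc', hcc⟩ := hc.exists_push hf hfK
  have hsub : ({f x} : Set Y) ⊆ f '' K := Set.singleton_subset_iff.2 ⟨x, hx, rfl⟩
  have h1 : RelNull {f x} (pushS f (n + 1) c') := by
    have := h.sub (hcc.mono hsub)
    rwa [sub_sub_cancel] at this
  have h2 : RelNull {x} c' := by
    refine RelNull.of_push hf ?_ (hc'.mono (Set.singleton_subset_iff.2 hx)) ?_
    · rw [Set.image_singleton]; exact isClosed_singleton
    · rwa [Set.image_singleton]
  have h3 : RelNull {g x} (pushS g (n + 1) c') := by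
    have := h2.push (mapsTo_compl_image hg.injective {x})
    rwa [Set.image_singleton] at this
  have h4 : RelNull K c' := RelNull.of_push hg hgK.isClosed hc' <|
    RelNull.of_point hconv hgK.isBounded ⟨x, hx, rfl⟩
      (hc'.push (mapsTo_compl_image hg.injective K)) h3
  have := hcc.add (h4.push (mapsTo_compl_image hf.injective K))
  rwa [sub_add_cancel] at this

/-- Local homology in a chart vanishes in degrees at least `3`. -/
lemma RelCycle.relNull_of_chart {V Y : Type} [TopologicalSpace V] [TopologicalSpace Y]
    {f : C(V, Y)} (hf : Topology.IsOpenEmbedding f) {g : C(V, ℂ)}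
    (hg : Topology.IsOpenEmbedding g) {K : Set V} (hfK : IsClosed (f '' K))
    (hgK : IsCompact (g '' K)) (hconv : Convex ℝ (g '' K)) {n : ℕ}
    {c : SChain Y (n + 3)} (hc : RelCycle (f '' K) c) : RelNull (f '' K) c := by
  rcases K.eq_empty_or_nonempty with rfl | ⟨x, hx⟩
  · rw [Set.image_empty]; exact relNull_empty c
  obtain ⟨c', hc', hcc⟩ := hc.exists_push hf hfK
  have h3 := hc'.push (mapsTo_compl_image hg.injective K)
  have hsub : ({g x} : Set ℂ) ⊆ g '' K := Set.singleton_subset_iff.2 ⟨x, hx, rfl⟩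
  have h4 : RelNull K c' := RelNull.of_push hg hgK.isClosed hc' <|
    RelNull.of_point hconv hgK.isBounded ⟨x, hx, rfl⟩ h3 (h3.mono hsub).relNull_of_plane
  have := hcc.add (h4.push (mapsTo_compl_image hf.injective K))
  rwa [sub_add_cancel] at this

end Plane

/-! ### The action of a strictly hyperbolic Fuchsian group -/

section Action

open Pointwise

/-- The subgroup of `SL(2, ℝ)` lying over a subgroup of `PSL(2, ℝ)`. -/
def liftSL (Γ : Subgroup PSL(2, ℝ)) : Subgroup SL(2, ℝ) := Γ.comap (QuotientGroup.mk' _)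

/-- Discreteness lifts along `SL(2, ℝ) → PSL(2, ℝ)` because the kernel is finite. -/
lemma discreteTopology_liftSL {Γ : Subgroup PSL(2, ℝ)} (h : DiscreteTopology Γ) :
    DiscreteTopology (liftSL Γ) := by
  let f : liftSL Γ → Γ := fun A => ⟨QuotientGroup.mk A.1, A.2⟩
  have hf : Continuous f := Continuous.subtype_mk (continuous_quotient_mk'.comp
    continuous_subtype_val) _
  have hopen : IsOpen (f ⁻¹' {1}) := (isOpen_discrete _).preimage hf
  have hcard : NeZero (max (Fintype.card (Fin 2)) 1) := ⟨by simp⟩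
  have hcenter : Finite (Subgroup.center SL(2, ℝ)) :=
    Finite.of_equiv _ (Matrix.SpecialLinearGroup.center_equiv_rootsOfUnity (n := Fin 2) (R := ℝ)).symm.toEquiv
  have hfin : (f ⁻¹' {1}).Finite := by
    have : f ⁻¹' {1} = Subtype.val ⁻¹' (Subgroup.center SL(2, ℝ) : Set SL(2, ℝ)) := by
      ext A
      simp only [Set.mem_preimage, Set.mem_singleton_iff, SetLike.mem_coe, f]
      rw [← QuotientGroup.eq_one_iff, Subtype.ext_iff]
      rfl
    rw [this]
    exact Set.Finite.preimage Subtype.val_injective.injOn (Set.toFinite _)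
  refine discreteTopology_of_isOpen_singleton_one ?_
  have : ({1} : Set (liftSL Γ)) = f ⁻¹' {1} \ (f ⁻¹' {1} \ {1}) := by
    ext A
    simp only [Set.mem_singleton_iff, Set.mem_sdiff, Set.mem_preimage]
    constructor
    · rintro rfl
      exact ⟨Subtype.ext rfl, fun h => h.2 rfl⟩
    · rintro ⟨h1, h2⟩
      by_contra h3
      exact h2 ⟨h1, h3⟩
  rw [this]
  exact hopen.sdiff (hfin.subset Set.sdiff_subset).isClosed

variable {Γ : Subgroup PSL(2, ℝ)}

lemma properlyDiscontinuousSMul_of_discrete (h : DiscreteTopology Γ) :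
    ProperlyDiscontinuousSMul Γ ℍ := by
  have := discreteTopology_liftSL h
  have hp : ProperlyDiscontinuousSMul (liftSL Γ) ℍ := inferInstance
  refine ⟨fun {K L} hK hL => ?_⟩
  refine ((hp.finite_disjoint_inter_image hK hL).image
    fun A : liftSL Γ => (⟨QuotientGroup.mk A.1, A.2⟩ : Γ)).subset ?_
  rintro ⟨γ, hγ⟩ hne
  induction γ using QuotientGroup.induction_on with
  | H A => exact ⟨⟨A, hγ⟩, hne, rfl⟩

/-- A hyperbolic element has no fixed point in the upper half-plane. -/
lemma smul_ne_of_isHyperbolic (A : SL(2, ℝ)) (hA : A.val.IsHyperbolic) (z : ℍ) : A • z ≠ z := by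
  intro h
  have h1 := congrArg ((↑) : ℍ → ℂ) h
  rw [coe_specialLinearGroup_apply] at h1
  have hden : (((A 1 0 : ℝ) : ℂ) * z + ((A 1 1 : ℝ) : ℂ)) ≠ 0 :=
    UpperHalfPlane.denom_ne_zero A z
  simp only [Algebra.algebraMap_self, RingHom.id_apply] at h1
  rw [div_eq_iff hden] at h1
  -- `A z = z` is a quadratic equation for `z`; as `z` is not real, its discriminant is not positive
  have hre := congrArg Complex.re h1
  have him := congrArg Complex.im h1
  simp at hre him
  have hy := z.im_pos
  rw [Matrix.IsHyperbolic, Matrix.discr_fin_two, Matrix.trace_fin_two, Matrix.det_fin_two] at hA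
  have e1 : A.val 0 0 - A.val 1 1 = 2 * A.val 1 0 * z.re := by
    have : (A.val 0 0 - A.val 1 1 - 2 * A.val 1 0 * z.re) * z.im = 0 := by
      linear_combination him
    rcases mul_eq_zero.1 this with h | h
    · linarith
    · exact absurd h hy.ne'
  have e2 : A.val 0 1 = - (A.val 1 0 * (z.re ^ 2 + z.im ^ 2)) := by
    linear_combination hre - z.re * e1
  have : (A.val 0 0 + A.val 1 1) ^ 2 - 4 * (A.val 0 0 * A.val 1 1 - A.val 0 1 * A.val 1 0) =
      - 4 * (A.val 1 0 * z.im) ^ 2 := by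
    rw [e2]
    linear_combination (A.val 0 0 - A.val 1 1 + 2 * A.val 1 0 * z.re) * e1
  nlinarith [sq_nonneg (A.val 1 0 * z.im)]

/-- A strictly hyperbolic group acts freely on the upper half-plane. -/
lemma isCancelSMul_of_hyperbolic (h : IsStrictlyHyperbolicFuchsian Γ) : IsCancelSMul Γ ℍ := by
  refine isCancelSMul_iff_eq_one_of_smul_eq.2 ?_
  rintro ⟨γ, hγ⟩ z hz
  induction γ using QuotientGroup.induction_on with
  | H A =>
    by_contra hne
    have hne' : (QuotientGroup.mk A : PSL(2, ℝ)) ≠ 1 := fun h => hne (Subtype.ext h)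
    exact smul_ne_of_isHyperbolic A (h.hyperbolic A hγ hne') z hz

lemma dist_smul_smul (γ : Γ) (z w : ℍ) : dist (γ • z) (γ • w) = dist z w := by
  obtain ⟨γ, hγ⟩ := γ
  induction γ using QuotientGroup.induction_on with
  | H A => exact dist_smul A z w

variable (Γ) in
/-- The projection `ℍ → Γ\ℍ`. -/
def proj : C(ℍ, MulAction.orbitRel.Quotient Γ ℍ) := (orbitMap Γ ℍ).hom

lemma proj_smul (γ : Γ) (z : ℍ) : proj Γ (γ • z) = proj Γ z := Quotient.sound ⟨γ, rfl⟩

lemma proj_eq_iff {z w : ℍ} : proj Γ z = proj Γ w ↔ ∃ γ : Γ, γ • w = z := Quotient.eq''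

lemma proj_surjective : Function.Surjective (proj Γ) := Quotient.mk_surjective

lemma isOpenMap_proj : IsOpenMap (proj Γ) := isOpenMap_quotient_mk'_mul

/-- The translates of a point stay a uniform distance apart, if the quotient is compact: locally this
is proper discontinuity, and the distance is constant on orbits up to conjugation in `Γ`. -/
lemma exists_le_dist_smul [CompactSpace (MulAction.orbitRel.Quotient Γ ℍ)]
    [ProperlyDiscontinuousSMul Γ ℍ] [IsCancelSMul Γ ℍ] :
    ∃ r > 0, ∀ (z : ℍ) (γ : Γ), γ ≠ 1 → r ≤ dist z (γ • z) := by
  have hloc (z : ℍ) : ∃ δ > 0, ∀ w ∈ Metric.ball z δ, ∀ γ : Γ, γ ≠ 1 → δ ≤ dist w (γ • w) := by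
    obtain ⟨U, hU, hUγ⟩ := ProperlyDiscontinuousSMul.exists_nhds_image_smul_eq_self Γ z
    obtain ⟨ε, hε, hεU⟩ := Metric.mem_nhds_iff.1 hU
    refine ⟨ε / 2, by positivity, fun w hw γ hγ => ?_⟩
    by_contra! hlt
    refine hγ (isCancelSMul_iff_eq_one_of_smul_eq.1 ‹_› γ z (hUγ γ ⟨γ • w, ⟨w, ?_, rfl⟩, ?_⟩))
    · exact hεU (Metric.ball_subset_ball (by linarith) hw)
    · refine hεU ?_
      rw [Metric.mem_ball] at hw ⊢
      have := dist_triangle_left (γ • w) z w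
      linarith
  choose δ hδ hδγ using hloc
  obtain ⟨t, ht⟩ := isCompact_univ.elim_finite_subcover
    (fun z : ℍ => proj Γ '' Metric.ball z (δ z)) (fun z => isOpenMap_proj _ Metric.isOpen_ball)
    (fun x _ => by
      obtain ⟨z, rfl⟩ := proj_surjective x
      exact Set.mem_iUnion.2 ⟨z, z, Metric.mem_ball_self (hδ z), rfl⟩)
  have hne : t.Nonempty := by
    obtain ⟨z, hz, -⟩ := Set.mem_iUnion₂.1 (ht (Set.mem_univ (proj Γ UpperHalfPlane.I)))
    exact ⟨z, hz⟩
  obtain ⟨z₀, hz₀, hmin⟩ := t.exists_min_image δ hne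
  refine ⟨δ z₀, hδ z₀, fun z γ hγ => ?_⟩
  obtain ⟨p, hp, w, hw, hwz⟩ := Set.mem_iUnion₂.1 (ht (Set.mem_univ (proj Γ z)))
  obtain ⟨η, rfl⟩ := proj_eq_iff.1 hwz
  refine (hmin p hp).trans ((hδγ p _ hw (η * γ * η⁻¹) ?_).trans (le_of_eq ?_))
  · intro h
    exact hγ (by rwa [mul_inv_eq_one, mul_eq_left] at h)
  · rw [mul_smul, mul_smul, inv_smul_smul, dist_smul_smul]

end Action

/-! ### Local homology of the surface -/

section Surface

variable {Γ : Subgroup PSL(2, ℝ)}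

/-- The projection restricted to a subset. -/
def projOn (Γ : Subgroup PSL(2, ℝ)) (U : Set ℍ) : C(U, MulAction.orbitRel.Quotient Γ ℍ) :=
  (proj Γ).comp ⟨Subtype.val, continuous_subtype_val⟩

/-- The inclusion of a subset of the upper half-plane in the plane. -/
def coeOn (U : Set ℍ) : C(U, ℂ) :=
  ⟨fun z => ((z : ℍ) : ℂ), UpperHalfPlane.continuous_coe.comp continuous_subtype_val⟩

lemma isOpenEmbedding_projOn {U : Set ℍ} (hU : IsOpen U) (hinj : Set.InjOn (proj Γ) U) :
    Topology.IsOpenEmbedding (projOn Γ U) :=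
  .of_continuous_injective_isOpenMap (projOn Γ U).continuous hinj.injective
    (isOpenMap_proj.comp hU.isOpenMap_subtype_val)

lemma isOpenEmbedding_coeOn {U : Set ℍ} (hU : IsOpen U) : Topology.IsOpenEmbedding (coeOn U) :=
  UpperHalfPlane.isOpenEmbedding_coe.comp hU.isOpenEmbedding_subtypeVal

lemma projOn_image {U K : Set ℍ} (hK : K ⊆ U) : projOn Γ U '' (Subtype.val ⁻¹' K) = proj Γ '' K := by
  change (proj Γ ∘ Subtype.val) '' _ = _
  rw [Set.image_comp, Subtype.image_preimage_coe, Set.inter_eq_right.2 hK]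

lemma coeOn_image {U K : Set ℍ} (hK : K ⊆ U) :
    coeOn U '' (Subtype.val ⁻¹' K) = ((↑) : ℍ → ℂ) '' K := by
  change (((↑) : ℍ → ℂ) ∘ Subtype.val) '' _ = _
  rw [Set.image_comp, Subtype.image_preimage_coe, Set.inter_eq_right.2 hK]

/-- Balls of half the minimal distance between translates embed in the surface. -/
lemma injOn_proj_ball {r₀ : ℝ} (h₀ : ∀ (z : ℍ) (γ : Γ), γ ≠ 1 → r₀ ≤ dist z (γ • z)) (p : ℍ) :
    Set.InjOn (proj Γ) (Metric.ball p (r₀ / 2)) := by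
  intro z hz w hw h
  obtain ⟨γ, rfl⟩ := proj_eq_iff.1 h
  rw [Metric.mem_ball] at hz hw
  by_contra hne
  have := h₀ w γ (fun h1 => hne (by rw [h1, one_smul]))
  have := dist_triangle_right w (γ • w) p
  linarith

/-- Hyperbolic balls are Euclidean balls, hence convex in the plane. -/
lemma convex_coe_closedBall (p : ℍ) (r : ℝ) : Convex ℝ (((↑) : ℍ → ℂ) '' Metric.closedBall p r) := by
  rw [UpperHalfPlane.image_coe_closedBall]
  exact convex_closedBall _ _

/-- The intersection of the closed balls of radius `r` with given centers. -/
def ballInter (r : ℝ) (s : Finset ℍ) : Set ℍ := ⋂ p ∈ s, Metric.closedBall p r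

lemma isCompact_ballInter {r : ℝ} {s : Finset ℍ} (hs : s.Nonempty) : IsCompact (ballInter r s) := by
  obtain ⟨p, hp⟩ := hs
  exact (isCompact_closedBall p r).of_isClosed_subset
    (isClosed_biInter fun _ _ => Metric.isClosed_closedBall) (Set.biInter_subset_of_mem hp)

lemma convex_coe_ballInter {r : ℝ} {s : Finset ℍ} (hs : s.Nonempty) :
    Convex ℝ (((↑) : ℍ → ℂ) '' ballInter r s) := by
  rw [ballInter]
  have h := Set.InjOn.image_biInter_eq (f := ((↑) : ℍ → ℂ)) (p := fun i : ℍ => i ∈ s)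
    (s := fun p _ => Metric.closedBall p r) hs UpperHalfPlane.coe_injective.injOn
  rw [h]
  exact convex_iInter₂ fun p _ => convex_coe_closedBall p r

/-- The family of the projections of intersections of small balls is closed under intersection: a
translate that meets a small set is unique. -/
lemma proj_ballInter_inter {r₀ : ℝ} (hr₀ : 0 < r₀)
    (h₀ : ∀ (z : ℍ) (γ : Γ), γ ≠ 1 → r₀ ≤ dist z (γ • z)) {s t : Finset ℍ} (hs : s.Nonempty)
    (ht : t.Nonempty) : ∃ u : Finset ℍ, u.Nonempty ∧
      proj Γ '' ballInter (r₀ / 8) s ∩ proj Γ '' ballInter (r₀ / 8) t =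
        proj Γ '' ballInter (r₀ / 8) u := by
  classical
  have hmem (u : Finset ℍ) (z : ℍ) : z ∈ ballInter (r₀ / 8) u ↔ ∀ p ∈ u, dist z p ≤ r₀ / 8 := by
    simp [ballInter]
  have hdiam {u : Finset ℍ} (hu : u.Nonempty) {z w : ℍ} (hz : z ∈ ballInter (r₀ / 8) u)
      (hw : w ∈ ballInter (r₀ / 8) u) : dist z w ≤ r₀ / 4 := by
    obtain ⟨p, hp⟩ := hu
    have := dist_triangle_right z w p
    have := (hmem u z).1 hz p hp
    have := (hmem u w).1 hw p hp
    linarith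
  have hunion (γ : Γ) : ballInter (r₀ / 8) (s ∪ t.image (γ • ·)) =
      ballInter (r₀ / 8) s ∩ {z | γ⁻¹ • z ∈ ballInter (r₀ / 8) t} := by
    ext z
    have h (p : ℍ) : dist z (γ • p) = dist (γ⁻¹ • z) p := by
      rw [← dist_smul_smul γ⁻¹, inv_smul_smul]
    simp only [Set.mem_inter_iff, Set.mem_ofPred_eq, hmem, Finset.mem_union, Finset.mem_image]
    constructor
    · intro hz
      exact ⟨fun p hp => hz p (Or.inl hp), fun p hp => by
        rw [← h]; exact hz _ (Or.inr ⟨p, hp, rfl⟩)⟩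
    · rintro ⟨h1, h2⟩ p (hp | ⟨p, hp, rfl⟩)
      · exact h1 p hp
      · rw [h]; exact h2 p hp
  have hsup (γ : Γ) : proj Γ '' ballInter (r₀ / 8) (s ∪ t.image (γ • ·)) ⊆
      proj Γ '' ballInter (r₀ / 8) s ∩ proj Γ '' ballInter (r₀ / 8) t := by
    rw [hunion]
    rintro _ ⟨z, ⟨h1, h2⟩, rfl⟩
    exact ⟨⟨z, h1, rfl⟩, ⟨γ⁻¹ • z, h2, proj_smul _ _⟩⟩
  by_cases hex : ∃ v ∈ ballInter (r₀ / 8) s, ∃ γ : Γ, γ⁻¹ • v ∈ ballInter (r₀ / 8) t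
  · obtain ⟨v, hv, γ, hγ⟩ := hex
    refine ⟨s ∪ t.image (γ • ·), hs.mono Finset.subset_union_left, subset_antisymm ?_ (hsup γ)⟩
    rintro _ ⟨⟨w, hw, rfl⟩, ⟨w', hw', hww⟩⟩
    obtain ⟨η, rfl⟩ := proj_eq_iff.1 hww
    refine ⟨w, ?_, rfl⟩
    rw [hunion]
    refine ⟨hw, ?_⟩
    -- the translates `η • v` and `γ⁻¹ • v` have distance at most `r₀ / 2`
    have hη : η = γ⁻¹ := by
      by_contra hne
      have h1 := h₀ v (η⁻¹ * γ⁻¹) (fun h => hne (by rw [inv_mul_eq_one] at h; exact h))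
      have h2 : dist v ((η⁻¹ * γ⁻¹) • v) = dist (η • v) (γ⁻¹ • v) := by
        rw [mul_smul, ← dist_smul_smul η v, smul_inv_smul]
      have h3 := dist_triangle (η • v) (η • w) (γ⁻¹ • v)
      rw [dist_smul_smul] at h3
      have h4 := hdiam hs hv hw
      have h5 := hdiam ht hw' hγ
      linarith
    change γ⁻¹ • w ∈ ballInter (r₀ / 8) t
    rwa [← hη]
  · refine ⟨s ∪ t.image ((1 : Γ) • ·), hs.mono Finset.subset_union_left,
      subset_antisymm ?_ (hsup 1)⟩
    rintro _ ⟨⟨w, hw, rfl⟩, ⟨w', hw', hww⟩⟩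
    obtain ⟨η, rfl⟩ := proj_eq_iff.1 hww
    exact absurd ⟨w, hw, η⁻¹, by rwa [inv_inv]⟩ hex

variable [ProperlyDiscontinuousSMul Γ ℍ]

lemma t2Space_quotient : T2Space (MulAction.orbitRel.Quotient Γ ℍ) :=
  t2Space_of_properlyDiscontinuousSMul_of_t2Space

/-- On the surface, a relative cycle of a small convex set bounds as soon as it bounds relative to
the complement of one point of the set. -/
lemma RelNull.of_point_of_surface {U K : Set ℍ} (hU : IsOpen U) (hinj : Set.InjOn (proj Γ) U)
    (hKU : K ⊆ U) (hK : IsCompact K) (hconv : Convex ℝ (((↑) : ℍ → ℂ) '' K)) {z : ℍ} (hz : z ∈ K)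
    {n : ℕ} {c : SChain (MulAction.orbitRel.Quotient Γ ℍ) (n + 1)} (hc : RelCycle (proj Γ '' K) c)
    (h : RelNull {proj Γ z} c) : RelNull (proj Γ '' K) c := by
  have := t2Space_quotient (Γ := Γ)
  rw [← projOn_image hKU] at hc ⊢
  refine RelNull.of_point_of_chart (isOpenEmbedding_projOn hU hinj) (isOpenEmbedding_coeOn hU)
    ?_ ?_ ?_ (x := ⟨z, hKU hz⟩) hz hc h
  · rw [projOn_image hKU]; exact (hK.image (proj Γ).continuous).isClosed
  · rw [coeOn_image hKU]; exact hK.image UpperHalfPlane.continuous_coe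
  · rwa [coeOn_image hKU]

/-- On the surface, the homology relative to the complement of a small convex set vanishes in degrees
at least `3`. -/
lemma RelCycle.relNull_of_surface {U K : Set ℍ} (hU : IsOpen U) (hinj : Set.InjOn (proj Γ) U)
    (hKU : K ⊆ U) (hK : IsCompact K) (hconv : Convex ℝ (((↑) : ℍ → ℂ) '' K))
    {n : ℕ} {c : SChain (MulAction.orbitRel.Quotient Γ ℍ) (n + 3)} (hc : RelCycle (proj Γ '' K) c) :
    RelNull (proj Γ '' K) c := by
  have := t2Space_quotient (Γ := Γ)
  rw [← projOn_image hKU] at hc ⊢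
  refine RelCycle.relNull_of_chart (isOpenEmbedding_projOn hU hinj) (isOpenEmbedding_coeOn hU)
    ?_ ?_ ?_ hc
  · rw [projOn_image hKU]; exact (hK.image (proj Γ).continuous).isClosed
  · rw [coeOn_image hKU]; exact hK.image UpperHalfPlane.continuous_coe
  · rwa [coeOn_image hKU]

/-- A `2`-cycle of the compact surface whose local classes all vanish bounds. Finitely many small
closed balls cover the surface; the cycle bounds relative to the complement of each of them, hence
relative to the complement of their union, which is empty. -/
lemma exists_dS_eq_of_local [CompactSpace (MulAction.orbitRel.Quotient Γ ℍ)] [IsCancelSMul Γ ℍ]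
    {c : SChain (MulAction.orbitRel.Quotient Γ ℍ) 2} (hc : dS 1 c = 0)
    (h : ∀ x, RelNull {x} c) : ∃ e, dS 2 e = c := by
  have := t2Space_quotient (Γ := Γ)
  obtain ⟨r₀, hr₀, h₀⟩ := exists_le_dist_smul (Γ := Γ)
  set 𝒢 : Set (Set (MulAction.orbitRel.Quotient Γ ℍ)) :=
    {A | ∃ s : Finset ℍ, s.Nonempty ∧ A = proj Γ '' ballInter (r₀ / 8) s} with h𝒢
  have hsub {s : Finset ℍ} {p : ℍ} (hp : p ∈ s) :
      ballInter (r₀ / 8) s ⊆ Metric.ball p (r₀ / 2) :=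
    (Set.biInter_subset_of_mem hp).trans (Metric.closedBall_subset_ball (by linarith))
  have hcl : ∀ A ∈ 𝒢, IsClosed A := by
    rintro _ ⟨s, hs, rfl⟩
    exact ((isCompact_ballInter hs).image (proj Γ).continuous).isClosed
  have hint : ∀ A ∈ 𝒢, ∀ B ∈ 𝒢, A ∩ B ∈ 𝒢 := by
    rintro _ ⟨s, hs, rfl⟩ _ ⟨t, ht, rfl⟩
    exact proj_ballInter_inter hr₀ h₀ hs ht
  have hvan : ∀ A ∈ 𝒢, ∀ (n : ℕ) (c : SChain (MulAction.orbitRel.Quotient Γ ℍ) (n + 3)),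
      RelCycle A c → RelNull A c := by
    rintro _ ⟨s, hs, rfl⟩ n c hc
    obtain ⟨p, hp⟩ := hs
    exact hc.relNull_of_surface Metric.isOpen_ball (injOn_proj_ball h₀ p) (hsub hp)
      (isCompact_ballInter ⟨p, hp⟩) (convex_coe_ballInter ⟨p, hp⟩)
  have hnull : ∀ A ∈ 𝒢, RelNull A c := by
    rintro _ ⟨s, hs, rfl⟩
    obtain ⟨p, hp⟩ := hs
    rcases (ballInter (r₀ / 8) s).eq_empty_or_nonempty with he | ⟨z, hz⟩
    · rw [he, Set.image_empty]; exact relNull_empty c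
    · exact RelNull.of_point_of_surface Metric.isOpen_ball (injOn_proj_ball h₀ p) (hsub hp)
        (isCompact_ballInter ⟨p, hp⟩) (convex_coe_ballInter ⟨p, hp⟩) hz
        (by rw [RelCycle, hc]; exact Submodule.zero_mem _) (h _)
  obtain ⟨t, ht⟩ := isCompact_univ.elim_finite_subcover
    (fun z : ℍ => proj Γ '' Metric.ball z (r₀ / 8)) (fun z => isOpenMap_proj _ Metric.isOpen_ball)
    (fun x _ => by
      obtain ⟨z, rfl⟩ := proj_surjective x
      exact Set.mem_iUnion.2 ⟨z, z, Metric.mem_ball_self (by positivity), rfl⟩)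
  have hl : ∀ A ∈ t.toList.map (fun p => proj Γ '' ballInter (r₀ / 8) {p}), A ∈ 𝒢 := by
    intro A hA
    obtain ⟨p, -, rfl⟩ := List.mem_map.1 hA
    exact ⟨{p}, Finset.singleton_nonempty p, rfl⟩
  have hU : (⋃ A ∈ t.toList.map (fun p => proj Γ '' ballInter (r₀ / 8) {p}), A) = Set.univ := by
    refine Set.eq_univ_of_univ_subset (ht.trans (Set.iUnion₂_subset fun p hp => ?_))
    refine subset_trans ?_ (Set.subset_biUnion_of_mem
      (List.mem_map.2 ⟨p, Finset.mem_toList.2 hp, rfl⟩))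
    refine Set.image_mono ?_
    simpa [ballInter] using Metric.ball_subset_closedBall
  obtain ⟨e, he⟩ := relNull_iUnion_of_forall hcl hint hvan _ hl c fun A hA => hnull A (hl A hA)
  rw [hU, Set.compl_univ] at he
  exact ⟨e, (sub_eq_zero.1 (chainsIn_empty he)).symm⟩

end Surface

/-! ### Local orientations -/

section Orientation

/-- The boundary of the standard triangle. -/
def triangleBoundary : Set (stdSimplex ℝ (Fin 3)) := {x | ∃ i, x i = 0}

lemma dS_single_triangle_mem {Y : Type} [TopologicalSpace Y] (f : C(stdSimplex ℝ (Fin 3), Y))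
    {A : Set Y} (hA : ∀ x ∈ triangleBoundary, f x ∈ A) :
    dS 1 (Finsupp.single f 1 : SChain Y 2) ∈ chainsIn A 1 := by
  rw [dS_single]
  refine Submodule.sum_mem _ fun i _ => Submodule.smul_mem _ _ (single_mem_chainsIn ?_ _)
  rintro x
  refine hA _ ⟨i, ?_⟩
  change stdSimplex.map i.succAbove x i = 0
  rw [stdSimplex.map_coe, FunOnFinite.linearMap_apply_apply]
  refine Finset.sum_eq_zero fun j hj => absurd (Finset.mem_filter.1 hj).2 (Fin.succAbove_ne i j)

/-- A homotopy of triangles that moves the boundary in the complement of `B` does not change the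
class relative to the complement of `B`. -/
lemma relNull_triangle_of_homotopy {Y : Type} [TopologicalSpace Y] {B : Set Y}
    (H : C(stdSimplex ℝ (Fin 3) × unitInterval, Y))
    (hH : ∀ x ∈ triangleBoundary, ∀ s, H (x, s) ∉ B) {f g : C(stdSimplex ℝ (Fin 3), Y)}
    (hf : ∀ x, H (x, 1) = f x) (hg : ∀ x, H (x, 0) = g x) :
    RelNull B (Finsupp.single f 1 - Finsupp.single g 1 : SChain Y 2) := by
  have h := relNull_of_homotopy (A := triangleBoundary) (B := B) H hH
    (n := 1) (dS_single_triangle_mem (ContinuousMap.id _) fun x hx => hx)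
  rw [pushS_single, pushS_single, ContinuousMap.comp_id, ContinuousMap.comp_id] at h
  have e1 : slice H 1 = f := ContinuousMap.ext hf
  have e0 : slice H 0 = g := ContinuousMap.ext hg
  rwa [e1, e0] at h

/-- The map of the standard triangle onto the triangle with vertices `1`, `i`, `-1 - i`. -/
def trianglePoint : C(stdSimplex ℝ (Fin 3), ℂ) where
  toFun x := (x 0 - x 2 : ℝ) + (x 1 - x 2 : ℝ) * Complex.I
  continuous_toFun := by
    have h (i : Fin 3) : Continuous fun x : stdSimplex ℝ (Fin 3) => x i :=
      (continuous_apply i).comp continuous_subtype_val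
    exact (Complex.continuous_ofReal.comp ((h 0).sub (h 2))).add
      ((Complex.continuous_ofReal.comp ((h 1).sub (h 2))).mul continuous_const)

lemma trianglePoint_coords (x : stdSimplex ℝ (Fin 3)) :
    0 ≤ x 0 ∧ 0 ≤ x 1 ∧ 0 ≤ x 2 ∧ x 0 + x 1 + x 2 = 1 := by
  have h := x.2.2
  rw [Fin.sum_univ_three] at h
  exact ⟨x.2.1 0, x.2.1 1, x.2.1 2, h⟩

lemma trianglePoint_re (x : stdSimplex ℝ (Fin 3)) : (trianglePoint x).re = x 0 - x 2 := by
  simp [trianglePoint]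

lemma trianglePoint_im (x : stdSimplex ℝ (Fin 3)) : (trianglePoint x).im = x 1 - x 2 := by
  simp [trianglePoint]

/-- The distance of the origin from the boundary of the triangle is `1 / √5`, which exceeds `2 / 5`. -/
lemma le_norm_trianglePoint {x : stdSimplex ℝ (Fin 3)} (hx : x ∈ triangleBoundary) :
    2 / 5 ≤ ‖trianglePoint x‖ := by
  obtain ⟨h0, h1, h2, h⟩ := trianglePoint_coords x
  refine le_of_sq_le_sq ?_ (norm_nonneg _)
  rw [Complex.sq_norm, Complex.normSq_apply, trianglePoint_re, trianglePoint_im]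
  obtain ⟨i, hi⟩ := hx
  fin_cases i
  · replace hi : x 0 = 0 := hi
    have : x 2 = 1 - x 1 := by linarith
    rw [hi, this]
    nlinarith [sq_nonneg (x 1 - 3 / 5)]
  · replace hi : x 1 = 0 := hi
    have : x 2 = 1 - x 0 := by linarith
    rw [hi, this]
    nlinarith [sq_nonneg (x 0 - 3 / 5)]
  · replace hi : x 2 = 0 := hi
    have : x 1 = 1 - x 0 := by linarith
    rw [hi, this]
    nlinarith [sq_nonneg (x 0 - 1 / 2)]

lemma norm_trianglePoint_le (x : stdSimplex ℝ (Fin 3)) : ‖trianglePoint x‖ ≤ 2 := by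
  obtain ⟨h0, h1, h2, h⟩ := trianglePoint_coords x
  refine (Complex.norm_le_abs_re_add_abs_im _).trans ?_
  rw [trianglePoint_re, trianglePoint_im]
  have := abs_le.2 (⟨by linarith, by linarith⟩ : -1 ≤ x 0 - x 2 ∧ x 0 - x 2 ≤ 1)
  have := abs_le.2 (⟨by linarith, by linarith⟩ : -1 ≤ x 1 - x 2 ∧ x 1 - x 2 ≤ 1)
  linarith

/-- The triangle with vertices `z + w`, `z + iw`, `z - (1 + i)w` in the plane. -/
def planeTriangle (z w : ℂ) : C(stdSimplex ℝ (Fin 3), ℂ) :=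
  ⟨fun x => z + w * trianglePoint x, by fun_prop⟩

lemma trianglePoint_ne_zero {x : stdSimplex ℝ (Fin 3)} (hx : x ∈ triangleBoundary) :
    trianglePoint x ≠ 0 := fun h => by
  have := le_norm_trianglePoint hx
  rw [h, norm_zero] at this
  linarith

/-- The orientation of a triangle around its center does not depend on its size and direction. -/
lemma relNull_planeTriangle_rotate {z w w' : ℂ} (hw : w ≠ 0) (hw' : w' ≠ 0) :
    RelNull {z} (Finsupp.single (planeTriangle z w) 1 - Finsupp.single (planeTriangle z w') 1 :
      SChain ℂ 2) := by
  -- the logarithms are joined by a segment, so that the factor never vanishes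
  refine relNull_triangle_of_homotopy
    ⟨fun q => z + Complex.exp ((q.2 : ℝ) * Complex.log w + (1 - (q.2 : ℝ)) * Complex.log w') *
      trianglePoint q.1, by fun_prop⟩ ?_ ?_ ?_
  · intro x hx s h
    have h' := add_eq_left.1 h
    exact mul_ne_zero (Complex.exp_ne_zero _) (trianglePoint_ne_zero hx) h'
  · intro x
    simp [planeTriangle, Complex.exp_log hw]
  · intro x
    simp [planeTriangle, Complex.exp_log hw']

/-- A triangle gives the positive orientation at each point near its center. -/
lemma relNull_planeTriangle_move {z z₀ : ℂ} {R r : ℝ} (hR : ‖z₀ - z‖ < 2 / 5 * R) (hr : 0 < r) :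
    RelNull {z} (Finsupp.single (planeTriangle z₀ R) 1 - Finsupp.single (planeTriangle z r) 1 :
      SChain ℂ 2) := by
  refine relNull_triangle_of_homotopy
    ⟨fun q => z + ((q.2 : ℝ) * (z₀ - z) + ((q.2 : ℝ) * R + (1 - (q.2 : ℝ)) * r : ℝ) *
      trianglePoint q.1), by fun_prop⟩ ?_ ?_ ?_
  · intro x hx s h
    have h' := add_eq_left.1 h
    have h1 := le_norm_trianglePoint hx
    have hs0 := s.2.1
    have hs1 := s.2.2
    have hpos : 0 ≤ (s : ℝ) * R + (1 - (s : ℝ)) * r := by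
      have := norm_nonneg (z₀ - z)
      have h2 : 0 < R := by linarith
      have h3 : 0 ≤ 1 - (s : ℝ) := by linarith
      positivity
    have h2 := congrArg norm (eq_neg_of_add_eq_zero_left h')
    rw [norm_neg, norm_mul, norm_mul, Complex.norm_real, Complex.norm_real,
      Real.norm_of_nonneg hs0, Real.norm_of_nonneg hpos] at h2
    have h3 := mul_le_mul_of_nonneg_left h1 hpos
    rcases hs0.eq_or_lt with h0 | h0
    · rw [← h0] at h2 h3
      linarith
    · have := mul_lt_mul_of_pos_left hR h0
      have : 0 ≤ (1 - (s : ℝ)) * r := mul_nonneg (by linarith) hr.le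
      nlinarith
  · intro x
    simp [planeTriangle, ← add_assoc]
  · intro x
    simp [planeTriangle]

/-- The inclusion of the upper half-plane in the plane. -/
def coeH : C(ℍ, ℂ) := ⟨(↑), UpperHalfPlane.continuous_coe⟩

lemma coe_orientedTriangle (z : ℍ) (r : ℝ) (h0 : 0 < r) (h1 : r < z.im)
    (x : stdSimplex ℝ (Fin 3)) :
    (orientedTriangle z r h0 h1 x : ℂ) = z + r * trianglePoint x := rfl

/-- The oriented triangle with center `z` and size `r`, as a chain. -/
abbrev triangleChain (z : ℍ) (r : ℝ) (h0 : 0 < r) (h1 : r < z.im) : SChain ℍ 2 :=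
  Finsupp.single (orientedTriangle z r h0 h1) 1

lemma relCycle_triangleChain {z₀ : ℍ} {R : ℝ} (h0 : 0 < R) (h1 : R < z₀.im) {A : Set ℍ}
    (hA : ∀ z ∈ A, ‖(z₀ : ℂ) - z‖ < 2 / 5 * R) : RelCycle A (triangleChain z₀ R h0 h1) := by
  refine dS_single_triangle_mem _ fun x hx h => ?_
  have h2 := hA _ h
  rw [coe_orientedTriangle, sub_add_cancel_left, norm_neg, norm_mul, Complex.norm_real,
    Real.norm_of_nonneg h0.le] at h2
  nlinarith [le_norm_trianglePoint hx]

/-- The local homology of the upper half-plane embeds in that of the plane. -/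
lemma relNull_of_coeH {z : ℍ} {n : ℕ} {c : SChain ℍ (n + 1)} (hc : RelCycle {z} c)
    (h : RelNull {(z : ℂ)} (pushS coeH (n + 1) c)) : RelNull {z} c := by
  refine RelNull.of_push UpperHalfPlane.isOpenEmbedding_coe (f := coeH) ?_ hc ?_
  · rw [Set.image_singleton]; exact isClosed_singleton
  · rwa [Set.image_singleton]

lemma relNull_triangleChain_move {z z₀ : ℍ} {R r : ℝ} (h0 : 0 < R) (h1 : R < z₀.im)
    (hz : ‖(z₀ : ℂ) - z‖ < 2 / 5 * R) (h2 : 0 < r) (h3 : r < z.im) :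
    RelNull {z} (triangleChain z₀ R h0 h1 - triangleChain z r h2 h3) := by
  refine relNull_of_coeH ((relCycle_triangleChain h0 h1 ?_).sub (relCycle_triangleChain h2 h3 ?_)) ?_
  · rintro _ rfl; exact hz
  · rintro _ rfl; rw [sub_self, norm_zero]; positivity
  · rw [map_sub, pushS_single, pushS_single]
    exact relNull_planeTriangle_move hz h2

lemma orientedTriangle_mem_ball (z : ℍ) {ε : ℝ} (hε : 0 < ε) : ∃ δ > 0, ∀ (r : ℝ) (h0 : 0 < r)
    (h1 : r < z.im), r < δ → ∀ x, orientedTriangle z r h0 h1 x ∈ Metric.ball z ε := by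
  have h : IsOpen (((↑) : ℍ → ℂ) '' Metric.ball z ε) :=
    UpperHalfPlane.isOpenEmbedding_coe.isOpenMap _ Metric.isOpen_ball
  obtain ⟨δ, hδ, hδε⟩ := Metric.isOpen_iff.1 h z ⟨z, Metric.mem_ball_self hε, rfl⟩
  refine ⟨δ / 2, by positivity, fun r h0 h1 hr x => ?_⟩
  obtain ⟨w, hw, hwx⟩ := hδε (show (orientedTriangle z r h0 h1 x : ℂ) ∈ Metric.ball (z : ℂ) δ by
    rw [Metric.mem_ball, dist_eq_norm, coe_orientedTriangle, add_sub_cancel_left, norm_mul,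
      Complex.norm_real, Real.norm_of_nonneg h0.le]
    nlinarith [norm_trianglePoint_le x])
  rwa [← UpperHalfPlane.coe_injective hwx]

lemma exists_triangleChain_mem {z : ℍ} {V : Set ℍ} (hV : IsOpen V) (hz : z ∈ V) :
    ∃ δ > 0, ∀ (r : ℝ) (h0 : 0 < r) (h1 : r < z.im), r < δ →
      triangleChain z r h0 h1 ∈ chainsIn V 2 := by
  obtain ⟨ε, hε, hεV⟩ := Metric.isOpen_iff.1 hV z hz
  obtain ⟨δ, hδ, h⟩ := orientedTriangle_mem_ball z hε
  exact ⟨δ, hδ, fun r h0 h1 hr => single_mem_chainsIn (fun x => hεV (h r h0 h1 hr x)) _⟩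

/-- The increment of a fractional linear transformation. -/
lemma mobius_add {a b c d z h : ℂ} (hdet : a * d - b * c = 1) (hz : c * z + d ≠ 0)
    (hh : c * (z + h) + d ≠ 0) :
    (a * z + b) / (c * z + d) + h / ((c * z + d) * (c * (z + h) + d)) =
      (a * (z + h) + b) / (c * (z + h) + d) := by
  rw [div_add_div _ _ hz (mul_ne_zero hz hh), div_eq_div_iff (by simp [hz, hh]) hh]
  linear_combination (-h * (c * z + d) * (c * (z + h) + d)) * hdet

/-- A fractional linear transformation preserves the local orientation. Its increment from `z` to
`z + h` is `h / ((cz + d)(c(z + h) + d))`; when `h` is shrunk to `0` in the denominator only, the map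
deforms to its linearization, without zeros of the increment for `h ≠ 0`. The linearization
multiplies by the complex number `1 / (cz + d)²`. -/
lemma relNull_triangleChain_smul (A : SL(2, ℝ)) {f : C(ℍ, ℍ)} (hf : ∀ z, f z = A • z) (z : ℍ)
    {r r' : ℝ} (h0 : 0 < r) (h1 : r < z.im) (h2 : 0 < r') (h3 : r' < (f z).im) :
    RelNull {f z} (pushS f 2 (triangleChain z r h0 h1) - triangleChain (f z) r' h2 h3) := by
  set c : ℂ := ((A 1 0 : ℝ) : ℂ) with hc
  set d : ℂ := ((A 1 1 : ℝ) : ℂ) with hd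
  have hden (w : ℍ) : c * w + d ≠ 0 := UpperHalfPlane.denom_ne_zero A w
  have hdet : ((A 0 0 : ℝ) : ℂ) * d - ((A 0 1 : ℝ) : ℂ) * c = 1 := by
    have := A.det_coe
    rw [Matrix.det_fin_two] at this
    rw [hc, hd]
    exact_mod_cast this
  have hfc (w : ℍ) : ((f w : ℍ) : ℂ) = (((A 0 0 : ℝ) : ℂ) * w + ((A 0 1 : ℝ) : ℂ)) / (c * w + d) := by
    rw [hf, coe_specialLinearGroup_apply]
    simp [hc, hd]
  have hmem (x : stdSimplex ℝ (Fin 3)) (s : unitInterval) :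
      0 < ((z : ℂ) + (s : ℝ) * (r * trianglePoint x)).im := by
    have e : ((z : ℂ) + (s : ℝ) * (r * trianglePoint x)).im = z.im + s * (r * (x 1 - x 2)) := by
      simp [trianglePoint_im]
    obtain ⟨h0', h1', h2', h'⟩ := trianglePoint_coords x
    have a : -1 ≤ x 1 - x 2 := by linarith
    have b := s.2.1
    have b' := s.2.2
    have e1 : -r ≤ r * (x 1 - x 2) := by nlinarith
    have e2 : -r ≤ s * (r * (x 1 - x 2)) := by nlinarith
    rw [e]
    linarith
  have hden' (x : stdSimplex ℝ (Fin 3)) (s : unitInterval) :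
      c * ((z : ℂ) + (s : ℝ) * (r * trianglePoint x)) + d ≠ 0 := hden ⟨_, hmem x s⟩
  refine relNull_of_coeH (RelCycle.sub ?_ (relCycle_triangleChain h2 h3 ?_)) ?_
  · have h := RelCycle.push (f := f) (A := {z}) (B := {f z}) ?_
      (relCycle_triangleChain h0 h1 (A := {z}) ?_)
    · exact h
    · intro w hw h
      have h' : A • w = A • z := by rw [← hf, ← hf]; exact h
      exact hw (smul_left_cancel A h')
    · rintro _ rfl; rw [sub_self, norm_zero]; positivity
  · rintro _ rfl; rw [sub_self, norm_zero]; positivity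
  · rw [map_sub, pushS_single, pushS_single, pushS_single]
    refine RelNull.trans (c' := Finsupp.single (planeTriangle (f z) (r / (c * z + d) ^ 2)) 1) ?_
      (relNull_planeTriangle_rotate ?_ ?_)
    · refine relNull_triangle_of_homotopy
        ⟨fun q => ((f z : ℍ) : ℂ) + r * trianglePoint q.1 / ((c * z + d) *
          (c * ((z : ℂ) + (q.2 : ℝ) * (r * trianglePoint q.1)) + d)), ?_⟩ ?_ ?_ ?_
      · refine continuous_const.add (Continuous.div (by fun_prop) (by fun_prop) fun q => ?_)
        exact mul_ne_zero (hden z) (hden' _ _)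
      · intro x hx s h
        have h' := add_eq_left.1 h
        exact div_ne_zero (mul_ne_zero (Complex.ofReal_ne_zero.2 h0.ne') (trianglePoint_ne_zero hx))
          (mul_ne_zero (hden z) (hden' _ _)) h'
      · intro x
        have e := hfc (orientedTriangle z r h0 h1 x)
        have hz1 := hden z
        have hz2 := hden (orientedTriangle z r h0 h1 x)
        rw [coe_orientedTriangle] at e hz2
        change _ = ((f (orientedTriangle z r h0 h1 x) : ℍ) : ℂ)
        rw [e, hfc z]
        simp only [ContinuousMap.coe_mk, Set.Icc.coe_one, Complex.ofReal_one, one_mul]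
        exact mobius_add hdet hz1 hz2
      · intro x
        simp [planeTriangle]
        ring
    · exact div_ne_zero (Complex.ofReal_ne_zero.2 h0.ne') (pow_ne_zero _ (hden z))
    · exact Complex.ofReal_ne_zero.2 h2.ne'

/-- The local orientation in terms of finitely supported chains. -/
lemma hasLocalOrientation_iff {Y : TopCat.{0}} (π : TopCat.of ℍ ⟶ Y) (c : (Sing ℤ Y).X 2) (z : ℍ) :
    HasLocalOrientation π c z ↔ ∃ ε > 0, ∀ r (h0 : 0 < r) (h1 : r < z.im), r < ε →
      RelNull {π z} (singEquiv Y 2 c - pushS π.hom 2 (triangleChain z r h0 h1)) := by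
  unfold HasLocalOrientation RelNull
  have key (r : ℝ) (h0 : 0 < r) (h1 : r < z.im) (e : (Sing ℤ Y).X 3) :
      ChainIn ℤ {π z}ᶜ (c - ((singMap ℤ π).f 2).hom (simplexChain ℤ (orientedTriangle z r h0 h1)) -
        ((Sing ℤ Y).d 3 2).hom e) ↔
      singEquiv Y 2 c - pushS π.hom 2 (triangleChain z r h0 h1) - dS 2 (singEquiv Y 3 e) ∈
        chainsIn {π z}ᶜ 2 := by
    rw [chainIn_iff, map_sub, map_sub, singEquiv_map, singEquiv_d, singEquiv_simplexChain]
  refine exists_congr fun ε => and_congr_right fun _ => ?_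
  refine forall₄_congr fun r h0 h1 _ => ⟨?_, ?_⟩
  · rintro ⟨e, he⟩
    exact ⟨_, (key r h0 h1 e).1 he⟩
  · rintro ⟨e, he⟩
    refine ⟨(singEquiv Y 3).symm e, (key r h0 h1 _).2 ?_⟩
    rwa [AddEquiv.apply_symm_apply]

end Orientation

/-! ### The fundamental class of the surface -/

section FundamentalClass

variable {Γ : Subgroup PSL(2, ℝ)}

/-- Projection to the surface of chains relative to a point, for chains that avoid the other
translates of the point. -/
lemma RelNull.push_proj {V : Set ℍ} (hV : IsOpen V) {z : ℍ} (hz : z ∈ V)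
    (hVz : ∀ w ∈ V, proj Γ w = proj Γ z → w = z) {n : ℕ} {c : SChain ℍ (n + 1)}
    (hcV : c ∈ chainsIn V (n + 1)) (h : RelNull {z} c) :
    RelNull {proj Γ z} (pushS (proj Γ) (n + 1) c) := by
  set i : C(V, ℍ) := ⟨Subtype.val, continuous_subtype_val⟩
  obtain ⟨c', -, rfl⟩ := exists_pushS_eq (f := i) Topology.IsEmbedding.subtypeVal hcV
    (fun w hw => ⟨⟨w, hw⟩, rfl⟩)
  have himg : i '' {⟨z, hz⟩} = {z} := Set.image_singleton
  have hc' : RelCycle {(⟨z, hz⟩ : V)} c' := by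
    have h1 : dS n (pushS i (n + 1) c') ∈ chainsIn {z}ᶜ n := h.relCycle
    rw [dS_pushS] at h1
    have h2 := mem_chainsIn_of_pushS (f := i) Subtype.val_injective h1
    refine chainsIn_mono ?_ _ h2
    intro w hw hwz
    exact hw (congrArg Subtype.val hwz)
  have h2 : RelNull {(⟨z, hz⟩ : V)} c' := by
    refine RelNull.of_push (f := i) hV.isOpenEmbedding_subtypeVal ?_ hc' ?_
    · rw [himg]; exact isClosed_singleton
    · rwa [himg]
  have h3 := h2.push (f := projOn Γ V) (B := {proj Γ z}) (by
    intro w hw hwz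
    exact hw (Subtype.ext (hVz w w.2 hwz)))
  rwa [projOn, pushS_comp] at h3

/-- The complement of the translates of `z` other than `z` itself. -/
def otherTranslatesCompl (Γ : Subgroup PSL(2, ℝ)) (z : ℍ) : Set ℍ :=
  {w | proj Γ w = proj Γ z → w = z}

lemma isOpen_otherTranslatesCompl [CompactSpace (MulAction.orbitRel.Quotient Γ ℍ)]
    [ProperlyDiscontinuousSMul Γ ℍ] [IsCancelSMul Γ ℍ] (z : ℍ) :
    IsOpen (otherTranslatesCompl Γ z) := by
  have := t2Space_quotient (Γ := Γ)
  obtain ⟨r, hr, h⟩ := exists_le_dist_smul (Γ := Γ)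
  have e : otherTranslatesCompl Γ z = (proj Γ ⁻¹' {proj Γ z} ∩ (Metric.ball z r)ᶜ)ᶜ := by
    ext w
    simp only [otherTranslatesCompl, Set.mem_ofPred_eq, Set.mem_compl_iff, Set.mem_inter_iff,
      Set.mem_preimage, Set.mem_singleton_iff, not_and, not_not]
    refine forall_congr' fun hw => ⟨?_, fun hwr => ?_⟩
    · rintro rfl; exact Metric.mem_ball_self hr
    · obtain ⟨γ, rfl⟩ := proj_eq_iff.1 hw
      by_contra hne
      have := h z γ (fun h1 => hne (by rw [h1, one_smul]))
      rw [Metric.mem_ball, dist_comm] at hwr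
      linarith
  rw [e]
  exact ((isClosed_singleton.preimage (proj Γ).continuous).inter
    Metric.isOpen_ball.isClosed_compl).isOpen_compl

/-- An interior point of a fundamental domain has no other translate in the domain, not even on its
frontier. -/
lemma IsFundamentalDomain.subset_otherTranslatesCompl {D : Set ℍ} (hD : IsFundamentalDomain Γ D)
    {z : ℍ} (hz : z ∈ interior D) : D ⊆ otherTranslatesCompl Γ z := by
  intro w hw hwz
  obtain ⟨γ, rfl⟩ := proj_eq_iff.1 hwz
  by_cases hγ : γ = 1
  · rw [hγ, one_smul]
  have hopen : IsOpen ((γ⁻¹ • ·) ⁻¹' interior D) :=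
    isOpen_interior.preimage (continuous_const_smul γ⁻¹)
  rw [← hD.closure_interior, mem_closure_iff] at hw
  obtain ⟨y, hy1, hy2⟩ := hw _ hopen (by simpa using hz)
  have := hD.disjoint γ hγ _ hy1
  rw [smul_inv_smul] at this
  exact absurd hy2 this

/-- The translates of the interior of a fundamental domain are dense. -/
lemma IsFundamentalDomain.exists_smul_mem_interior {D : Set ℍ} (hD : IsFundamentalDomain Γ D)
    {U : Set ℍ} (hU : IsOpen U) {z : ℍ} (hz : z ∈ U) : ∃ w ∈ U, ∃ γ : Γ, γ • w ∈ interior D := by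
  obtain ⟨γ, hγ⟩ := hD.covers z
  rw [← hD.closure_interior, mem_closure_iff] at hγ
  obtain ⟨y, hy1, hy2⟩ := hγ ((γ⁻¹ • ·) ⁻¹' U) (hU.preimage (continuous_const_smul γ⁻¹))
    (by simpa using hz)
  exact ⟨γ⁻¹ • y, hy1, γ, by rwa [smul_inv_smul]⟩

variable [CompactSpace (MulAction.orbitRel.Quotient Γ ℍ)]
    [ProperlyDiscontinuousSMul Γ ℍ] [IsCancelSMul Γ ℍ]

/-- The projection of a fundamental chain gives the local orientation at the points that have a
translate in the interior of the fundamental domain. -/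
lemma IsFundamentalChain.relNull_proj {D : Set ℍ} (hD : IsFundamentalDomain Γ D)
    {F : (Sing ℤ (TopCat.of ℍ)).X 2} (hF : IsFundamentalChain D F) {z : ℍ} {γ : Γ}
    (hz : γ • z ∈ interior D) : ∃ ε > 0, ∀ r (h0 : 0 < r) (h1 : r < z.im), r < ε →
      RelNull {proj Γ z} (pushS (proj Γ) 2 (singEquiv _ 2 F) -
        pushS (proj Γ) 2 (triangleChain z r h0 h1)) := by
  have hAo := isOpen_otherTranslatesCompl (Γ := Γ) (γ • z)
  have hzA : γ • z ∈ otherTranslatesCompl Γ (γ • z) := fun _ => rfl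
  obtain ⟨ε₁, hε₁, h₁⟩ := (hasLocalOrientation_iff _ _ _).1 (hF.orientation _ hz)
  obtain ⟨δ₁, hδ₁, hδA⟩ := exists_triangleChain_mem hAo hzA
  have him := (γ • z).im_pos
  obtain ⟨r', hr0, hr'⟩ : ∃ r', 0 < r' ∧ r' < min (γ • z).im (min ε₁ δ₁) :=
    exists_between (lt_min him (lt_min hε₁ hδ₁))
  rw [lt_min_iff, lt_min_iff] at hr'
  obtain ⟨hr1, hr2, hr3⟩ := hr'
  have hFA : singEquiv (TopCat.of ℍ) 2 F ∈ chainsIn (otherTranslatesCompl Γ (γ • z)) 2 :=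
    chainsIn_mono (hD.subset_otherTranslatesCompl hz) _ ((chainIn_iff _).1 hF.chainIn)
  have hT := hδA r' hr0 hr1 hr3
  have N1 := h₁ r' hr0 hr1 hr2
  have N1' := RelNull.push_proj hAo hzA (fun w hw => hw) (Submodule.sub_mem _ hFA hT)
    (c := singEquiv (TopCat.of ℍ) 2 F - triangleChain (γ • z) r' hr0 hr1) (by
      have e : pushS (TopCat.Hom.hom (𝟙 (TopCat.of ℍ))) 2 (triangleChain (γ • z) r' hr0 hr1) =
        triangleChain (γ • z) r' hr0 hr1 := pushS_id _ _
      rw [e] at N1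
      exact N1)
  -- the translation by `γ` carries the local orientation at `z` to the one at `γ • z`
  let f : C(ℍ, ℍ) := ⟨fun w => γ • w, continuous_const_smul γ⟩
  obtain ⟨A, hA⟩ : ∃ A : SL(2, ℝ), ∀ w, f w = A • w := by
    obtain ⟨γ, hγ⟩ := γ
    induction γ using QuotientGroup.induction_on with
    | H A => exact ⟨A, fun w => rfl⟩
  obtain ⟨δ₂, hδ₂, hδf⟩ := exists_triangleChain_mem (hAo.preimage f.continuous) (z := z) hzA
  refine ⟨δ₂, hδ₂, fun r h0 h1 hr => ?_⟩
  have N2 := RelNull.push_proj hAo hzA (fun w hw => hw)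
    (Submodule.sub_mem _ (pushS_mem_chainsIn (fun w hw => hw) (hδf r h0 h1 hr)) hT)
    (relNull_triangleChain_smul A hA z h0 h1 hr0 hr1)
  have ef : (proj Γ).comp f = proj Γ := ContinuousMap.ext fun w => proj_smul γ w
  rw [map_sub, proj_smul] at N1' N2
  rw [← pushS_comp, ef] at N2
  exact N1'.trans N2.symm

/-- If the projection of a fundamental chain is a cycle, it gives the local orientation at all
points: the class at a point is determined by the class at a nearby point. -/
lemma IsFundamentalChain.hasLocalOrientation {D : Set ℍ} (hD : IsFundamentalDomain Γ D)
    {F : (Sing ℤ (TopCat.of ℍ)).X 2} (hF : IsFundamentalChain D F)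
    (hc : dS 1 (pushS (proj Γ) 2 (singEquiv _ 2 F)) = 0) (z₀ : ℍ) :
    ∃ ε > 0, ∀ r (h0 : 0 < r) (h1 : r < z₀.im), r < ε →
      RelNull {proj Γ z₀} (pushS (proj Γ) 2 (singEquiv _ 2 F) -
        pushS (proj Γ) 2 (triangleChain z₀ r h0 h1)) := by
  obtain ⟨r₀, hr₀, h₀⟩ := exists_le_dist_smul (Γ := Γ)
  set U := Metric.ball z₀ (r₀ / 2) with hU
  have hUo : IsOpen U := Metric.isOpen_ball
  have hinj := injOn_proj_ball h₀ z₀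
  have hz₀U : z₀ ∈ U := Metric.mem_ball_self (by positivity)
  obtain ⟨ε, hε, hεU⟩ := exists_triangleChain_mem hUo hz₀U
  refine ⟨ε, hε, fun R h0 h1 hR => ?_⟩
  have hTU := hεU R h0 h1 hR
  -- a closed ball around `z₀` inside both `U` and the triangle
  have hW : IsOpen {z : ℍ | ‖(z₀ : ℂ) - z‖ < 2 / 5 * R} :=
    isOpen_lt (continuous_const.sub UpperHalfPlane.continuous_coe).norm continuous_const
  have hz₀W : ‖(z₀ : ℂ) - z₀‖ < 2 / 5 * R := by rw [sub_self, norm_zero]; positivity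
  obtain ⟨δ, hδ, hδUW⟩ := Metric.nhds_basis_closedBall.mem_iff.1
    ((hUo.inter hW).mem_nhds ⟨hz₀U, hz₀W⟩)
  -- a point `z` of the ball where the orientation is known already
  obtain ⟨z, hz, γ, hγ⟩ := hD.exists_smul_mem_interior Metric.isOpen_ball
    (Metric.mem_ball_self hδ : z₀ ∈ Metric.ball z₀ δ)
  have hzK := Metric.ball_subset_closedBall hz
  have hzU := (hδUW hzK).1
  obtain ⟨ε₁, hε₁, hF₁⟩ := hF.relNull_proj hD hγ
  obtain ⟨ε₂, hε₂, hT₂⟩ := exists_triangleChain_mem hUo hzU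
  obtain ⟨r, hr0, hr⟩ : ∃ r, 0 < r ∧ r < min z.im (min ε₁ ε₂) :=
    exists_between (lt_min z.im_pos (lt_min hε₁ hε₂))
  rw [lt_min_iff, lt_min_iff] at hr
  obtain ⟨hr1, hr2, hr3⟩ := hr
  have N1 := hF₁ r hr0 hr1 hr2
  have N2 := RelNull.push_proj hUo hzU (fun w hw h => hinj hw hzU h)
    (Submodule.sub_mem _ hTU (hT₂ r hr0 hr1 hr3))
    (relNull_triangleChain_move h0 h1 (hδUW hzK).2 hr0 hr1)
  rw [map_sub] at N2
  -- relative to the complement of the whole ball, the difference is a cycle that bounds at `z`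
  have hcyc : RelCycle (proj Γ '' Metric.closedBall z₀ δ)
      (pushS (proj Γ) 2 (singEquiv (TopCat.of ℍ) 2 F) -
        pushS (proj Γ) 2 (triangleChain z₀ R h0 h1)) := by
    refine RelCycle.sub ?_ ?_
    · rw [RelCycle, hc]; exact Submodule.zero_mem _
    · have hb := chainsIn_inter (dS_mem_chainsIn hTU)
        (relCycle_triangleChain h0 h1 (A := Metric.closedBall z₀ δ) fun w hw => (hδUW hw).2)
      rw [RelCycle, dS_pushS]
      refine pushS_mem_chainsIn ?_ hb
      rintro w ⟨hwU, hwK⟩ ⟨w', hw', hww⟩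
      rw [← hinj (hδUW hw').1 hwU hww] at hwK
      exact hwK hw'
  have hsub : {proj Γ z₀} ⊆ proj Γ '' Metric.closedBall z₀ δ :=
    Set.singleton_subset_iff.2 ⟨z₀, Metric.mem_closedBall_self hδ.le, rfl⟩
  exact (RelNull.of_point_of_surface hUo hinj (fun w hw => (hδUW hw).1)
    (isCompact_closedBall z₀ δ) (convex_coe_closedBall z₀ δ) hzK hcyc (N1.trans N2.symm)).mono
      hsub

/-- Two `2`-cycles of the surface with the same local orientations are homologous. -/
lemma exists_dS_eq_of_hasLocalOrientation {c c' : SChain (MulAction.orbitRel.Quotient Γ ℍ) 2}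
    (hc : dS 1 c = 0) (hc' : dS 1 c' = 0)
    (h : ∀ z : ℍ, ∃ ε > 0, ∀ r (h0 : 0 < r) (h1 : r < z.im), r < ε →
      RelNull {proj Γ z} (c - pushS (proj Γ) 2 (triangleChain z r h0 h1)))
    (h' : ∀ z : ℍ, ∃ ε > 0, ∀ r (h0 : 0 < r) (h1 : r < z.im), r < ε →
      RelNull {proj Γ z} (c' - pushS (proj Γ) 2 (triangleChain z r h0 h1))) :
    ∃ e, dS 2 e = c - c' := by
  refine exists_dS_eq_of_local (by rw [map_sub, hc, hc', sub_zero]) fun x => ?_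
  obtain ⟨z, rfl⟩ := proj_surjective x
  obtain ⟨ε, hε, h⟩ := h z
  obtain ⟨ε', hε', h'⟩ := h' z
  obtain ⟨r, hr0, hr⟩ : ∃ r, 0 < r ∧ r < min z.im (min ε ε') :=
    exists_between (lt_min z.im_pos (lt_min hε hε'))
  rw [lt_min_iff, lt_min_iff] at hr
  exact (h r hr0 hr.1 hr.2.1).trans (h' r hr0 hr.1 hr.2.2).symm

end FundamentalClass

/-! ### The contraction of the normalized bar resolution -/

section BarCone

variable {k : Type} [CommRing k] {G : Type} [Group G]

lemma bar_hom_ext {n : ℕ} {M : Type*} [AddCommGroup M] [Module k M]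
    {f g : (BarModule k G n).V →ₗ[k] M}
    (h : ∀ (γ : G) (s : Fin n → G), f ((BarModule k G n).ρ γ (barSymbol k G s)) =
      g ((BarModule k G n).ρ γ (barSymbol k G s))) : f = g := by
  refine Finsupp.lhom_ext' fun s => MonoidAlgebra.lhom_ext' fun γ => LinearMap.ext_ring ?_
  have := h γ s.1
  rw [barSymbol, dif_pos s.2] at this
  simpa using this

/-- The contracting homotopy `γ[γ₁|…|γₙ] ↦ [γ|γ₁|…|γₙ]`. -/
def barCone (n : ℕ) : (BarModule k G n).V →ₗ[k] (BarModule k G (n + 1)).V :=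
  Finsupp.linearCombination k (fun x : {g : Fin n → G // ∀ i, g i ≠ 1} × G =>
    barSymbol k G (Fin.cons x.2 x.1.1 : Fin (n + 1) → G)) ∘ₗ
    (Finsupp.curryLinearEquiv k).symm.toLinearMap ∘ₗ
    Finsupp.mapRange.linearMap (MonoidAlgebra.coeffLinearEquiv _).toLinearMap

lemma barCone_symbol {n : ℕ} (γ : G) (s : Fin n → G) :
    barCone n ((BarModule k G n).ρ γ (barSymbol k G s)) =
      barSymbol k G (Fin.cons γ s : Fin (n + 1) → G) := by
  by_cases h : ∀ i, s i ≠ 1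
  · rw [barSymbol, dif_pos h]
    simp [barCone]
  · push Not at h
    obtain ⟨i, hi⟩ := h
    rw [barSymbol_eq_zero s i hi, map_zero, map_zero, barSymbol_eq_zero _ i.succ (by simpa using hi)]

lemma contractNth_cons_zero {n : ℕ} (γ : G) (s : Fin (n + 1) → G) :
    Fin.contractNth 0 (· * ·) (Fin.cons γ s : Fin (n + 2) → G) =
      Fin.cons (γ * s 0) (fun i => s i.succ) := by
  funext i
  refine Fin.cases ?_ (fun i => ?_) i
  · rw [Fin.contractNth_apply_of_eq _ _ _ _ rfl]
    simp
  · rw [Fin.contractNth_apply_of_gt _ _ _ _ (by simp)]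
    simp

lemma contractNth_cons_succ {n : ℕ} (γ : G) (s : Fin (n + 1) → G) (j : Fin (n + 1)) :
    Fin.contractNth j.succ (· * ·) (Fin.cons γ s : Fin (n + 2) → G) =
      Fin.cons γ (Fin.contractNth j (· * ·) s) := by
  funext i
  refine Fin.cases ?_ (fun i => ?_) i
  · rw [Fin.contractNth_apply_of_lt _ _ _ _ (by simp)]
    simp
  · rw [Fin.cons_succ]
    rcases lt_trichotomy i.val j.val with h | h | h
    · rw [Fin.contractNth_apply_of_lt _ _ _ _ (by simpa using h),
        Fin.contractNth_apply_of_lt _ _ _ _ h]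
      simp
    · rw [Fin.contractNth_apply_of_eq _ _ _ _ (by simpa using h),
        Fin.contractNth_apply_of_eq _ _ _ _ h]
      simp
    · rw [Fin.contractNth_apply_of_gt _ _ _ _ (by simpa using h),
        Fin.contractNth_apply_of_gt _ _ _ _ h]
      simp

lemma barD_rho {n : ℕ} (γ : G) (b : (BarModule k G (n + 1)).V) :
    (barD k G n).hom ((BarModule k G (n + 1)).ρ γ b) =
      (BarModule k G n).ρ γ ((barD k G n).hom b) :=
  Rep.hom_comm_apply (barD k G n) γ b

lemma barD_barCone_succ {n : ℕ} (b : (BarModule k G (n + 1)).V) :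
    (barD k G (n + 1)).hom (barCone (n + 1) b) + barCone n ((barD k G n).hom b) = b := by
  have key : (barD k G (n + 1)).hom.toLinearMap ∘ₗ barCone (n + 1) +
      barCone n ∘ₗ (barD k G n).hom.toLinearMap = LinearMap.id := by
    refine bar_hom_ext fun γ s => ?_
    change (barD k G (n + 1)).hom (barCone (n + 1) _) + barCone n ((barD k G n).hom _) = _
    rw [barCone_symbol, barD_symbol, barD_rho, barD_symbol, barBoundary, barBoundary, map_add,
      map_add, map_sum, map_sum, ← Module.End.mul_apply, ← map_mul, barCone_symbol,
      Fin.sum_univ_succ, contractNth_cons_zero]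
    have h1 : ∑ j : Fin (n + 1), (-1 : k) ^ (j.succ.val + 1) •
        barSymbol k G (Fin.contractNth j.succ (· * ·) (Fin.cons γ s : Fin (n + 2) → G)) =
        -∑ j : Fin (n + 1), barCone n ((BarModule k G n).ρ γ
          ((-1 : k) ^ (j.val + 1) • barSymbol k G (j.contractNth (· * ·) s))) := by
      rw [← Finset.sum_neg_distrib]
      refine Finset.sum_congr rfl fun j _ => ?_
      rw [map_smul, map_smul, barCone_symbol, contractNth_cons_succ, Fin.val_succ, pow_succ,
        mul_neg_one]
      exact neg_smul _ _
    rw [h1, Fin.cons_zero, Fin.val_zero, zero_add, pow_one, neg_one_smul]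
    simp only [Fin.cons_succ, LinearMap.id_apply]
    abel
  exact LinearMap.congr_fun key b

lemma barD_barCone_zero (b : (BarModule k G 0).V) :
    (barD k G 0).hom (barCone 0 b) + ((barAug k G).hom b : k) • barSymbol k G (![] : Fin 0 → G) =
      b := by
  have key : (barD k G 0).hom.toLinearMap ∘ₗ barCone 0 +
      (LinearMap.toSpanSingleton k _ (barSymbol k G (![] : Fin 0 → G))) ∘ₗ
        (barAug k G).hom.toLinearMap = LinearMap.id := by
    refine bar_hom_ext fun γ s => ?_
    change (barD k G 0).hom (barCone 0 _) + ((barAug k G).hom _ : k) • barSymbol k G ![] = _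
    have h : ((barAug k G).hom ((BarModule k G 0).ρ γ (barSymbol k G s)) : k) = 1 :=
      (Rep.hom_comm_apply (barAug k G) γ _).trans (barAug_symbol (k := k) (G := G) s)
    rw [barCone_symbol, barD_symbol, barBoundary, h, Fin.sum_univ_one, Subsingleton.elim s ![],
      Subsingleton.elim (fun i : Fin 0 => (Fin.cons γ ![] : Fin 1 → G) i.succ) ![],
      Subsingleton.elim (Fin.contractNth 0 (· * ·) (Fin.cons γ ![] : Fin 1 → G)) ![]]
    simp
  exact LinearMap.congr_fun key b

end BarCone

/-! ### The rows of the double complex -/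

section Rows

variable {k : Type} [CommRing k]

variable {G : Type} [Group G] {X : Type} [TopologicalSpace X] [MulAction G X]
  [ContinuousConstSMul G X]

/-- The class of `c ⊗ b` in `S_p ⊗ B_q` over the group ring. -/
def tensorMk {p q : ℕ} (c : (Sing k (TopCat.of X)).X p) (b : (BarModule k G q).V) :
    biK k G X p q :=
  Rep.coinvariantsTensorMk ((singRepComplex k G X).X p) ((barResolution k G).X q) c b

/-- Translation of singular chains. -/
def smulChain (γ : G) {p : ℕ} (c : (Sing k (TopCat.of X)).X p) : (Sing k (TopCat.of X)).X p :=
  ((singMap k (translation G X γ)).f p).hom c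

lemma tensorMk_smul_smul {p q : ℕ} (γ : G) (c : (Sing k (TopCat.of X)).X p)
    (b : (BarModule k G q).V) :
    tensorMk (smulChain γ c) ((BarModule k G q).ρ γ b) = tensorMk c b :=
  Representation.Coinvariants.mk_self_apply
    (((singRepComplex k G X).X p).ρ.tprod ((barResolution k G).X q).ρ) γ
    (TensorProduct.tmul k c b)

lemma smulChain_simplexChain (γ : G) {p : ℕ} (σ : C(stdSimplex ℝ (Fin (p + 1)), X)) :
    smulChain γ (simplexChain k (X := TopCat.of X) σ) =
      simplexChain k (X := TopCat.of X) (γ • σ : C(stdSimplex ℝ (Fin (p + 1)), X)) :=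
  singMap_simplexChain _ _

lemma tensorMk_add_left {p q : ℕ} (c c' : (Sing k (TopCat.of X)).X p) (b : (BarModule k G q).V) :
    tensorMk (c + c') b = tensorMk c b + tensorMk c' b :=
  LinearMap.map_add₂ (Rep.coinvariantsTensorMk ((singRepComplex k G X).X p)
    ((barResolution k G).X q)) _ _ _

lemma tensorMk_add_right {p q : ℕ} (c : (Sing k (TopCat.of X)).X p) (b b' : (BarModule k G q).V) :
    tensorMk c (b + b') = tensorMk c b + tensorMk c b' :=
  map_add (Rep.coinvariantsTensorMk ((singRepComplex k G X).X p)
    ((barResolution k G).X q) c) _ _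

lemma tensorMk_smul_right {p q : ℕ} (c : (Sing k (TopCat.of X)).X p) (r : k)
    (b : (BarModule k G q).V) : tensorMk c (r • b) = r • tensorMk c b :=
  map_smul (Rep.coinvariantsTensorMk ((singRepComplex k G X).X p)
    ((barResolution k G).X q) c) _ _

lemma biK_hom_ext {p q : ℕ} {M : Type} [AddCommGroup M] [Module k M]
    {f g : biK k G X p q →ₗ[k] M}
    (h : ∀ (σ : C(stdSimplex ℝ (Fin (p + 1)), X)) (b : (BarModule k G q).V),
      f (tensorMk (simplexChain k (X := TopCat.of X) σ) b) =
        g (tensorMk (simplexChain k (X := TopCat.of X) σ) b)) : f = g := by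
  refine Representation.Coinvariants.hom_ext (TensorProduct.ext' fun c b => ?_)
  exact LinearMap.congr_fun (sing_linearMap_ext (X := TopCat.of X)
    (f := f ∘ₗ (Rep.coinvariantsTensorMk ((singRepComplex k G X).X p)
      ((barResolution k G).X q)).flip b)
    (g := g ∘ₗ (Rep.coinvariantsTensorMk ((singRepComplex k G X).X p)
      ((barResolution k G).X q)).flip b) fun σ => h σ b) c

/-- The differential `∂'` of the singular chains. -/
def dH (p q : ℕ) : biK k G X (p + 1) q →ₗ[k] biK k G X p q :=
  (((tensorZG k G).map ((singRepComplex k G X).d (p + 1) p)).app ((barResolution k G).X q)).hom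

/-- The differential `∂''` of the bar resolution, without the sign `(-1)ᵖ` of the total complex. -/
def dV (p q : ℕ) : biK k G X p (q + 1) →ₗ[k] biK k G X p q :=
  (((tensorZG k G).obj ((singRepComplex k G X).X p)).map ((barResolution k G).d (q + 1) q)).hom

lemma dH_tensorMk {p q : ℕ} (c : (Sing k (TopCat.of X)).X (p + 1)) (b : (BarModule k G q).V) :
    dH p q (tensorMk c b) = tensorMk (((Sing k (TopCat.of X)).d (p + 1) p).hom c) b := rfl

lemma dV_tensorMk {p q : ℕ} (c : (Sing k (TopCat.of X)).X p) (b : (BarModule k G (q + 1)).V) :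
    dV p q (tensorMk c b) = tensorMk c ((barD k G q).hom b) := by
  have e : (barResolution k G).d (q + 1) q = barD k G q := by
    unfold barResolution
    simp
  have : dV p q (tensorMk c b) = tensorMk c (((barResolution k G).d (q + 1) q).hom b) := rfl
  rw [this, e]
  rfl

variable (G X) in
/-- The representative of the orbit of a simplex. -/
def orbitRep {p : ℕ} (σ : C(stdSimplex ℝ (Fin (p + 1)), X)) : C(stdSimplex ℝ (Fin (p + 1)), X) :=
  (Quotient.mk (MulAction.orbitRel G C(stdSimplex ℝ (Fin (p + 1)), X)) σ).out

lemma exists_smul_orbitRep {p : ℕ} (σ : C(stdSimplex ℝ (Fin (p + 1)), X)) :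
    ∃ γ : G, γ • orbitRep G X σ = σ := by
  obtain ⟨γ, hγ⟩ := Quotient.mk_out (s := MulAction.orbitRel G C(stdSimplex ℝ (Fin (p + 1)), X)) σ
  exact ⟨γ⁻¹, inv_smul_eq_iff.2 hγ.symm⟩

variable (G X) in
/-- The element that translates the representative of the orbit of a simplex to the simplex. -/
def orbitElt {p : ℕ} (σ : C(stdSimplex ℝ (Fin (p + 1)), X)) : G :=
  (exists_smul_orbitRep (G := G) σ).choose

lemma orbitElt_smul_orbitRep {p : ℕ} (σ : C(stdSimplex ℝ (Fin (p + 1)), X)) :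
    orbitElt G X σ • orbitRep G X σ = σ := (exists_smul_orbitRep (G := G) σ).choose_spec

lemma orbitRep_smul {p : ℕ} (γ : G) (σ : C(stdSimplex ℝ (Fin (p + 1)), X)) :
    orbitRep G X (γ • σ) = orbitRep G X σ :=
  congrArg Quotient.out (Quotient.sound ⟨γ, rfl⟩)

lemma tensorMk_orbitRep {p q : ℕ} (σ : C(stdSimplex ℝ (Fin (p + 1)), X))
    (b : (BarModule k G q).V) :
    tensorMk (simplexChain k (X := TopCat.of X) (orbitRep G X σ))
        ((BarModule k G q).ρ (orbitElt G X σ)⁻¹ b) =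
      tensorMk (simplexChain k (X := TopCat.of X) σ) b := by
  rw [← tensorMk_smul_smul (orbitElt G X σ), smulChain_simplexChain, orbitElt_smul_orbitRep,
    ← Module.End.mul_apply, ← map_mul, mul_inv_cancel, map_one, Module.End.one_apply]

variable (k G X) in
/-- The bilinear map underlying `rowCone`. -/
def rowConeBilin (p q : ℕ) :
    (Sing k (TopCat.of X)).X p →ₗ[k] (BarModule k G q).V →ₗ[k] biK k G X p (q + 1) :=
  singLift (X := TopCat.of X) fun σ : C(stdSimplex ℝ (Fin (p + 1)), X) =>
    Rep.coinvariantsTensorMk ((singRepComplex k G X).X p) ((barResolution k G).X (q + 1))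
      (simplexChain k (X := TopCat.of X) (orbitRep G X σ)) ∘ₗ barCone q ∘ₗ
        (BarModule k G q).ρ (orbitElt G X σ)⁻¹

lemma rowConeBilin_simplexChain {p q : ℕ} (σ : C(stdSimplex ℝ (Fin (p + 1)), X))
    (b : (BarModule k G q).V) :
    rowConeBilin k G X p q (simplexChain k (X := TopCat.of X) σ) b =
      tensorMk (simplexChain k (X := TopCat.of X) (orbitRep G X σ))
        (barCone q ((BarModule k G q).ρ (orbitElt G X σ)⁻¹ b)) := by
  rw [rowConeBilin, singLift_simplexChain]
  rfl

variable (G X) in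
/-- Simplices of the quotient lift to `X`, uniquely up to translation. -/
structure LiftsSimplices : Prop where
  exists_lift : ∀ (p : ℕ) (τ : C(stdSimplex ℝ (Fin (p + 1)), MulAction.orbitRel.Quotient G X)),
    ∃ σ : C(stdSimplex ℝ (Fin (p + 1)), X), (orbitMap G X).hom.comp σ = τ
  exists_smul_eq : ∀ (p : ℕ) (σ σ' : C(stdSimplex ℝ (Fin (p + 1)), X)),
    (orbitMap G X).hom.comp σ = (orbitMap G X).hom.comp σ' → ∃ γ : G, γ • σ' = σ

/-- The section `τ ↦ σ₀ ⊗ [ ]` of the augmentation `σ ⊗ [ ] ↦ π σ`, with `σ₀` the representative of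
the orbit of lifts of `τ`. -/
def augSection (h : LiftsSimplices G X) (p : ℕ) :
    (Sing k (TopCat.of (MulAction.orbitRel.Quotient G X))).X p →ₗ[k] biK k G X p 0 :=
  singLift (X := TopCat.of (MulAction.orbitRel.Quotient G X)) fun τ =>
    tensorMk (simplexChain k (X := TopCat.of X) (orbitRep G X (h.exists_lift p τ).choose))
      (barSymbol k G ![])

lemma biKAug_tensorMk {p : ℕ} (σ : C(stdSimplex ℝ (Fin (p + 1)), X)) (b : (BarModule k G 0).V) :
    (biKAug k G X p).hom (tensorMk (simplexChain k (X := TopCat.of X) σ) b) =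
      ((barAug k G).hom b : k) • simplexChain k (X := TopCat.of (MulAction.orbitRel.Quotient G X))
        ((orbitMap G X).hom.comp σ) := by
  rw [← singMap_simplexChain]
  exact biKAug_mk k G X p _ b

lemma barAug_rho (γ : G) (b : (BarModule k G 0).V) :
    ((barAug k G).hom ((BarModule k G 0).ρ γ b) : k) = (barAug k G).hom b :=
  Rep.hom_comm_apply (barAug k G) γ b

lemma orbitMap_comp_orbitRep {p : ℕ} (σ : C(stdSimplex ℝ (Fin (p + 1)), X)) :
    (orbitMap G X).hom.comp (orbitRep G X σ) = (orbitMap G X).hom.comp σ := by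
  obtain ⟨γ, hγ⟩ := exists_smul_orbitRep (G := G) σ
  nth_rewrite 2 [← hγ]
  ext x
  exact (Quotient.sound ⟨γ, rfl⟩ : (Quotient.mk (MulAction.orbitRel G X) (γ • orbitRep G X σ x)) =
    Quotient.mk _ (orbitRep G X σ x)).symm

lemma biKAug_surjective (h : LiftsSimplices G X) (p : ℕ) :
    Function.Surjective (biKAug k G X p).hom := by
  intro c
  refine ⟨augSection h p c, ?_⟩
  have key : (biKAug k G X p).hom ∘ₗ augSection h p = LinearMap.id := by
    refine sing_linearMap_ext fun τ => ?_
    change (biKAug k G X p).hom (augSection h p (simplexChain k τ)) = simplexChain k τ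
    rw [augSection, singLift_simplexChain, biKAug_tensorMk, barAug_symbol, one_smul,
      orbitMap_comp_orbitRep, (h.exists_lift p τ).choose_spec]
  exact LinearMap.congr_fun key c

variable [IsCancelSMul G X]

/-- The translating element is equivariant because the action is free. -/
lemma orbitElt_smul {p : ℕ} (γ : G) (σ : C(stdSimplex ℝ (Fin (p + 1)), X)) :
    orbitElt G X (γ • σ) = γ * orbitElt G X σ := by
  have h := orbitElt_smul_orbitRep (G := G) (γ • σ)
  have h2 : γ • σ = (γ * orbitElt G X σ) • orbitRep G X σ := by
    rw [mul_smul, orbitElt_smul_orbitRep]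
  rw [orbitRep_smul] at h
  have h' := DFunLike.congr_fun (h.trans h2) (stdSimplex.vertex 0)
  exact IsCancelSMul.right_cancel _ _ _ h'

lemma rowConeBilin_smul_smul {p q : ℕ} (γ : G) (c : (Sing k (TopCat.of X)).X p)
    (b : (BarModule k G q).V) :
    rowConeBilin k G X p q (smulChain γ c) ((BarModule k G q).ρ γ b) =
      rowConeBilin k G X p q c b := by
  refine LinearMap.congr_fun (sing_linearMap_ext (X := TopCat.of X)
    (f := (rowConeBilin k G X p q).flip ((BarModule k G q).ρ γ b) ∘ₗ
      ((singMap k (translation G X γ)).f p).hom)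
    (g := (rowConeBilin k G X p q).flip b) fun σ => ?_) c
  change rowConeBilin k G X p q (smulChain γ (simplexChain k σ)) _ =
    rowConeBilin k G X p q (simplexChain k σ) b
  rw [smulChain_simplexChain, rowConeBilin_simplexChain, rowConeBilin_simplexChain, orbitRep_smul,
    orbitElt_smul, ← Module.End.mul_apply, ← map_mul, mul_inv_rev, inv_mul_cancel_right]

/-- The contraction of the rows of the double complex: `σ ⊗ b` is written `σ₀ ⊗ b'` with the
representative `σ₀` of the orbit of `σ`, and the contraction of the bar resolution is applied to
`b'`. -/
def rowCone (p q : ℕ) : biK k G X p q →ₗ[k] biK k G X p (q + 1) :=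
  Representation.Coinvariants.lift _ (TensorProduct.lift (rowConeBilin k G X p q)) fun γ =>
    TensorProduct.ext' fun c b => rowConeBilin_smul_smul γ c b

lemma rowCone_tensorMk {p q : ℕ} (σ : C(stdSimplex ℝ (Fin (p + 1)), X))
    (b : (BarModule k G q).V) :
    rowCone p q (tensorMk (simplexChain k (X := TopCat.of X) σ) b) =
      tensorMk (simplexChain k (X := TopCat.of X) (orbitRep G X σ))
        (barCone q ((BarModule k G q).ρ (orbitElt G X σ)⁻¹ b)) :=
  rowConeBilin_simplexChain σ b

lemma dV_rowCone_succ {p q : ℕ} (x : biK k G X p (q + 1)) :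
    dV p (q + 1) (rowCone p (q + 1) x) + rowCone p q (dV p q x) = x := by
  have key : dV p (q + 1) ∘ₗ rowCone p (q + 1) + rowCone p q ∘ₗ dV p q =
      (LinearMap.id : biK k G X p (q + 1) →ₗ[k] _) := by
    refine biK_hom_ext fun σ b => ?_
    change dV p (q + 1) (rowCone p (q + 1) (tensorMk (simplexChain k σ) b)) +
      rowCone p q (dV p q (tensorMk (simplexChain k σ) b)) = tensorMk (simplexChain k σ) b
    rw [rowCone_tensorMk, dV_tensorMk, dV_tensorMk, rowCone_tensorMk, ← barD_rho,
      ← tensorMk_add_right, barD_barCone_succ, tensorMk_orbitRep]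
  exact LinearMap.congr_fun key x

/-- Exactness of the rows in positive degrees. -/
lemma exists_dV_eq {p q : ℕ} {x : biK k G X p (q + 1)} (hx : dV p q x = 0) :
    ∃ y, dV p (q + 1) y = x := by
  refine ⟨rowCone p (q + 1) x, ?_⟩
  have := dV_rowCone_succ x
  rwa [hx, map_zero, add_zero] at this

lemma dV_rowCone_zero (h : LiftsSimplices G X) {p : ℕ} (x : biK k G X p 0) :
    dV p 0 (rowCone p 0 x) + augSection h p ((biKAug k G X p).hom x) = x := by
  have key : dV p 0 ∘ₗ rowCone p 0 + augSection h p ∘ₗ (biKAug k G X p).hom =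
      (LinearMap.id : biK k G X p 0 →ₗ[k] _) := by
    refine biK_hom_ext fun σ b => ?_
    change dV p 0 (rowCone p 0 (tensorMk (simplexChain k σ) b)) +
      augSection h p ((biKAug k G X p).hom (tensorMk (simplexChain k σ) b)) =
        tensorMk (simplexChain k σ) b
    have hrep : orbitRep G X (h.exists_lift p ((orbitMap G X).hom.comp σ)).choose =
        orbitRep G X σ := by
      obtain ⟨γ, hγ⟩ := h.exists_smul_eq p _ _
        (h.exists_lift p ((orbitMap G X).hom.comp σ)).choose_spec
      rw [← hγ, orbitRep_smul]
    rw [rowCone_tensorMk, dV_tensorMk, biKAug_tensorMk, map_smul, augSection, singLift_simplexChain,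
      hrep, ← tensorMk_smul_right, ← barAug_rho (orbitElt G X σ)⁻¹ b, ← tensorMk_add_right,
      barD_barCone_zero, tensorMk_orbitRep]
  exact LinearMap.congr_fun key x

/-- Exactness of the augmented rows in degree zero. -/
lemma exists_dV_eq_of_aug (h : LiftsSimplices G X) {p : ℕ} {x : biK k G X p 0}
    (hx : (biKAug k G X p).hom x = 0) : ∃ y, dV p 0 y = x := by
  refine ⟨rowCone p 0 x, ?_⟩
  have := dV_rowCone_zero h x
  rwa [hx, map_zero, add_zero] at this

end Rows

/-! ### The augmentation is an isomorphism on homology -/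

section Zigzag

variable {k : Type} [CommRing k] {G : Type} [Group G] {X : Type} [TopologicalSpace X]
  [MulAction G X] [ContinuousConstSMul G X]

lemma dH_dH {p q : ℕ} (x : biK k G X (p + 2) q) : dH p q (dH (p + 1) q x) = 0 := by
  have key : dH p q ∘ₗ dH (p + 1) q = (0 : biK k G X (p + 2) q →ₗ[k] _) := by
    refine biK_hom_ext fun σ b => ?_
    change dH p q (dH (p + 1) q (tensorMk (simplexChain k σ) b)) = 0
    have h := congrArg (fun f => f.hom (simplexChain k (X := TopCat.of X) σ))
      ((Sing k (TopCat.of X)).d_comp_d (p + 2) (p + 1) p)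
    rw [dH_tensorMk, dH_tensorMk]
    refine (congrArg (fun c => tensorMk c b) h).trans ?_
    exact LinearMap.map_zero₂ (Rep.coinvariantsTensorMk ((singRepComplex k G X).X p)
      ((barResolution k G).X q)) b
  exact LinearMap.congr_fun key x

lemma dH_dV {p q : ℕ} (x : biK k G X (p + 1) (q + 1)) :
    dH p q (dV (p + 1) q x) = dV p q (dH p (q + 1) x) := by
  have key : dH p q ∘ₗ dV (p + 1) q =
      (dV p q ∘ₗ dH p (q + 1) : biK k G X (p + 1) (q + 1) →ₗ[k] _) := by
    refine biK_hom_ext fun σ b => ?_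
    change dH p q (dV (p + 1) q (tensorMk (simplexChain k σ) b)) =
      dV p q (dH p (q + 1) (tensorMk (simplexChain k σ) b))
    rw [dH_tensorMk, dV_tensorMk, dH_tensorMk, dV_tensorMk]
  exact LinearMap.congr_fun key x

lemma biKAug_dH {p : ℕ} (x : biK k G X (p + 1) 0) :
    (biKAug k G X p).hom (dH p 0 x) =
      ((Sing k (TopCat.of (MulAction.orbitRel.Quotient G X))).d (p + 1) p).hom
        ((biKAug k G X (p + 1)).hom x) :=
  congrArg (fun f => f.hom x) (biKAug_d k G X p)

lemma totK_d_inTot (p q n m : ℕ) (h : p + q = n) (x : biK k G X p q) :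
    ((totK k G X).d n m).hom (inTot k G X p q n h x) =
      (HomologicalComplex.mapBifunctor.d₁ (singRepComplex k G X) (barResolution k G)
        (tensorZG k G) (ComplexShape.down ℕ) p q m).hom x +
      (HomologicalComplex.mapBifunctor.d₂ (singRepComplex k G X) (barResolution k G)
        (tensorZG k G) (ComplexShape.down ℕ) p q m).hom x := by
  have e : HomologicalComplex.ιMapBifunctor (singRepComplex k G X) (barResolution k G)
      (tensorZG k G) (ComplexShape.down ℕ) p q n h ≫ (totK k G X).d n m =
      HomologicalComplex.mapBifunctor.d₁ _ _ _ _ p q m +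
        HomologicalComplex.mapBifunctor.d₂ _ _ _ _ p q m := by
    rw [HomologicalComplex.mapBifunctor.d_eq, Preadditive.comp_add,
      HomologicalComplex.mapBifunctor.ι_D₁, HomologicalComplex.mapBifunctor.ι_D₂]
  exact congrArg (fun f => f.hom x) e

lemma d₁_apply_succ (p q m : ℕ) (h : p + q = m) (x : biK k G X (p + 1) q) :
    (HomologicalComplex.mapBifunctor.d₁ (singRepComplex k G X) (barResolution k G)
        (tensorZG k G) (ComplexShape.down ℕ) (p + 1) q m).hom x =
      inTot k G X p q m h (dH p q x) := by
  rw [HomologicalComplex.mapBifunctor.d₁_eq _ _ _ _ (i₁' := p) (by simp) q m h]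
  erw [one_smul]
  rfl

lemma d₁_apply_zero (q m : ℕ) (x : biK k G X 0 q) :
    (HomologicalComplex.mapBifunctor.d₁ (singRepComplex k G X) (barResolution k G)
        (tensorZG k G) (ComplexShape.down ℕ) 0 q m).hom x = 0 := by
  rw [HomologicalComplex.mapBifunctor.d₁_eq_zero _ _ _ _ _ _ _ (by simp)]
  rfl

lemma d₂_apply_zero (p m : ℕ) (x : biK k G X p 0) :
    (HomologicalComplex.mapBifunctor.d₂ (singRepComplex k G X) (barResolution k G)
        (tensorZG k G) (ComplexShape.down ℕ) p 0 m).hom x = 0 := by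
  rw [HomologicalComplex.mapBifunctor.d₂_eq_zero _ _ _ _ _ _ _ (by simp)]
  rfl

lemma d₂_apply_succ (p q m : ℕ) (h : p + q = m) (x : biK k G X p (q + 1)) :
    (HomologicalComplex.mapBifunctor.d₂ (singRepComplex k G X) (barResolution k G)
        (tensorZG k G) (ComplexShape.down ℕ) p (q + 1) m).hom x =
      (-1 : k) ^ p • inTot k G X p q m h (dV p q x) := by
  rw [HomologicalComplex.mapBifunctor.d₂_eq _ _ _ _ p (i₂ := q + 1) (i₂' := q) (by simp) m h]
  have hε : ComplexShape.ε₂ (ComplexShape.down ℕ) (ComplexShape.down ℕ) (ComplexShape.down ℕ)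
      (p, q + 1) = (-1 : ℤˣ) ^ p := rfl
  rw [hε]
  rcases Nat.even_or_odd p with hp | hp
  · rw [hp.neg_one_pow, hp.neg_one_pow, one_smul, one_smul]
    rfl
  · rw [hp.neg_one_pow, hp.neg_one_pow, Units.neg_smul, one_smul, neg_one_smul]
    rfl

/-- The projection of the degree `n` part of the total complex to `K_{p,q}`; it is zero unless
`p + q = n`. -/
def totProj (p q n : ℕ) : (totK k G X).X n ⟶ biK k G X p q :=
  HomologicalComplex.mapBifunctorDesc fun p' q' _ =>
    if h : p' = p ∧ q' = q then eqToHom (by rw [h.1, h.2]) else 0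

lemma totProj_inTot_self (p q n : ℕ) (h : p + q = n) (x : biK k G X p q) :
    (totProj p q n).hom (inTot k G X p q n h x) = x := by
  have e := HomologicalComplex.ι_mapBifunctorDesc (K₁ := singRepComplex k G X)
    (K₂ := barResolution k G) (F := tensorZG k G) (c := ComplexShape.down ℕ)
    (A := biK k G X p q) (j := n) (fun p' q' _ =>
      if h : p' = p ∧ q' = q then eqToHom (by rw [h.1, h.2]) else 0) p q h
  rw [dif_pos ⟨rfl, rfl⟩, eqToHom_refl] at e
  exact congrArg (fun f => f.hom x) e

lemma totProj_inTot_of_ne (p q p' q' n : ℕ) (h : p' + q' = n) (hne : p' ≠ p)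
    (x : biK k G X p' q') : (totProj p q n).hom (inTot k G X p' q' n h x) = 0 := by
  have e := HomologicalComplex.ι_mapBifunctorDesc (K₁ := singRepComplex k G X)
    (K₂ := barResolution k G) (F := tensorZG k G) (c := ComplexShape.down ℕ)
    (A := biK k G X p q) (j := n) (fun p' q' _ =>
      if h : p' = p ∧ q' = q then eqToHom (by rw [h.1, h.2]) else 0) p' q' h
  rw [dif_neg fun h => hne h.1] at e
  exact congrArg (fun f => f.hom x) e

lemma exists_eq_inTot_add (x : (totK k G X).X 2) :
    ∃ (a : biK k G X 2 0) (b : biK k G X 1 1) (c : biK k G X 0 2),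
      x = inTot k G X 2 0 2 rfl a + inTot k G X 1 1 2 rfl b + inTot k G X 0 2 2 rfl c := by
  refine ⟨(totProj 2 0 2).hom x, (totProj 1 1 2).hom x, (totProj 0 2 2).hom x, ?_⟩
  have key : 𝟙 ((totK k G X).X 2) =
      totProj 2 0 2 ≫ ModuleCat.ofHom (inTot k G X 2 0 2 rfl) +
      totProj 1 1 2 ≫ ModuleCat.ofHom (inTot k G X 1 1 2 rfl) +
      totProj 0 2 2 ≫ ModuleCat.ofHom (inTot k G X 0 2 2 rfl) := by
    refine HomologicalComplex.mapBifunctor.hom_ext fun p q h => ?_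
    refine ModuleCat.hom_ext (LinearMap.ext fun y => ?_)
    have h' : p + q = 2 := h
    change inTot k G X p q 2 h' y =
      inTot k G X 2 0 2 rfl ((totProj 2 0 2).hom (inTot k G X p q 2 h' y)) +
      inTot k G X 1 1 2 rfl ((totProj 1 1 2).hom (inTot k G X p q 2 h' y)) +
      inTot k G X 0 2 2 rfl ((totProj 0 2 2).hom (inTot k G X p q 2 h' y))
    obtain ⟨rfl, rfl⟩ | ⟨rfl, rfl⟩ | ⟨rfl, rfl⟩ : (p = 2 ∧ q = 0) ∨ (p = 1 ∧ q = 1) ∨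
      (p = 0 ∧ q = 2) := by omega
    · rw [totProj_inTot_self, totProj_inTot_of_ne 1 1 2 0 2 rfl (by simp),
        totProj_inTot_of_ne 0 2 2 0 2 rfl (by simp), map_zero, map_zero, add_zero, add_zero]
    · rw [totProj_inTot_self, totProj_inTot_of_ne 2 0 1 1 2 rfl (by simp),
        totProj_inTot_of_ne 0 2 1 1 2 rfl (by simp), map_zero, map_zero, add_zero, zero_add]
    · rw [totProj_inTot_self, totProj_inTot_of_ne 1 1 0 2 2 rfl (by simp),
        totProj_inTot_of_ne 2 0 0 2 2 rfl (by simp), map_zero, map_zero, add_zero, zero_add]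
  exact congrArg (fun f => f.hom x) key

/-- The differential of the total complex in degree `2`. -/
lemma totK_d_two (a : biK k G X 2 0) (b : biK k G X 1 1) (c : biK k G X 0 2) :
    ((totK k G X).d 2 1).hom
      (inTot k G X 2 0 2 rfl a + inTot k G X 1 1 2 rfl b + inTot k G X 0 2 2 rfl c) =
      inTot k G X 1 0 1 rfl (dH 1 0 a - dV 1 0 b) + inTot k G X 0 1 1 rfl (dH 0 1 b + dV 0 1 c) := by
  rw [map_add, map_add, totK_d_inTot, totK_d_inTot, totK_d_inTot, d₁_apply_succ 1 0 1 rfl,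
    d₁_apply_succ 0 1 1 rfl, d₁_apply_zero, d₂_apply_zero, d₂_apply_succ 1 0 1 rfl,
    d₂_apply_succ 0 1 1 rfl, map_add, map_sub, pow_one, pow_zero, one_smul, neg_one_smul]
  abel

lemma totK_d_three (y₃ : biK k G X 3 0) (y₂ : biK k G X 2 1) (y₁ : biK k G X 1 2)
    (y₀ : biK k G X 0 3) :
    ((totK k G X).d 3 2).hom
      (inTot k G X 3 0 3 rfl y₃ + inTot k G X 2 1 3 rfl y₂ + inTot k G X 1 2 3 rfl y₁ +
        inTot k G X 0 3 3 rfl y₀) =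
      inTot k G X 2 0 2 rfl (dH 2 0 y₃ + dV 2 0 y₂) + inTot k G X 1 1 2 rfl (dH 1 1 y₂ - dV 1 1 y₁) +
        inTot k G X 0 2 2 rfl (dH 0 2 y₁ + dV 0 2 y₀) := by
  rw [map_add, map_add, map_add, totK_d_inTot, totK_d_inTot, totK_d_inTot, totK_d_inTot,
    d₁_apply_succ 2 0 2 rfl, d₁_apply_succ 1 1 2 rfl, d₁_apply_succ 0 2 2 rfl, d₁_apply_zero,
    d₂_apply_zero, d₂_apply_succ 2 0 2 rfl, d₂_apply_succ 1 1 2 rfl, d₂_apply_succ 0 2 2 rfl,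
    map_add, map_sub, map_add, pow_one, pow_zero, one_smul, neg_one_smul, neg_one_sq, one_smul]
  abel

lemma totK_d_two_eq_zero_iff {a : biK k G X 2 0} {b : biK k G X 1 1} {c : biK k G X 0 2} :
    ((totK k G X).d 2 1).hom
      (inTot k G X 2 0 2 rfl a + inTot k G X 1 1 2 rfl b + inTot k G X 0 2 2 rfl c) = 0 ↔
      dH 1 0 a = dV 1 0 b ∧ dH 0 1 b + dV 0 1 c = 0 := by
  rw [totK_d_two]
  constructor
  · intro h
    have h1 := congrArg (totProj 1 0 1).hom h
    have h2 := congrArg (totProj 0 1 1).hom h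
    rw [map_add, totProj_inTot_self, totProj_inTot_of_ne 1 0 0 1 1 rfl (by simp), map_zero,
      add_zero, sub_eq_zero] at h1
    rw [map_add, totProj_inTot_self, totProj_inTot_of_ne 0 1 1 0 1 rfl (by simp), map_zero,
      zero_add] at h2
    exact ⟨h1, h2⟩
  · rintro ⟨h1, h2⟩
    rw [h1, h2, sub_self, map_zero, map_zero, add_zero]

lemma totAug_inTot_zero (x : biK k G X 2 0) :
    ((totAug k G X).f 2).hom (inTot k G X 2 0 2 rfl x) = (biKAug k G X 2).hom x := by
  have e := HomologicalComplex.ι_mapBifunctorDesc (K₁ := singRepComplex k G X)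
    (K₂ := barResolution k G) (F := tensorZG k G) (c := ComplexShape.down ℕ)
    (j := 2) (totAugComponent k G X 2) 2 0 rfl
  refine (congrArg (fun f => f.hom x) e).trans ?_
  exact congrArg (fun f => f.hom x) (Category.comp_id (biKAug k G X 2))

lemma totAug_inTot_succ (p q : ℕ) (h : p + (q + 1) = 2) (x : biK k G X p (q + 1)) :
    ((totAug k G X).f 2).hom (inTot k G X p (q + 1) 2 h x) = 0 := by
  have e := HomologicalComplex.ι_mapBifunctorDesc (K₁ := singRepComplex k G X)
    (K₂ := barResolution k G) (F := tensorZG k G) (c := ComplexShape.down ℕ)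
    (j := 2) (totAugComponent k G X 2) p (q + 1) h
  exact congrArg (fun f => f.hom x) e

lemma totAug_two (a : biK k G X 2 0) (b : biK k G X 1 1) (c : biK k G X 0 2) :
    ((totAug k G X).f 2).hom
      (inTot k G X 2 0 2 rfl a + inTot k G X 1 1 2 rfl b + inTot k G X 0 2 2 rfl c) =
      (biKAug k G X 2).hom a := by
  rw [map_add, map_add, totAug_inTot_zero, totAug_inTot_succ 1 0 rfl, totAug_inTot_succ 0 1 rfl,
    add_zero, add_zero]

variable [IsCancelSMul G X]

/-- A `2`-cycle of the quotient lifts to the total complex, by a zigzag through the exact rows. -/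
lemma exists_totAug_eq (hL : LiftsSimplices G X)
    {z : (Sing k (TopCat.of (MulAction.orbitRel.Quotient G X))).X 2}
    (hz : ((Sing k (TopCat.of (MulAction.orbitRel.Quotient G X))).d 2 1).hom z = 0) :
    ∃ x, ((totK k G X).d 2 1).hom x = 0 ∧ ((totAug k G X).f 2).hom x = z := by
  obtain ⟨a, rfl⟩ := biKAug_surjective (G := G) (X := X) hL 2 z
  obtain ⟨b, hb⟩ := exists_dV_eq_of_aug hL (x := dH 1 0 a) (by rw [biKAug_dH, hz])
  obtain ⟨c, hc⟩ := exists_dV_eq (x := -dH 0 1 b) (by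
    rw [map_neg, ← dH_dV, hb, dH_dH, neg_zero])
  refine ⟨_, totK_d_two_eq_zero_iff.2 ⟨hb.symm, ?_⟩, totAug_two a b c⟩
  rw [hc, add_neg_cancel]

/-- A `2`-cycle of the total complex bounds if its augmentation does, by a zigzag through the exact
rows. -/
lemma exists_totK_d_eq (hL : LiftsSimplices G X) {x : (totK k G X).X 2}
    (hx : ((totK k G X).d 2 1).hom x = 0)
    {w : (Sing k (TopCat.of (MulAction.orbitRel.Quotient G X))).X 3}
    (hw : ((Sing k (TopCat.of (MulAction.orbitRel.Quotient G X))).d 3 2).hom w =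
      ((totAug k G X).f 2).hom x) : ∃ y, ((totK k G X).d 3 2).hom y = x := by
  obtain ⟨a, b, c, rfl⟩ := exists_eq_inTot_add x
  rw [totAug_two] at hw
  obtain ⟨h1, h2⟩ := totK_d_two_eq_zero_iff.1 hx
  obtain ⟨y₃, rfl⟩ := biKAug_surjective (G := G) (X := X) hL 3 w
  obtain ⟨y₂, h₂⟩ := exists_dV_eq_of_aug hL (x := a - dH 2 0 y₃) (by
    rw [map_sub, biKAug_dH, hw, sub_self])
  obtain ⟨y₁, h₁⟩ := exists_dV_eq (x := dH 1 1 y₂ - b) (by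
    rw [map_sub, ← dH_dV, h₂, map_sub, dH_dH, sub_zero, h1, sub_self])
  obtain ⟨y₀, h₀⟩ := exists_dV_eq (x := c - dH 0 2 y₁) (by
    rw [map_sub, ← dH_dV, h₁, map_sub, dH_dH, zero_sub, sub_neg_eq_add, add_comm, h2])
  refine ⟨_, (totK_d_three y₃ y₂ y₁ y₀).trans ?_⟩
  rw [h₂, h₁, h₀, add_sub_cancel, sub_sub_cancel, add_sub_cancel]

end Zigzag

section Covering

variable {G : Type} [Group G] {X : Type} [TopologicalSpace X]
  [MulAction G X] [ContinuousConstSMul G X]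

/-- Maps from the simply connected standard simplices lift through a covering map. -/
lemma liftsSimplices_of_isCoveringMap
    (hcov : IsCoveringMap (Quotient.mk (MulAction.orbitRel G X))) : LiftsSimplices G X := by
  have hsimply (p : ℕ) : SimplyConnectedSpace (stdSimplex ℝ (Fin (p + 1))) := by
    have := (convex_stdSimplex ℝ (Fin (p + 1))).contractibleSpace ⟨_, (stdSimplex.vertex 0).2⟩
    infer_instance
  have hloc (p : ℕ) : LocallyPathConnectedSpace (stdSimplex ℝ (Fin (p + 1))) :=
    (convex_stdSimplex ℝ (Fin (p + 1))).locallyPathConnectedSpace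
  refine ⟨fun p τ => ?_, fun p σ σ' h => ?_⟩
  · obtain ⟨x, hx⟩ := Quotient.mk_surjective (τ (stdSimplex.vertex 0))
    obtain ⟨F, ⟨-, hF⟩, -⟩ := hcov.existsUnique_continuousMap_lifts τ (stdSimplex.vertex 0) x hx
    exact ⟨F, ContinuousMap.ext fun t => congrFun hF t⟩
  · have h0 := DFunLike.congr_fun h (stdSimplex.vertex 0)
    obtain ⟨γ, hγ⟩ : ∃ γ : G, γ • σ' (stdSimplex.vertex 0) = σ (stdSimplex.vertex 0) :=
      Quotient.exact h0
    refine ⟨γ, ?_⟩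
    obtain ⟨F, -, hF⟩ := hcov.existsUnique_continuousMap_lifts ((orbitMap G X).hom.comp σ)
      (stdSimplex.vertex 0) (σ (stdSimplex.vertex 0)) rfl
    rw [hF σ ⟨rfl, rfl⟩]
    refine hF _ ⟨hγ, ?_⟩
    rw [h]
    funext t
    exact Quotient.sound ⟨γ, rfl⟩

end Covering

section Bijective

variable {Γ : Subgroup PSL(2, ℝ)}

lemma liftsSimplices_of_properlyDiscontinuousSMul [ProperlyDiscontinuousSMul Γ ℍ]
    [IsCancelSMul Γ ℍ] : LiftsSimplices Γ ℍ :=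
  liftsSimplices_of_isCoveringMap
    isQuotientCoveringMap_quotientMk_of_properlyDiscontinuousSMul.isCoveringMap

lemma d_totAug_eq_zero {x : (totK ℤ Γ ℍ).X 2} (hx : ((totK ℤ Γ ℍ).d 2 1).hom x = 0) :
    ((Sing ℤ (surface Γ)).d 2 1).hom (((totAug ℤ Γ ℍ).f 2).hom x) = 0 := by
  have h := moduleCat_hom_congr ((totAug ℤ Γ ℍ).comm 2 1) x
  refine h.trans ?_
  exact (congrArg ((totAug ℤ Γ ℍ).f 1).hom hx).trans (map_zero _)

/-- The augmentation induces an isomorphism `H₂(Tot K) ≅ H₂(X, ℤ)`. -/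
lemma bijective_homologyMap_totAug [ProperlyDiscontinuousSMul Γ ℍ] [IsCancelSMul Γ ℍ] :
    Function.Bijective (HomologicalComplex.homologyMap (totAug ℤ Γ ℍ) 2).hom := by
  have hL := liftsSimplices_of_properlyDiscontinuousSMul (Γ := Γ)
  constructor
  · intro u v huv
    obtain ⟨x, hx, rfl⟩ := homologyClass_surjective u
    obtain ⟨y, hy, rfl⟩ := homologyClass_surjective v
    rw [homologyMap_homologyClass _ x hx (d_totAug_eq_zero hx),
      homologyMap_homologyClass _ y hy (d_totAug_eq_zero hy), homologyClass_eq_iff] at huv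
    obtain ⟨w, hw⟩ := huv
    rw [homologyClass_eq_iff]
    exact exists_totK_d_eq hL (by rw [map_sub, hx, hy, sub_zero]) (hw.trans (map_sub _ _ _).symm)
  · intro u
    obtain ⟨z, hz, rfl⟩ := homologyClass_surjective u
    obtain ⟨x, hx, rfl⟩ := exists_totAug_eq (G := Γ) (X := ℍ) hL hz
    exact ⟨homologyClass ℤ _ x hx, homologyMap_homologyClass _ x hx hz⟩

end Bijective

/-! ### The cycle of a canonical polygon -/

section BarFormulas

variable {k : Type} [CommRing k] {G : Type} [Group G] {X : Type} [TopologicalSpace X]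
  [MulAction G X] [ContinuousConstSMul G X]

lemma tensorMk_rho {p q : ℕ} (γ : G) (c : (Sing k (TopCat.of X)).X p) (b : (BarModule k G q).V) :
    tensorMk c ((BarModule k G q).ρ γ b) = tensorMk (smulChain γ⁻¹ c) b := by
  rw [← tensorMk_smul_smul γ⁻¹, ← Module.End.mul_apply, ← map_mul, inv_mul_cancel, map_one,
    Module.End.one_apply]

lemma tensorMk_sub_left {p q : ℕ} (c c' : (Sing k (TopCat.of X)).X p) (b : (BarModule k G q).V) :
    tensorMk (c - c') b = tensorMk c b - tensorMk c' b := by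
  rw [eq_sub_iff_add_eq, ← tensorMk_add_left, sub_add_cancel]

lemma tensorMk_sum_left {p q : ℕ} {ι : Type} (s : Finset ι) (c : ι → (Sing k (TopCat.of X)).X p)
    (b : (BarModule k G q).V) : tensorMk (∑ i ∈ s, c i) b = ∑ i ∈ s, tensorMk (c i) b :=
  LinearMap.map_sum₂ (Rep.coinvariantsTensorMk ((singRepComplex k G X).X p)
    ((barResolution k G).X q)) _ _ _

lemma barBoundary_one (x : G) : barBoundary k G ![x] =
    (BarModule k G 0).ρ x (barSymbol k G ![]) - barSymbol k G ![] := by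
  rw [barBoundary, Fin.sum_univ_one, Subsingleton.elim (fun i : Fin 0 => (![x] : Fin 1 → G) i.succ) ![],
    Subsingleton.elim (Fin.contractNth 0 (· * ·) (![x] : Fin 1 → G)) ![], sub_eq_add_neg]
  have h : (-1 : k) ^ ((0 : Fin (0 + 1)).val + 1) = -1 := by simp
  rw [h]
  exact congrArg (_ + ·) (neg_one_smul k _)

lemma barBoundary_two (x y : G) : barBoundary k G ![x, y] =
    (BarModule k G 1).ρ x (barSymbol k G ![y]) - barSymbol k G ![x * y] + barSymbol k G ![x] := by
  have e1 : (fun i : Fin 1 => (![x, y] : Fin 2 → G) i.succ) = ![y] := by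
    funext i; fin_cases i; rfl
  have e2 : Fin.contractNth 0 (· * ·) (![x, y] : Fin 2 → G) = ![x * y] := by
    funext i; fin_cases i; rfl
  have e3 : Fin.contractNth 1 (· * ·) (![x, y] : Fin 2 → G) = ![x] := by
    funext i; fin_cases i; rfl
  rw [barBoundary, Fin.sum_univ_two, e1, e2, e3, Fin.val_zero, Fin.val_one, zero_add, pow_one,
    neg_one_sq, one_smul, sub_eq_add_neg, add_assoc]
  exact congrArg (_ + ·) (congrArg (· + _) (neg_one_smul k _))

lemma tensorMk_sub_right {p q : ℕ} (c : (Sing k (TopCat.of X)).X p) (b b' : (BarModule k G q).V) :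
    tensorMk c (b - b') = tensorMk c b - tensorMk c b' := by
  rw [eq_sub_iff_add_eq, ← tensorMk_add_right, sub_add_cancel]

lemma dV_one {p : ℕ} (c : (Sing k (TopCat.of X)).X p) (x : G) :
    dV p 0 (chainTensor k G X c ![x]) =
      chainTensor k G X (smulChain x⁻¹ c) ![] - chainTensor k G X c ![] := by
  refine (dV_tensorMk c (barSymbol k G ![x])).trans ?_
  rw [barD_symbol, barBoundary_one, tensorMk_sub_right, tensorMk_rho]
  rfl

lemma dV_two {p : ℕ} (c : (Sing k (TopCat.of X)).X p) (x y : G) :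
    dV p 1 (chainTensor k G X c ![x, y]) =
      chainTensor k G X (smulChain x⁻¹ c) ![y] - chainTensor k G X c ![x * y] +
        chainTensor k G X c ![x] := by
  refine (dV_tensorMk c (barSymbol k G ![x, y])).trans ?_
  rw [barD_symbol, barBoundary_two, tensorMk_add_right, tensorMk_sub_right, tensorMk_rho]
  rfl

lemma chainTensor_one {p : ℕ} (c : (Sing k (TopCat.of X)).X p) :
    chainTensor k G X c ![(1 : G)] = 0 := by
  rw [chainTensor, barSymbol_eq_zero _ 0 rfl]
  exact map_zero (Rep.coinvariantsTensorMk ((singRepComplex k G X).X p)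
    ((barResolution k G).X 1) c)

lemma biKAug_chainTensor {p : ℕ} (c : (Sing k (TopCat.of X)).X p) :
    (biKAug k G X p).hom (chainTensor k G X c ![]) = ((singMap k (orbitMap G X)).f p).hom c := by
  refine (biKAug_mk k G X p c (barSymbol k G ![])).trans ?_
  rw [barAug_symbol, one_smul]

end BarFormulas

section Polygon

variable {Γ : Subgroup PSL(2, ℝ)}

lemma stdFace_zero_apply_one (x : stdSimplex ℝ (Fin 1)) : stdFace 0 0 x 1 = 1 := by
  change stdSimplex.map (Fin.succAbove 0) x 1 = 1
  have hx := x.2.2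
  rw [Fin.sum_univ_one] at hx
  rw [stdSimplex.map_coe, FunOnFinite.linearMap_apply_apply, Finset.sum_filter, Fin.sum_univ_one]
  exact (if_pos rfl).trans hx

lemma stdFace_one_apply_one (x : stdSimplex ℝ (Fin 1)) : stdFace 0 1 x 1 = 0 := by
  change stdSimplex.map (Fin.succAbove 1) x 1 = 0
  rw [stdSimplex.map_coe, FunOnFinite.linearMap_apply_apply]
  exact Finset.sum_eq_zero fun j hj => absurd (Finset.mem_filter.1 hj).2 (Fin.succAbove_ne 1 j)

lemma d_pathChain (p : C(unitInterval, ℍ)) :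
    ((Sing ℤ (TopCat.of ℍ)).d 1 0).hom (pathChain p) = pointChain (p 1) - pointChain (p 0) := by
  refine (singEquiv (TopCat.of ℍ) 0).injective ?_
  rw [singEquiv_d, pathChain, singEquiv_simplexChain, dS_single, map_sub, pointChain, pointChain,
    singEquiv_simplexChain, singEquiv_simplexChain, Fin.sum_univ_two, Fin.val_zero, Fin.val_one,
    pow_zero, pow_one, one_smul, neg_one_smul, ← sub_eq_add_neg]
  refine congrArg₂ (fun σ τ => Finsupp.single σ (1 : ℤ) - Finsupp.single τ 1)
    (ContinuousMap.ext fun x => ?_) (ContinuousMap.ext fun x => ?_)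
  · exact congrArg p (Subtype.ext (stdFace_zero_apply_one x))
  · exact congrArg p (Subtype.ext (stdFace_one_apply_one x))

lemma smulChain_pointChain (γ : Γ) (v : ℍ) : smulChain γ (pointChain v) = pointChain (γ • v) :=
  smulChain_simplexChain _ _

lemma smulChain_inv_pathChain (γ : Γ) (p : C(unitInterval, ℍ)) :
    smulChain γ⁻¹ (pathChain p) = pathChain (pullPath γ p) := smulChain_simplexChain _ _

lemma prod_groupComm_eq_one {g : ℕ} {α β : Fin g → Γ} (h : IsMarking α β) :
    (List.ofFn fun i => groupComm (α i) (β i)).prod = 1 := by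
  have h1 : (List.ofFn fun i : Fin g =>
      groupComm (FreeGroup.of (Sum.inl i : Fin g ⊕ Fin g)) (FreeGroup.of (Sum.inr i))).prod ∈
      (FreeGroup.lift (Sum.elim α β)).ker := by
    rw [h.2]
    exact Subgroup.subset_normalClosure rfl
  rw [MonoidHom.mem_ker, map_list_prod, List.map_ofFn] at h1
  rw [← h1]
  congr 2
  funext i
  simp [groupComm]

/-- The product `γ_g⁻¹ ⋯ γ_{i+1}⁻¹` of the inverses of the commutators, for indices that start at
`1`. -/
def tailProd {g : ℕ} (α β : Fin g → Γ) (i : ℕ) : Γ :=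
  (((List.ofFn fun j => (groupComm (α j) (β j))⁻¹).drop i).reverse).prod

lemma tailProd_length {g : ℕ} (α β : Fin g → Γ) : tailProd α β g = 1 := by
  rw [tailProd, List.drop_eq_nil_of_le (by simp), List.reverse_nil, List.prod_nil]

lemma tailProd_zero {g : ℕ} {α β : Fin g → Γ} (h : IsMarking α β) : tailProd α β 0 = 1 := by
  have h1 := List.prod_inv_reverse (List.ofFn fun i => groupComm (α i) (β i))
  rw [prod_groupComm_eq_one h, inv_one, List.map_ofFn] at h1
  exact h1.symm

lemma tailProd_succ_mul {g : ℕ} (α β : Fin g → Γ) (i : Fin g) :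
    tailProd α β (i.val + 1) * (groupComm (α i) (β i))⁻¹ = tailProd α β i.val := by
  have h := List.drop_eq_getElem_cons (l := List.ofFn fun j => (groupComm (α j) (β j))⁻¹)
    (i := i.val) (by simp)
  rw [List.getElem_ofFn] at h
  rw [tailProd, tailProd, h, List.reverse_cons, List.prod_append, List.prod_singleton]

namespace CanonicalPolygon

variable {g : ℕ} {α β : Fin g → Γ} (P : CanonicalPolygon α β)

lemma a_one (i : Fin g) : P.a i 1 = (β i)⁻¹ • P.b i 0 := P.consecutive i 0

lemma b_one (i : Fin g) : P.b i 1 = (α i)⁻¹ • P.a i 0 := by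
  have h := P.consecutive i 2
  have e1 : polygonSide α β P.a P.b i (Fin.castSucc 2) 1 = (α i)⁻¹ • P.a i (unitInterval.symm 1) :=
    rfl
  have e2 : polygonSide α β P.a P.b i (Fin.succ 2) 0 = P.b i (unitInterval.symm 0) := rfl
  rw [e1, e2, unitInterval.symm_one, unitInterval.symm_zero] at h
  exact h.symm

lemma b_zero (i : Fin g) : P.b i 0 = (groupComm (α i) (β i))⁻¹ • P.a i 0 := by
  have h := P.consecutive i 1
  have e1 : polygonSide α β P.a P.b i (Fin.castSucc 1) 1 = (β i)⁻¹ • P.b i 1 := rfl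
  have e2 : polygonSide α β P.a P.b i (Fin.succ 1) 0 = (α i)⁻¹ • P.a i (unitInterval.symm 0) :=
    rfl
  rw [e1, e2, unitInterval.symm_zero, a_one, b_one, ← mul_smul, ← mul_smul] at h
  rw [← inv_smul_eq_iff, inv_inv]
  calc groupComm (α i) (β i) • P.b i 0
      = (α i * β i) • ((α i)⁻¹ * (β i)⁻¹) • P.b i 0 := by rw [← mul_smul, groupComm]; group
    _ = P.a i 0 := by rw [← h, ← mul_smul]; group; rw [one_smul]

lemma a_finRotate (i : Fin g) : P.a (finRotate g i) 0 = P.b i 0 := by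
  have h := P.consecutive' i
  have e1 : polygonSide α β P.a P.b i 3 1 = P.b i (unitInterval.symm 1) := rfl
  rw [e1, unitInterval.symm_one] at h
  exact h.symm

/-- The boundary of `F` identifies sides in pairs, which is `∂'F = ∂''L`. -/
lemma dH_cornerF : dH 1 0 (cornerF P.chain) = dV 1 0 (edgeL α β P.a P.b) := by
  refine (dH_tensorMk P.chain (barSymbol ℤ Γ ![])).trans ?_
  rw [P.boundary_chain, edgeL, map_sum, tensorMk_sum_left]
  refine Finset.sum_congr rfl fun i _ => ?_
  rw [map_sub, dV_one, dV_one, tensorMk_sub_left, tensorMk_sub_left, tensorMk_add_left,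
    smulChain_inv_pathChain, smulChain_inv_pathChain]
  change tensorMk _ _ + tensorMk _ _ - tensorMk _ _ - tensorMk _ _ =
    tensorMk _ _ - tensorMk _ _ - (tensorMk _ _ - tensorMk _ _)
  abel

/-- The vertex terms with index `i` bound the ends of the edges `a_i` and `b_i`, up to one term
`b_i(0) ⊗ [γ_i⁻¹]`. -/
lemma dV_vertex (i : Fin g) :
    dV 0 1 (chainTensor ℤ Γ ℍ (pointChain (P.a i 0)) ![α i, β i] -
      chainTensor ℤ Γ ℍ (pointChain (P.b i 0)) ![β i, α i] +
      chainTensor ℤ Γ ℍ (pointChain (P.b i 0)) ![(groupComm (α i) (β i))⁻¹, α i * β i]) =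
    dH 0 1 (chainTensor ℤ Γ ℍ (pathChain (P.b i)) ![β i] -
      chainTensor ℤ Γ ℍ (pathChain (P.a i)) ![α i]) +
    chainTensor ℤ Γ ℍ (pointChain (P.b i 0)) ![(groupComm (α i) (β i))⁻¹] := by
  have h1 (p : C(unitInterval, ℍ)) (x : Γ) : dH 0 1 (chainTensor ℤ Γ ℍ (pathChain p) ![x]) =
      chainTensor ℤ Γ ℍ (pointChain (p 1)) ![x] - chainTensor ℤ Γ ℍ (pointChain (p 0)) ![x] := by
    refine (dH_tensorMk (pathChain p) (barSymbol ℤ Γ ![x])).trans ?_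
    rw [d_pathChain, tensorMk_sub_left]
    rfl
  have h2 : (groupComm (α i) (β i))⁻¹ * (α i * β i) = β i * α i := by
    rw [groupComm]; group
  have h3 : groupComm (α i) (β i) • P.b i 0 = P.a i 0 := by rw [P.b_zero, smul_inv_smul]
  rw [map_add, map_sub, map_sub, dV_two, dV_two, dV_two, h1, h1, smulChain_pointChain,
    smulChain_pointChain, smulChain_pointChain, inv_inv, h2, h3, ← P.a_one, ← P.b_one]
  abel

end CanonicalPolygon

/-- The vertex `b_i(0)` is the translate of `b_g(0)` by the product `γ_{i+1} ⋯ γ_g`, for indices that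
start at `1`. -/
lemma CanonicalPolygon.tailProd_inv_smul {m : ℕ} {α β : Fin (m + 1) → Γ}
    (P : CanonicalPolygon α β) (i : Fin (m + 1)) :
    (tailProd α β (i.val + 1))⁻¹ • P.b (Fin.last m) 0 = P.b i 0 := by
  induction i using Fin.reverseInduction with
  | last => rw [Fin.val_last, tailProd_length, inv_one, one_smul]
  | cast i ih =>
    have h1 := tailProd_succ_mul α β i.succ
    have h2 := P.a_finRotate i.castSucc
    rw [finRotate_apply, Fin.coeSucc_eq_succ] at h2
    rw [Fin.val_castSucc, ← Fin.val_succ, ← h1, mul_inv_rev, inv_inv, mul_smul, ih, P.b_zero,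
      smul_inv_smul, h2]

/-- The second part of `V` telescopes: it bounds the terms `b_i(0) ⊗ [γ_i⁻¹]`, because the product of
the commutators is `1`. The index `g` contributes to the sum through the end of the telescope. -/
lemma CanonicalPolygon.dV_tail {m : ℕ} {α β : Fin (m + 1) → Γ} (h : IsMarking α β)
    (P : CanonicalPolygon α β) :
    dV 0 1 (∑ i : Fin (m + 1) with i.val + 1 < m + 1,
      chainTensor ℤ Γ ℍ (pointChain (P.b (Fin.last m) 0))
        ![tailProd α β (i.val + 1), (groupComm (α i) (β i))⁻¹]) =
    ∑ i, chainTensor ℤ Γ ℍ (pointChain (P.b i 0)) ![(groupComm (α i) (β i))⁻¹] := by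
  have hterm (i : Fin (m + 1)) : dV 0 1 (chainTensor ℤ Γ ℍ (pointChain (P.b (Fin.last m) 0))
        ![tailProd α β (i.val + 1), (groupComm (α i) (β i))⁻¹]) =
      chainTensor ℤ Γ ℍ (pointChain (P.b i 0)) ![(groupComm (α i) (β i))⁻¹] +
      (chainTensor ℤ Γ ℍ (pointChain (P.b (Fin.last m) 0)) ![tailProd α β (i.val + 1)] -
        chainTensor ℤ Γ ℍ (pointChain (P.b (Fin.last m) 0)) ![tailProd α β i.val]) := by
    rw [dV_two, smulChain_pointChain, P.tailProd_inv_smul, tailProd_succ_mul]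
    abel
  have htel := Finset.sum_range_sub (fun j => chainTensor ℤ Γ ℍ
    (pointChain (P.b (Fin.last m) 0)) ![tailProd α β j]) m
  have hlast := tailProd_succ_mul α β (Fin.last m)
  rw [Fin.val_last, tailProd_length, one_mul] at hlast
  rw [tailProd_zero h, chainTensor_one, sub_zero, ← hlast] at htel
  rw [map_sum, Finset.sum_filter, Fin.sum_univ_castSucc, if_neg (by simp), add_zero,
    Fin.sum_univ_castSucc, ← htel, ← Fin.sum_univ_eq_sum_range (fun j => chainTensor ℤ Γ ℍ
      (pointChain (P.b (Fin.last m) 0)) ![tailProd α β (j + 1)] - chainTensor ℤ Γ ℍ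
      (pointChain (P.b (Fin.last m) 0)) ![tailProd α β j]), ← Finset.sum_add_distrib]
  refine Finset.sum_congr rfl fun i _ => ?_
  rw [if_pos (by simp), hterm]
  rfl

lemma CanonicalPolygon.dH_edgeL {g : ℕ} (hg : 0 < g) {α β : Fin g → Γ} (h : IsMarking α β)
    (P : CanonicalPolygon α β) :
    dH 0 1 (edgeL α β P.a P.b) = dV 0 1 (vertexV hg α β P.a P.b) := by
  obtain ⟨m, rfl⟩ := Nat.exists_eq_succ_of_ne_zero hg.ne'
  rw [vertexV, map_sub, map_sum, edgeL, map_sum]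
  rw [Finset.sum_congr rfl fun i _ => P.dV_vertex i, Finset.sum_add_distrib]
  refine (eq_sub_iff_add_eq.2 ?_)
  exact congrArg (_ + ·) (P.dV_tail h)

lemma sigmaChain_eq (F : (Sing ℤ (TopCat.of ℍ)).X 2) (L : biK ℤ Γ ℍ 1 1) (V : biK ℤ Γ ℍ 0 2) :
    sigmaChain F L V = inTot ℤ Γ ℍ 2 0 2 rfl (cornerF F) + inTot ℤ Γ ℍ 1 1 2 rfl L +
      inTot ℤ Γ ℍ 0 2 2 rfl (-V) := by
  rw [sigmaChain, map_neg, sub_eq_add_neg]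

/-- The chain `Σ` of a canonical polygon is a cycle. -/
lemma CanonicalPolygon.d_sigmaChain {g : ℕ} (hg : 0 < g) {α β : Fin g → Γ} (h : IsMarking α β)
    (P : CanonicalPolygon α β) :
    ((totK ℤ Γ ℍ).d 2 1).hom
      (sigmaChain P.chain (edgeL α β P.a P.b) (vertexV hg α β P.a P.b)) = 0 := by
  rw [sigmaChain_eq, totK_d_two_eq_zero_iff]
  exact ⟨P.dH_cornerF, by rw [map_neg, P.dH_edgeL hg h, add_neg_cancel]⟩

lemma totAug_sigmaChain (F : (Sing ℤ (TopCat.of ℍ)).X 2) (L : biK ℤ Γ ℍ 1 1) (V : biK ℤ Γ ℍ 0 2) :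
    ((totAug ℤ Γ ℍ).f 2).hom (sigmaChain F L V) = ((singMap ℤ (orbitMap Γ ℍ)).f 2).hom F := by
  rw [sigmaChain_eq, totAug_two]
  exact biKAug_chainTensor F

lemma singEquiv_totAug_sigmaChain (F : (Sing ℤ (TopCat.of ℍ)).X 2) (L : biK ℤ Γ ℍ 1 1)
    (V : biK ℤ Γ ℍ 0 2) :
    singEquiv (surface Γ) 2 (((totAug ℤ Γ ℍ).f 2).hom (sigmaChain F L V)) =
      pushS (proj Γ) 2 (singEquiv _ 2 F) := by
  rw [totAug_sigmaChain, singEquiv_map]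
  rfl

lemma dS_singEquiv_eq_zero {Y : TopCat.{0}} {n : ℕ} {c : (Sing ℤ Y).X (n + 1)}
    (hc : ((Sing ℤ Y).d (n + 1) n).hom c = 0) : dS n (singEquiv Y (n + 1) c) = 0 := by
  rw [← singEquiv_d, hc, map_zero]

lemma dS_pushS_proj_eq_zero {F : (Sing ℤ (TopCat.of ℍ)).X 2} {L : biK ℤ Γ ℍ 1 1}
    {V : biK ℤ Γ ℍ 0 2} (h : ((totK ℤ Γ ℍ).d 2 1).hom (sigmaChain F L V) = 0) :
    dS 1 (pushS (proj Γ) 2 (singEquiv _ 2 F)) = 0 := by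
  rw [← singEquiv_totAug_sigmaChain F L V]
  exact dS_singEquiv_eq_zero (d_totAug_eq_zero h)

variable [CompactSpace (MulAction.orbitRel.Quotient Γ ℍ)]
    [ProperlyDiscontinuousSMul Γ ℍ] [IsCancelSMul Γ ℍ]

/-- A cycle `F + L - V` with a fundamental chain `F` represents the fundamental class. -/
lemma isFundamentalClass_sigmaChain {D : Set ℍ} (hD : IsFundamentalDomain Γ D)
    {F : (Sing ℤ (TopCat.of ℍ)).X 2} (hF : IsFundamentalChain D F) {L : biK ℤ Γ ℍ 1 1}
    {V : biK ℤ Γ ℍ 0 2} (h : ((totK ℤ Γ ℍ).d 2 1).hom (sigmaChain F L V) = 0) :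
    IsFundamentalClass Γ ((HomologicalComplex.homologyMap (totAug ℤ Γ ℍ) 2).hom
      (homologyClass ℤ (totK ℤ Γ ℍ) _ h)) := by
  refine ⟨_, d_totAug_eq_zero h, (homologyMap_homologyClass _ _ h _).symm, fun z => ?_⟩
  rw [hasLocalOrientation_iff, singEquiv_totAug_sigmaChain]
  exact hF.hasLocalOrientation hD (dS_pushS_proj_eq_zero h) z

/-- The fundamental class is determined by its local orientations. -/
lemma IsFundamentalClass.unique {u v : (Sing ℤ (surface Γ)).homology 2}
    (hu : IsFundamentalClass Γ u) (hv : IsFundamentalClass Γ v) : u = v := by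
  obtain ⟨c, hc, rfl, hco⟩ := hu
  obtain ⟨c', hc', rfl, hco'⟩ := hv
  rw [homologyClass_eq_iff]
  obtain ⟨e, he⟩ := exists_dS_eq_of_hasLocalOrientation
    (c := singEquiv (surface Γ) 2 c) (c' := singEquiv (surface Γ) 2 c')
    (dS_singEquiv_eq_zero hc) (dS_singEquiv_eq_zero hc')
    (fun z => (hasLocalOrientation_iff _ _ _).1 (hco z))
    (fun z => (hasLocalOrientation_iff _ _ _).1 (hco' z))
  refine ⟨(singEquiv (surface Γ) 3).symm e, (singEquiv (surface Γ) 2).injective ?_⟩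
  refine (singEquiv_d (n := 2) _).trans ?_
  rw [AddEquiv.apply_symm_apply, map_sub]
  exact he

end Polygon

end

theorem mainTheorem5 (Γ : Subgroup PSL(2, ℝ)) (hΓ : IsStrictlyHyperbolicFuchsian Γ)
    (hX : CompactSpace (MulAction.orbitRel.Quotient Γ ℍ)) :
    Function.Bijective (HomologicalComplex.homologyMap (totAug ℤ Γ ℍ) 2).hom ∧
    (∀ (g : ℕ) (hg : 1 < g) (α β : Fin g → Γ), IsMarking α β →
      ∀ P : CanonicalPolygon α β,
        ∃ h : ((totK ℤ Γ ℍ).d 2 1).hom (sigmaChain P.chain (edgeL α β P.a P.b)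
            (vertexV (by omega) α β P.a P.b)) = 0,
          IsFundamentalClass Γ ((HomologicalComplex.homologyMap (totAug ℤ Γ ℍ) 2).hom
            (homologyClass ℤ (totK ℤ Γ ℍ) _ h))) ∧
    (∀ (D D' : Set ℍ) (F F' : (Sing ℤ (TopCat.of ℍ)).X 2)
      (L L' : biK ℤ Γ ℍ 1 1) (V V' : biK ℤ Γ ℍ 0 2),
      IsFundamentalDomain Γ D → IsFundamentalDomain Γ D' →
      IsFundamentalChain D F → IsFundamentalChain D' F' →
      ∀ (h : ((totK ℤ Γ ℍ).d 2 1).hom (sigmaChain F L V) = 0)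
        (h' : ((totK ℤ Γ ℍ).d 2 1).hom (sigmaChain F' L' V') = 0),
        homologyClass ℤ (totK ℤ Γ ℍ) _ h = homologyClass ℤ (totK ℤ Γ ℍ) _ h') := by
  have := properlyDiscontinuousSMul_of_discrete hΓ.discrete
  have := isCancelSMul_of_hyperbolic hΓ
  refine ⟨bijective_homologyMap_totAug, fun g hg α β hαβ P => ?_, ?_⟩
  · exact ⟨P.d_sigmaChain (by omega) hαβ,
      isFundamentalClass_sigmaChain P.fundamentalDomain P.fundamentalChain _⟩
  · intro D D' F F' L L' V V' hD hD' hF hF' h h'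
    exact bijective_homologyMap_totAug.injective
      ((isFundamentalClass_sigmaChain hD hF h).unique (isFundamentalClass_sigmaChain hD' hF' h'))
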